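/- Let $n\ge 3$ be an odd integer and let $\mu\ge 0$ and $\nu^2\ge 0$ be constants. Put $\delta=(\mu-1)^2-4\nu^2$ and let $\sqrt{\delta}$ be its principal square root, so that $\sqrt\delta=i\sqrt{-\delta}$ if $\delta<0$. Let $f\in C^{\frac{n+1}{2}}([0,\infty)\times\mathbb R^n)$, $u_0\in C^{\frac{n+1}{2}+1}(\mathbb R^n)$ and $u_1\in C^{\frac{n+1}{2}}(\mathbb R^n)$ be real-valued. Define the kernels $$E(t,x;b,y)=(1+t)^{-\frac{\mu}{2}+\frac{1-\sqrt\delta}{2}}(1+b)^{\frac{\mu}{2}+\frac{1-\sqrt\delta}{2}}\big((t+b+2)^2-(y-x)^2\big)^{\frac{\sqrt\delta-1}{2}}\,\mathsf F\Big(\tfrac{1-\sqrt\delta}{2},\tfrac{1-\sqrt\delta}{2};1;\tfrac{(t-b)^2-(y-x)^2}{(t+b+2)^2-(y-x)^2}\Big),$$ $$K_0(t,x;y)=-\frac{\partial}{\partial b}E(t,x;b,y)\Big|_{b=0},\qquad K_1(t,x;y)=E(t,x;0,y),$$ where $\mathsf F$ is the Gauss hypergeometric function. For a function $\varphi$ on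 $\mathbb R^n$ put $$w[\varphi](t,x)=\frac{1}{(n-2)!!}\,\frac{\partial}{\partial t}\Big(\frac1t\frac{\partial}{\partial t}\Big)^{\frac{n-3}{2}}\Big(t^{n-2}\,\frac{1}{|\partial B_t(x)|}\int_{\partial B_t(x)}\varphi(z)\,d\sigma_z\Big)$$ (extended by continuity to $t=0$), and let $w[f](t,x;b)=w[f(b,\cdot)](t,x)$. Then the Cauchy problem $$u_{tt}-\Delta u+\frac{\mu}{1+t}u_t+\frac{\nu^2}{(1+t)^2}u=f(t,x)\quad(t>0,\ x\in\mathbb R^n),\qquad u(0,x)=u_0(x),\quad u_t(0,x)=u_1(x)\quad(x\in\mathbb R^n),$$ has a unique classical solution $u\in C^2([0,\infty)\times\mathbb R^n)$, and for all $t\ge 0$ and $x\in\mathbb R^n$ it is given by $$\begin{aligned}u(t,x)={}&(1+t)^{-\frac{\mu}{2}}w[u_0](t,x)+\frac{1}{2^{\sqrt\delta-1}}\int_0^t w[u_0](s,x)\,K_0(t,0;s)\,ds+\frac{1}{2^{\sqrt\delta-1}}\int_0^t w[u_1+\mu u_0](s,x)\,K_1(t,0;s)\,ds\\&+\frac{1}{2^{\sqrt\delta-1}}\int_0^t\int_0^{t-b}w[f](s,x;b)\,E(t,0;b,s)\,ds\,db,\end{aligned}$$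 where all the integrals converge. -/

import Mathlib

open MeasureTheory Set
open scoped Laplacian

noncomputable section

namespace ScaleInvariantWave

/-- The space `ℝⁿ` with its Euclidean norm. -/
abbrev Space (n : ℕ) : Type := EuclideanSpace ℝ (Fin n)

/-- The principal square root `√δ` of the real number `δ = (μ - 1)² - 4ν²`.
It is the usual root for `δ ≥ 0` and `i √(-δ)` for `δ < 0`. -/
def sqrtDelta (μ ν : ℝ) : ℂ := (((μ - 1) ^ 2 - 4 * ν ^ 2 : ℝ) : ℂ) ^ (1 / 2 : ℂ)

/-- The kernel `E(t, x; b, y; μ, ν²)`. -/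
def kernelE (μ ν t x b y : ℝ) : ℂ :=
  ((1 + t : ℝ) : ℂ) ^ (-(μ : ℂ) / 2 + (1 - sqrtDelta μ ν) / 2)
    * ((1 + b : ℝ) : ℂ) ^ ((μ : ℂ) / 2 + (1 - sqrtDelta μ ν) / 2)
    * (((t + b + 2) ^ 2 - (y - x) ^ 2 : ℝ) : ℂ) ^ ((sqrtDelta μ ν - 1) / 2)
    * ordinaryHypergeometric ((1 - sqrtDelta μ ν) / 2) ((1 - sqrtDelta μ ν) / 2) (1 : ℂ)
        ((((t - b) ^ 2 - (y - x) ^ 2) / ((t + b + 2) ^ 2 - (y - x) ^ 2) : ℝ) : ℂ)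

/-- The kernel `K₀(t, x; y; μ, ν²) = - ∂E/∂b (t, x; b, y; μ, ν²)` at `b = 0`. -/
def kernelK0 (μ ν t x y : ℝ) : ℂ := -deriv (fun b : ℝ => kernelE μ ν t x b y) 0

/-- The kernel `K₁(t, x; y; μ, ν²) = E(t, x; 0, y; μ, ν²)`. -/
def kernelK1 (μ ν t x y : ℝ) : ℂ := kernelE μ ν t x 0 y

/-- The mean of `φ` over the sphere of radius `r` about `x`, written as the average of
`φ (x + r ω)` over the unit sphere `|ω| = 1` with its surface measure. -/
def sphericalMean {n : ℕ} (φ : Space n → ℝ) (x : Space n) (r : ℝ) : ℝ :=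
  ⨍ ω : Metric.sphere (0 : Space n) 1, φ (x + r • (ω : Space n)) ∂(volume : Measure (Space n)).toSphere

/-- The operator `(1/t) ∂/∂t`. -/
def radialDeriv (g : ℝ → ℝ) : ℝ → ℝ := fun t => (1 / t) * deriv g t

/-- The classical formula for the solution `w[φ](t, x)`, in odd dimension `n ≥ 3`, of the free wave
equation with data `w(0, ·) = φ`, `w_t(0, ·) = 0`:
`w[φ](t, x) = 1/(n-2)!! ∂/∂t ((1/t) ∂/∂t)^((n-3)/2) (t^(n-2) ⨍_{∂B_t(x)} φ dσ)`.
For `φ = f(b, ·)` this is `w[f](t, x; b)`. -/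
def freeWave {n : ℕ} (φ : Space n → ℝ) (t : ℝ) (x : Space n) : ℝ :=
  1 / (Nat.doubleFactorial (n - 2) : ℝ) *
    deriv (radialDeriv^[(n - 3) / 2] (fun r => r ^ (n - 2) * sphericalMean φ x r)) t

/-- `u` is a classical solution, of class `C²` on `[0, ∞) × ℝⁿ`, of the Cauchy problem
`u_tt - Δu + μ/(1+t) u_t + ν²/(1+t)² u = f` for `t > 0`, `u(0, ·) = u₀`, `u_t(0, ·) = u₁`. -/
structure IsClassicalSolution {n : ℕ} (μ ν : ℝ) (f : ℝ → Space n → ℝ) (u₀ u₁ : Space n → ℝ)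
    (u : ℝ → Space n → ℝ) : Prop where
  contDiffOn : ContDiffOn ℝ 2 (fun p : ℝ × Space n => u p.1 p.2) (Ici 0 ×ˢ univ)
  equation : ∀ t : ℝ, 0 < t → ∀ x : Space n,
    deriv (deriv (fun s => u s x)) t - Δ (u t) x + μ / (1 + t) * deriv (fun s => u s x) t
      + ν ^ 2 / (1 + t) ^ 2 * u t x = f t x
  initial : ∀ x : Space n, u 0 x = u₀ x
  initial_deriv : ∀ x : Space n, derivWithin (fun s => u s x) (Ici 0) 0 = u₁ x

end ScaleInvariantWave

end

/-!
The damping term is removed by `u = (1 + t)^{-μ/2} v`, where `v` solves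
`v_tt - Δv + l / (1 + t)² v = (1 + t)^{μ/2} f` with `l = ν² - μ²/4 + μ/2 = (1 - δ)/4`
(`liouville_wave`). Solutions of this equation are obtained from solutions `W(r, b, x)` of the free
wave equation `W_rr = ΔW` through the transmutation
`T(t, b, x) = W(t - b, b, x) + ∫₀^{t-b} W(s, b, x) N(t, b, s) ds`
(`transmute_wave`): integration by parts in `s` shows that `T` is a solution as soon as the kernel
satisfies `N_tt - N_ss + l / (1 + t)² N = 0`, has the right derivative along the diagonal `s = t - b`,
and produces no boundary term at `s = 0`.

Such kernels come from the Riemann function `R = P(q)` of the one-dimensional operator, with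
`q = ((t - b)² - s²) / (4 (1 + t) (1 + b))` and `P` the regular solution of
`q (1 + q) P'' + (1 + 2q) P' + l P = 0` with `P(0) = 1`. Both `N = -∂_s R` and `N = -∂_b R` qualify
(`isTransmutationKernel_kS`, `isTransmutationKernel_kB`), because the potential does not depend on
`b` and `s`. With `a = (1 - √δ)/2` the complex expression `(1 + q)^{-a} F(a, a; 1; q / (1 + q))`
satisfies the same equation, so an energy estimate for the singular equation shows that it is real and
equals `P` on `[0, ∞)` (`exists_profile`). Up to powers of `2`, `1 + t` and `1 + b` it is the
kernel `E` (`kernelE_eq`), also for `δ < 0`.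

The free waves are built from spherical means. Darboux's equation (`darboux`), proved by testing
against radial functions in polar coordinates, turns the iterated operator `(1/r) ∂_r` in odd
dimension `n = 2k + 3` into a function `waveV k F` of class `C²` down to `r = 0`, which solves
the free wave equation with data `V = 0`, `V_r = F` and whose `r`-derivative is `freeWave`
(`dd_dd_waveV`, `freeWave_eq`). The solution is then the sum of the transmutation of
`w[u₀]` with `-∂_b R`, of the transmutation with `-∂_s R` of the free wave whose velocity is
`u₁ + μ/2 u₀`, and of the Duhamel superposition (`superpose_wave`) for the source;
an integration by parts in `s` (`integral_dd_eR_mul_kerR`) and the derivative of `(1 + b)^{μ/2}`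
in `K₀` give the stated formula.

Regularity up to `t = 0` is handled by extending `f`, and in the uniqueness proof the two solutions, to
functions of the same class for all times (`exists_contDiff_extension`). Uniqueness
(`IsClassicalSolution.unique`) is the energy method with a cut-off
whose support shrinks at unit speed.
-/

noncomputable section

namespace ScaleInvariantWave

open scoped Topology ContDiff

/-! ### Directional derivatives and parametric integrals -/

/-- The directional derivative `∂_v h`, as a function on the whole space. -/
def dd {E : Type*} [NormedAddCommGroup E] [NormedSpace ℝ E] (v : E) (h : E → ℝ) : E → ℝ :=
  fun p => fderiv ℝ h p v

section DirectionalDerivative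

variable {E : Type*} [NormedAddCommGroup E] [NormedSpace ℝ E] {g h : E → ℝ} {v w : E}

lemma contDiff_dd {k : ℕ∞ω} (hh : ContDiff ℝ (k + 1) h) : ContDiff ℝ k (dd v h) :=
  (hh.fderiv_right le_rfl).clm_apply contDiff_const

lemma contDiff_dd_one (hh : ContDiff ℝ 2 h) : ContDiff ℝ 1 (dd v h) :=
  contDiff_dd (by simpa [one_add_one_eq_two] using hh)

lemma continuous_dd (hh : ContDiff ℝ 1 h) : Continuous (dd v h) :=
  (contDiff_dd (k := 0) (by simpa using hh)).continuous

lemma continuous_dd_dd (hh : ContDiff ℝ 2 h) : Continuous (dd w (dd v h)) :=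
  continuous_dd (contDiff_dd_one hh)

lemma dd_eq_of_hasFDerivAt {h' : E →L[ℝ] ℝ} {p : E} (hh : HasFDerivAt h h' p) : dd v h p = h' v := by
  rw [dd, hh.fderiv]

/-- The directional derivative is the derivative along any curve with velocity `v`. -/
lemma dd_eq_of_hasDerivAt {p : E} {γ : ℝ → E} {t d : ℝ} (hh : DifferentiableAt ℝ h p)
    (hp : γ t = p) (hγ : HasDerivAt γ v t) (hd : HasDerivAt (fun τ => h (γ τ)) d t) :
    dd v h p = d := by
  subst hp
  exact (hh.hasFDerivAt.comp_hasDerivAt t hγ).unique hd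

lemma hasDerivAt_comp_dd {p : E} {γ : ℝ → E} {t : ℝ} (hh : DifferentiableAt ℝ h p)
    (hp : γ t = p) (hγ : HasDerivAt γ v t) : HasDerivAt (fun τ => h (γ τ)) (dd v h p) t := by
  subst hp
  exact hh.hasFDerivAt.comp_hasDerivAt t hγ

lemma dd_add (hg : Differentiable ℝ g) (hh : Differentiable ℝ h) :
    dd v (fun p => g p + h p) = fun p => dd v g p + dd v h p := by
  ext p; simp [dd, fderiv_fun_add (hg p) (hh p)]

lemma dd_sub (hg : Differentiable ℝ g) (hh : Differentiable ℝ h) :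
    dd v (fun p => g p - h p) = fun p => dd v g p - dd v h p := by
  ext p; simp [dd, fderiv_fun_sub (hg p) (hh p)]

lemma dd_mul (hg : Differentiable ℝ g) (hh : Differentiable ℝ h) :
    dd v (fun p => g p * h p) = fun p => dd v g p * h p + g p * dd v h p := by
  ext p; simp [dd, fderiv_fun_mul (hg p) (hh p)]; ring

lemma dd_const_mul (c : ℝ) (hh : Differentiable ℝ h) :
    dd v (fun p => c * h p) = fun p => c * dd v h p := by
  ext p; simp [dd, fderiv_const_mul (hh p)]

lemma dd_sum {ι : Type*} {s : Finset ι} {g : ι → E → ℝ} (hg : ∀ i ∈ s, Differentiable ℝ (g i)) :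
    dd v (fun p => ∑ i ∈ s, g i p) = fun p => ∑ i ∈ s, dd v (g i) p := by
  ext p; simp [dd, fderiv_fun_sum (fun i hi => hg i hi p)]

lemma dd_comp_clm {E' : Type*} [NormedAddCommGroup E'] [NormedSpace ℝ E'] (L : E' →L[ℝ] E)
    (hh : Differentiable ℝ h) (v : E') : dd v (fun p => h (L p)) = fun p => dd (L v) h (L p) := by
  ext p
  exact dd_eq_of_hasFDerivAt ((hh (L p)).hasFDerivAt.comp p L.hasFDerivAt)

/-- Mixed second derivatives of a `C²` function commute. -/
lemma dd_comm (hh : ContDiff ℝ 2 h) : dd v (dd w h) = dd w (dd v h) := by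
  ext p
  have h1 : DifferentiableAt ℝ (fderiv ℝ h) p :=
    ((hh.fderiv_right (m := 1) (by norm_num)).differentiable one_ne_zero) p
  have key : ∀ a b : E, dd a (dd b h) p = fderiv ℝ (fderiv ℝ h) p a b := by
    intro a b
    have := h1.hasFDerivAt.clm_apply (hasFDerivAt_const b p)
    exact (dd_eq_of_hasFDerivAt (h := dd b h) (v := a) this).trans (by simp)
  rw [key, key]
  exact (hh.contDiffAt.isSymmSndFDerivAt (by simp)) v w

end DirectionalDerivative

section ParametricIntegral

variable {E Q G : Type} [NormedAddCommGroup E] [NormedSpace ℝ E] [FiniteDimensional ℝ E]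
  [NormedAddCommGroup Q] [NormedSpace ℝ Q] [NormedAddCommGroup G] [NormedSpace ℝ G]
  {Y : Type} [TopologicalSpace Y] [SecondCountableTopology Y] [MeasurableSpace Y]
  [OpensMeasurableSpace Y] {μ : Measure Y} [IsLocallyFiniteMeasure μ] {s : Set Y} {ι : Y → Q}

lemma hasFDerivAt_setIntegral {Φ : E × Q → G} (hΦ : ContDiff ℝ 1 Φ) (hs : IsCompact s)
    (hι : Continuous ι) (x : E) :
    HasFDerivAt (fun x => ∫ y in s, Φ (x, ι y) ∂μ)
      (∫ y in s, (fderiv ℝ Φ (x, ι y)).comp (ContinuousLinearMap.inl ℝ E Q) ∂μ) x := by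
  have hμs : μ s < ⊤ := hs.measure_lt_top
  have : IsFiniteMeasure (μ.restrict s) := ⟨by simpa using hμs⟩
  have hc : Continuous (fderiv ℝ Φ) := hΦ.continuous_fderiv one_ne_zero
  have hc' : Continuous (fun p : E × Y =>
      (fderiv ℝ Φ (p.1, ι p.2)).comp (ContinuousLinearMap.inl ℝ E Q)) := by fun_prop
  obtain ⟨M, hM⟩ := ((isCompact_closedBall x 1).prod hs).bddAbove_image hc'.norm.continuousOn
  have hint : ∀ z, Continuous fun y => Φ (z, ι y) := fun z =>
    hΦ.continuous.comp (continuous_const.prodMk hι)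
  have hae : ∀ᵐ y ∂(μ.restrict s), ∀ z ∈ Metric.closedBall x 1,
      ‖(fderiv ℝ Φ (z, ι y)).comp (ContinuousLinearMap.inl ℝ E Q)‖ ≤ M := by
    have hcl : MeasurableSet {y | ∀ z ∈ Metric.closedBall x 1,
        ‖(fderiv ℝ Φ (z, ι y)).comp (ContinuousLinearMap.inl ℝ E Q)‖ ≤ M} := by
      apply IsClosed.measurableSet
      simp only [ofPred_forall]
      refine isClosed_iInter fun z => isClosed_iInter fun _ => ?_
      exact isClosed_le (hc'.comp (continuous_const.prodMk continuous_id)).norm continuous_const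
    rw [ae_restrict_iff hcl]
    filter_upwards with y hy z hz using hM ⟨(z, y), ⟨hz, hy⟩, rfl⟩
  refine hasFDerivAt_integral_of_dominated_of_fderiv_le (bound := fun _ => M)
    (s := Metric.closedBall x 1) (Metric.closedBall_mem_nhds x one_pos)
    (F' := fun x y => (fderiv ℝ Φ (x, ι y)).comp (ContinuousLinearMap.inl ℝ E Q)) ?_ ?_ ?_ hae
    (integrable_const M) ?_
  · filter_upwards with z using (hint z).aestronglyMeasurable
  · obtain ⟨M', hM'⟩ := hs.bddAbove_image (hint x).norm.continuousOn
    refine Integrable.mono' (integrable_const M') (hint x).aestronglyMeasurable ?_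
    rw [ae_restrict_iff (isClosed_le (hint x).norm continuous_const).measurableSet]
    filter_upwards with y hy using hM' ⟨y, hy, rfl⟩
  · exact (hc'.comp (continuous_const.prodMk continuous_id)).aestronglyMeasurable
  · filter_upwards with y z _
    exact ((hΦ.differentiable one_ne_zero) (z, ι y)).hasFDerivAt.comp z
      (hasFDerivAt_prodMk_left z (ι y))

lemma contDiff_setIntegral {k : ℕ} {Φ : E × Q → G} (hΦ : ContDiff ℝ k Φ) (hs : IsCompact s)
    (hι : Continuous ι) : ContDiff ℝ k (fun x => ∫ y in s, Φ (x, ι y) ∂μ) := by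
  induction k generalizing G with
  | zero =>
    refine contDiff_zero.2 (continuous_parametric_integral_of_continuous ?_ hs)
    exact (contDiff_zero.1 hΦ).comp (by fun_prop : Continuous fun p : E × Y => (p.1, ι p.2))
  | succ k ih =>
    push_cast at hΦ ⊢
    refine contDiff_succ_iff_hasFDerivAt.2 ⟨_, ?_, fun x =>
      hasFDerivAt_setIntegral (hΦ.of_le (by simp)) hs hι x⟩
    exact ih (Φ := fun p => (fderiv ℝ Φ p).comp (ContinuousLinearMap.inl ℝ E Q))
      ((hΦ.fderiv_right le_rfl).clm_comp contDiff_const)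

lemma dd_setIntegral {Φ : E × Q → ℝ} (hΦ : ContDiff ℝ 1 Φ) (hs : IsCompact s)
    (hι : Continuous ι) (v : E) :
    dd v (fun x => ∫ y in s, Φ (x, ι y) ∂μ) =
      fun x => ∫ y in s, dd (v, (0 : Q)) Φ (x, ι y) ∂μ := by
  ext x
  refine (dd_eq_of_hasFDerivAt (hasFDerivAt_setIntegral hΦ hs hι x)).trans ?_
  have hc : Continuous (fderiv ℝ Φ) := hΦ.continuous_fderiv one_ne_zero
  have hc' : Continuous fun y =>
      (fderiv ℝ Φ (x, ι y)).comp (ContinuousLinearMap.inl ℝ E Q) := by fun_prop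
  rw [ContinuousLinearMap.integral_apply]
  · rfl
  · have : IsFiniteMeasure (μ.restrict s) := ⟨by simpa using hs.measure_lt_top⟩
    obtain ⟨M', hM'⟩ := hs.bddAbove_image hc'.norm.continuousOn
    refine Integrable.mono' (integrable_const M') hc'.aestronglyMeasurable ?_
    rw [ae_restrict_iff (isClosed_le hc'.norm continuous_const).measurableSet]
    filter_upwards with y hy using hM' ⟨y, hy, rfl⟩

/-- An integral with smooth integrand and smooth upper limit is smooth: the substitution
`s = ρ α(x)` makes the limits constant. -/
lemma contDiff_intervalIntegral {k : ℕ} {Φ : E × ℝ → ℝ} {α : E → ℝ} (hΦ : ContDiff ℝ k Φ)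
    (hα : ContDiff ℝ k α) : ContDiff ℝ k (fun x => ∫ s in (0 : ℝ)..α x, Φ (x, s)) := by
  have h1 : (fun x => ∫ s in (0 : ℝ)..α x, Φ (x, s))
      = fun x => α x * ∫ ρ in Icc (0 : ℝ) 1, Φ (x, α x * ρ) := by
    ext x
    have := intervalIntegral.smul_integral_comp_mul_left (a := 0) (b := 1) (fun s => Φ (x, s)) (α x)
    rw [mul_zero, mul_one, smul_eq_mul] at this
    rw [← this, intervalIntegral.integral_of_le zero_le_one, integral_Icc_eq_integral_Ioc]
  rw [h1]
  refine hα.mul (contDiff_setIntegral (Φ := fun p : E × ℝ => Φ (p.1, α p.1 * p.2)) (ι := id) ?_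
    isCompact_Icc continuous_id)
  exact hΦ.comp (contDiff_fst.prodMk ((hα.comp contDiff_fst).mul contDiff_snd))

/-- Leibniz' rule for a moving upper limit. -/
lemma dd_intervalIntegral {Φ : E × ℝ → ℝ} {α : E → ℝ} (hΦ : ContDiff ℝ 1 Φ)
    (hα : ContDiff ℝ 1 α) (v : E) :
    dd v (fun x => ∫ s in (0 : ℝ)..α x, Φ (x, s)) =
      fun x => dd v α x * Φ (x, α x) + ∫ s in (0 : ℝ)..α x, dd (v, (0 : ℝ)) Φ (x, s) := by
  ext x
  have hΦc := hΦ.continuous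
  have hc : Continuous (fderiv ℝ Φ) := hΦ.continuous_fderiv one_ne_zero
  set f₁ : E → ℝ → E →L[ℝ] ℝ := fun y a =>
    ∫ s in (0 : ℝ)..a, (fderiv ℝ Φ (y, s)).comp (ContinuousLinearMap.inl ℝ E ℝ) with hf₁
  set f₂ : E → ℝ → ℝ →L[ℝ] ℝ := fun y a =>
    ContinuousLinearMap.toSpanSingleton ℝ (Φ (y, a)) with hf₂
  have key := hasStrictFDerivAt_uncurry_coprod (𝕜 := ℝ) (u := (x, α x))
    (f := fun y a => ∫ s in (0 : ℝ)..a, Φ (y, s)) (f₁ := f₁) (f₂ := f₂)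
    (Filter.Eventually.of_forall fun p => by
      have aux : ∀ a b : ℝ, HasFDerivAt (fun y => ∫ s in Ioc a b, Φ (y, s))
          (∫ s in Ioc a b, (fderiv ℝ Φ (p.1, s)).comp (ContinuousLinearMap.inl ℝ E ℝ)) p.1 := by
        intro a b
        have := hasFDerivAt_setIntegral (μ := volume) (ι := id) hΦ (isCompact_Icc (a := a) (b := b))
          continuous_id p.1
        simpa only [integral_Icc_eq_integral_Ioc, id] using this
      exact (aux 0 p.2).sub (aux p.2 0))
    (Filter.Eventually.of_forall fun p =>
      (intervalIntegral.integral_hasDerivAt_right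
        ((by fun_prop : Continuous fun s => Φ (p.1, s)).intervalIntegrable _ _)
        ((by fun_prop : Continuous fun s => Φ (p.1, s)).stronglyMeasurableAtFilter _ _)
        (by fun_prop : Continuous fun s => Φ (p.1, s)).continuousAt).hasFDerivAt)
    (by
      apply Continuous.continuousAt
      have : Continuous (fun q : E × ℝ => ∫ s in (0 : ℝ)..q.2,
          (fderiv ℝ Φ (q.1, s)).comp (ContinuousLinearMap.inl ℝ E ℝ)) := by
        apply intervalIntegral.continuous_parametric_intervalIntegral_of_continuous
        · unfold Function.uncurry; fun_prop
        · fun_prop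
      exact this)
    (by
      apply Continuous.continuousAt
      have : Continuous (fun q : E × ℝ => ContinuousLinearMap.toSpanSingleton ℝ (Φ (q.1, q.2))) :=
        (ContinuousLinearMap.toSpanSingletonCLE (𝕜 := ℝ) (E := ℝ)).continuous.comp (by fun_prop)
      exact this)
  have hα' := (hα.differentiable one_ne_zero x).hasFDerivAt
  have h2 := key.hasFDerivAt.comp x ((hasFDerivAt_id x).prodMk hα')
  refine (dd_eq_of_hasFDerivAt h2).trans ?_
  have h3 : f₁ x (α x) v = ∫ s in (0 : ℝ)..α x, dd (v, (0 : ℝ)) Φ (x, s) := by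
    rw [hf₁]
    simp only
    rw [ContinuousLinearMap.intervalIntegral_apply]
    · rfl
    · exact (by fun_prop : Continuous fun s => (fderiv ℝ Φ (x, s)).comp
        (ContinuousLinearMap.inl ℝ E ℝ)).intervalIntegrable _ _
  have h4 : f₂ x (α x) (fderiv ℝ α x v) = dd v α x * Φ (x, α x) := by
    simp [hf₂, dd]
  rw [← h3, ← h4]
  simp [Function.HasUncurry.uncurry]
  ring

end ParametricIntegral

/-! ### Extension of `C^k` functions across the initial hyperplane -/

section Extension

variable {E : Type*} [NormedAddCommGroup E] [NormedSpace ℝ E]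

/-- Functions with matching Taylor series on two closed sets can be glued. -/
lemma HasFTaylorSeriesUpToOn.piecewise {k : ℕ} {f g : E → ℝ}
    {p q : E → FormalMultilinearSeries ℝ E ℝ} {s t : Set E} [DecidablePred (· ∈ s)]
    (hs : IsClosed s) (ht : IsClosed t) (hst : s ∪ t = univ)
    (hf : HasFTaylorSeriesUpToOn k f p s) (hg : HasFTaylorSeriesUpToOn k g q t)
    (hpq : ∀ m : ℕ, m ≤ k → ∀ x ∈ s ∩ t, p x m = q x m) :
    HasFTaylorSeriesUpToOn k (s.piecewise f g) (s.piecewise p q) univ := by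
  have hps : ∀ m : ℕ, EqOn (fun x => s.piecewise p q x m) (fun x => p x m) s := fun m x hx => by
    simp [hx]
  have hqt : ∀ m : ℕ, m ≤ k → EqOn (fun x => s.piecewise p q x m) (fun x => q x m) t := by
    intro m hm x hx
    by_cases h : x ∈ s
    · simpa [h] using hpq m hm x ⟨h, hx⟩
    · simp [h]
  constructor
  · intro x _
    by_cases h : x ∈ s
    · simpa [h] using hf.zero_eq x h
    · have : x ∈ t := (hst.ge (mem_univ x)).resolve_left h
      simpa [h] using hg.zero_eq x this
  · intro m hm x _
    have hm' : m < k := by exact_mod_cast hm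
    have key : ∀ r : Set E, IsClosed r → ∀ P : E → FormalMultilinearSeries ℝ E ℝ,
        (∀ m : ℕ, m ≤ k → EqOn (fun x => s.piecewise p q x m) (fun x => P x m) r) →
        (∀ x ∈ r, HasFDerivWithinAt (P · m) (P x m.succ).curryLeft r x) →
        HasFDerivWithinAt (fun x => s.piecewise p q x m)
          (s.piecewise p q x m.succ).curryLeft r x := by
      intro r hr P hP hd
      by_cases hx : x ∈ r
      · have h1 := hP (m + 1) hm' hx
        simp only at h1
        rw [h1]
        exact (hd x hx).congr (hP m hm'.le) (hP m hm'.le hx)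
      · exact HasFDerivWithinAt.of_notMem_closure (by rwa [hr.closure_eq])
    rw [← hst]
    exact (key s hs p (fun m _ => hps m) (hf.fderivWithin m hm)).union
      (key t ht q hqt (hg.fderivWithin m hm))
  · intro m hm
    rw [← hst]
    exact ((hf.cont m hm).congr (hps m)).union_of_isClosed
      ((hg.cont m hm).congr (hqt m (by exact_mod_cast hm))) hs ht

lemma HasFTaylorSeriesUpToOn.finsetSum {ι : Type*} {k : ℕ∞ω} {f : ι → E → ℝ}
    {p : ι → E → FormalMultilinearSeries ℝ E ℝ} {s : Set E} (u : Finset ι)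
    (hf : ∀ i ∈ u, HasFTaylorSeriesUpToOn k (f i) (p i) s) :
    HasFTaylorSeriesUpToOn k (fun x => ∑ i ∈ u, f i x) (fun x m => ∑ i ∈ u, p i x m) s := by
  classical
  induction u using Finset.induction_on with
  | empty =>
    constructor
    · intro x _; simp
    · intro m _ x _
      simp only [Finset.sum_empty]
      convert! hasFDerivWithinAt_const (𝕜 := ℝ) (0 : E [×m]→L[ℝ] ℝ) x s using 1
    · intro m _
      simpa using continuousOn_const
  | insert a u ha ih =>
    simp only [Finset.sum_insert ha]
    exact (hf a (by simp)).add (ih fun i hi => hf i (by simp [hi]))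

/-- Coefficients of the higher-order reflection: the moments of order at most `k` at the nodes
`-1, -2, …, -(k + 1)` are all equal to one. -/
lemma exists_reflection_coefficients (k : ℕ) :
    ∃ c : Fin (k + 1) → ℝ, ∀ i ≤ k, ∑ j, c j * (-((j : ℕ) + 1 : ℝ)) ^ i = 1 := by
  set x : Fin (k + 1) → ℝ := fun j => -((j : ℕ) + 1 : ℝ) with hx
  have hinj : Function.Injective x := fun a b hab => by
    have : (a : ℕ) = (b : ℕ) := by
      have : (a : ℝ) = b := by simpa [hx] using hab
      exact_mod_cast this
    exact Fin.ext this
  have hdet : IsUnit (Matrix.vandermonde x).det :=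
    (Matrix.det_vandermonde_ne_zero_iff.2 hinj).isUnit
  refine ⟨Matrix.vecMul (fun _ => 1) (Matrix.vandermonde x)⁻¹, fun i hi => ?_⟩
  have h := congrFun (show Matrix.vecMul (Matrix.vecMul (fun _ => 1) (Matrix.vandermonde x)⁻¹)
    (Matrix.vandermonde x) = fun _ => 1 by
      rw [Matrix.vecMul_vecMul, Matrix.nonsing_inv_mul _ hdet, Matrix.vecMul_one])
    (⟨i, Nat.lt_succ_of_le hi⟩ : Fin (k + 1))
  simpa [Matrix.vecMul, dotProduct, Matrix.vandermonde_apply, hx] using h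

/-- The scaling `(b, x) ↦ (a b, x)`. -/
def timeScaling (E : Type*) [NormedAddCommGroup E] [NormedSpace ℝ E] (a : ℝ) :
    ℝ × E →L[ℝ] ℝ × E :=
  (a • ContinuousLinearMap.fst ℝ ℝ E).prod (ContinuousLinearMap.snd ℝ ℝ E)

lemma multilinear_comp_timeScaling {m : ℕ} (A : (ℝ × E) [×m]→L[ℝ] ℝ) (a : ℝ)
    (v : Fin m → ℝ × E) :
    A (fun i => timeScaling E a (v i)) = ∑ u : Finset (Fin m),
      a ^ u.card * A (u.piecewise (fun i => ((v i).1, 0)) fun i => (0, (v i).2)) := by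
  have h1 : (fun i => timeScaling E a (v i))
      = (fun i => a • ((v i).1, (0 : E))) + fun i => ((0 : ℝ), (v i).2) := by
    ext i <;> simp [timeScaling]
  rw [h1, A.map_add_univ]
  refine Finset.sum_congr rfl fun u _ => ?_
  have h2 := A.toMultilinearMap.map_piecewise_smul (fun _ => a)
    (u.piecewise (fun i => ((v i).1, (0 : E))) fun i => (0, (v i).2)) u
  rw [Finset.prod_const, smul_eq_mul] at h2
  rw [ContinuousMultilinearMap.coe_coe] at h2
  rw [← h2]
  congr 1
  ext1 i
  by_cases hi : i ∈ u <;> simp [hi]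

/-- A `C^k` function on the closed half-space `[0, ∞) × E` extends to a `C^k` function on
`ℝ × E`, by a higher-order reflection `f(-b, x) = ∑ cⱼ f((j + 1) b, x)`. -/
theorem exists_contDiff_extension {k : ℕ} {f : ℝ × E → ℝ}
    (hf : ContDiffOn ℝ k f (Ici 0 ×ˢ univ)) :
    ∃ F : ℝ × E → ℝ, ContDiff ℝ k F ∧ ∀ t, 0 ≤ t → ∀ x, F (t, x) = f (t, x) := by
  classical
  obtain ⟨c, hc⟩ := exists_reflection_coefficients k
  set s : Set (ℝ × E) := Ici 0 ×ˢ univ with hs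
  set t : Set (ℝ × E) := Iic 0 ×ˢ univ with ht
  have hsu : UniqueDiffOn ℝ s := (uniqueDiffOn_Ici 0).prod uniqueDiffOn_univ
  set p := ftaylorSeriesWithin ℝ f s with hp
  have hfp : HasFTaylorSeriesUpToOn k f p s := hf.ftaylorSeriesWithin hsu
  set L : Fin (k + 1) → (ℝ × E →L[ℝ] ℝ × E) := fun j => timeScaling E (-((j : ℕ) + 1 : ℝ)) with hL
  have hterm : ∀ j ∈ (Finset.univ : Finset (Fin (k + 1))),
      HasFTaylorSeriesUpToOn k (c j • fun x => f (L j x)) (fun x m =>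
        c j • (p (L j x) m).compContinuousLinearMap fun _ => L j) t := by
    intro j _
    have h1 := (hfp.compContinuousLinearMap (L j)).mono (s := L j ⁻¹' s) (t := t) (by
      rintro ⟨b, x⟩ hb
      have hb' : b ≤ 0 := by simpa [ht] using hb
      have : (0 : ℝ) ≤ (-((j : ℕ) + 1 : ℝ)) * b :=
        mul_nonneg_of_nonpos_of_nonpos (by linarith [Nat.cast_nonneg (α := ℝ) (j : ℕ)]) hb'
      simpa [hs, hL, timeScaling] using this)
    exact h1.continuousLinearMap_comp (c j • ContinuousLinearMap.id ℝ ℝ)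
  have hg := HasFTaylorSeriesUpToOn.finsetSum Finset.univ hterm
  have hsc : IsClosed s := isClosed_Ici.prod isClosed_univ
  have htc : IsClosed t := isClosed_Iic.prod isClosed_univ
  have hst : s ∪ t = univ := by
    ext ⟨b, x⟩; simp [hs, ht, le_total]
  refine ⟨_, contDiffOn_univ.1 ((HasFTaylorSeriesUpToOn.piecewise hsc htc hst hfp hg ?_).contDiffOn
    (n := (k : ℕ∞))), ?_⟩
  · rintro m hm ⟨b, x⟩ ⟨hb, hb'⟩
    have hb0 : b = 0 := le_antisymm (by simpa [ht] using hb') (by simpa [hs] using hb)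
    subst hb0
    have hLx : ∀ j, L j (0, x) = (0, x) := fun j => by simp [hL, timeScaling]
    ext v
    simp only [hLx, sum_apply, smul_apply,
      ContinuousMultilinearMap.compContinuousLinearMap_apply, smul_eq_mul]
    -- Expanding into time and space directions, the coefficient of a term with `|u|` time directions is
    -- `∑ cⱼ (-(j + 1))^|u| = 1`, so that the two Taylor series agree on `b = 0`.
    simp only [hL, multilinear_comp_timeScaling, Finset.mul_sum]
    rw [Finset.sum_comm]
    have h1 := multilinear_comp_timeScaling (p (0, x) m) 1 v
    have h2 : (fun i => timeScaling E 1 (v i)) = v := by ext i <;> simp [timeScaling]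
    rw [h2] at h1
    rw [h1]
    refine Finset.sum_congr rfl fun u _ => ?_
    have hu := hc u.card ((Finset.card_le_univ u).trans (by simpa using hm))
    simp only [← mul_assoc]
    rw [← Finset.sum_mul, hu, one_pow]
  · intro b hb x
    have : (b, x) ∈ s := by simpa [hs] using hb
    simp [this]

end Extension

/-! ### Classical solutions in terms of directional derivatives -/

section Dictionary

variable {n : ℕ}

/-- The sum of the second derivatives of `h` in the directions `e i`. -/
def lapAlong {E : Type*} [NormedAddCommGroup E] [NormedSpace ℝ E] (e : Fin n → E) (h : E → ℝ) :
    E → ℝ :=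
  fun p => ∑ i, dd (e i) (dd (e i) h) p

/-- The `i`-th spatial unit vector of `ℝ × ℝⁿ`. -/
def eX (i : Fin n) : ℝ × Space n := (0, EuclideanSpace.single i 1)

/-- The temporal unit vector of `ℝ × ℝⁿ`. -/
def eT (n : ℕ) : ℝ × Space n := (1, 0)

variable {E : Type*} [NormedAddCommGroup E] [NormedSpace ℝ E]

lemma hasDerivAt_left {h : ℝ × E → ℝ} (hh : Differentiable ℝ h) (t : ℝ) (x : E) :
    HasDerivAt (fun s => h (s, x)) (dd (1, 0) h (t, x)) t :=
  hasDerivAt_comp_dd (hh _) rfl ((hasDerivAt_id t).prodMk (hasDerivAt_const t x))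

lemma deriv_deriv_left {h : ℝ × E → ℝ} (hh : ContDiff ℝ 2 h) (t : ℝ) (x : E) :
    deriv (deriv fun s => h (s, x)) t = dd (1, 0) (dd (1, 0) h) (t, x) := by
  have h1 : deriv (fun s => h (s, x)) = fun s => dd (1, 0) h (s, x) :=
    funext fun s => (hasDerivAt_left (hh.differentiable two_ne_zero) s x).deriv
  rw [h1]
  exact (hasDerivAt_left ((contDiff_dd_one hh).differentiable one_ne_zero) t x).deriv

lemma fderiv_right {h : ℝ × E → ℝ} (hh : Differentiable ℝ h) (t : ℝ) (x v : E) :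
    fderiv ℝ (fun y => h (t, y)) x v = dd (0, v) h (t, x) := by
  have := (hh (t, x)).hasFDerivAt.comp x (hasFDerivAt_prodMk_right t x)
  exact (dd_eq_of_hasFDerivAt (h := fun y => h (t, y)) (v := v) this).trans (by simp [dd])

lemma laplacian_eq_sum_dd {g : Space n → ℝ} (hg : ContDiff ℝ 2 g) (x : Space n) :
    Δ g x = ∑ i, dd (EuclideanSpace.single i 1) (dd (EuclideanSpace.single i 1) g) x := by
  rw [InnerProductSpace.laplacian_eq_iteratedFDeriv_orthonormalBasis g
    (EuclideanSpace.basisFun (Fin n) ℝ)]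
  refine Finset.sum_congr rfl fun i _ => ?_
  have h1 : DifferentiableAt ℝ (fderiv ℝ g) x :=
    ((hg.fderiv_right (m := 1) (by norm_num)).differentiable one_ne_zero) x
  have := h1.hasFDerivAt.clm_apply (hasFDerivAt_const (EuclideanSpace.single i (1 : ℝ)) x)
  rw [iteratedFDeriv_two_apply]
  exact ((dd_eq_of_hasFDerivAt (h := dd (EuclideanSpace.single i 1) g)
    (v := EuclideanSpace.single i 1) this).trans (by simp)).symm

lemma laplacian_right {h : ℝ × Space n → ℝ} (hh : ContDiff ℝ 2 h) (t : ℝ) (x : Space n) :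
    Δ (fun y => h (t, y)) x = lapAlong eX h (t, x) := by
  rw [laplacian_eq_sum_dd (g := fun y => h (t, y))
    (hh.comp (by fun_prop : ContDiff ℝ 2 fun y : Space n => (t, y)))]
  refine Finset.sum_congr rfl fun i _ => ?_
  have h1 : dd (EuclideanSpace.single i 1) (fun y : Space n => h (t, y))
      = fun y => dd (eX i) h (t, y) :=
    funext fun y => fderiv_right (hh.differentiable two_ne_zero) t y _
  rw [h1]
  exact fderiv_right ((contDiff_dd_one hh).differentiable one_ne_zero) t x _

/-- A globally defined `C²` function `F` that satisfies the equation for positive times and takes the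
initial data restricts to a classical solution. -/
lemma isClassicalSolution_of_contDiff {μ ν : ℝ} {f : ℝ → Space n → ℝ} {u₀ u₁ : Space n → ℝ}
    {F : ℝ × Space n → ℝ} (hF : ContDiff ℝ 2 F)
    (heq : ∀ t, 0 < t → ∀ x, dd (eT n) (dd (eT n) F) (t, x) - lapAlong eX F (t, x)
      + μ / (1 + t) * dd (eT n) F (t, x) + ν ^ 2 / (1 + t) ^ 2 * F (t, x) = f t x)
    (h0 : ∀ x, F (0, x) = u₀ x) (h1 : ∀ x, dd (eT n) F (0, x) = u₁ x) :
    IsClassicalSolution μ ν f u₀ u₁ (fun t x => F (t, x)) where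
  contDiffOn := hF.contDiffOn
  equation t ht x := by
    rw [deriv_deriv_left hF, laplacian_right hF,
      (hasDerivAt_left (hF.differentiable two_ne_zero) t x).deriv]
    exact heq t ht x
  initial := h0
  initial_deriv x := by
    rw [(hasDerivAt_left (hF.differentiable two_ne_zero) 0 x).hasDerivWithinAt.derivWithin
      (uniqueDiffOn_Ici 0 0 self_mem_Ici)]
    exact h1 x

/-- A classical solution is the restriction of a globally defined `C²` function. -/
lemma IsClassicalSolution.exists_contDiff {μ ν : ℝ} {f : ℝ → Space n → ℝ} {u₀ u₁ : Space n → ℝ}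
    {u : ℝ → Space n → ℝ} (hu : IsClassicalSolution μ ν f u₀ u₁ u) :
    ∃ F : ℝ × Space n → ℝ, ContDiff ℝ 2 F ∧ (∀ t, 0 ≤ t → ∀ x, F (t, x) = u t x) ∧
      (∀ t, 0 < t → ∀ x, dd (eT n) (dd (eT n) F) (t, x) - lapAlong eX F (t, x)
        + μ / (1 + t) * dd (eT n) F (t, x) + ν ^ 2 / (1 + t) ^ 2 * F (t, x) = f t x) ∧
      (∀ x, F (0, x) = u₀ x) ∧ ∀ x, dd (eT n) F (0, x) = u₁ x := by
  obtain ⟨F, hF, hFu⟩ := exists_contDiff_extension (k := 2)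
    (f := fun p : ℝ × Space n => u p.1 p.2) (by exact_mod_cast hu.contDiffOn)
  have hF2 : ContDiff ℝ 2 F := by exact_mod_cast hF
  replace hFu : ∀ t, 0 ≤ t → ∀ x, F (t, x) = u t x := hFu
  refine ⟨F, hF2, hFu, fun t ht x => ?_, fun x => (hFu 0 le_rfl x).trans (hu.initial x),
    fun x => ?_⟩
  · have h1 : (fun s => F (s, x)) =ᶠ[𝓝 t] fun s => u s x := by
      filter_upwards [lt_mem_nhds ht] with s hs using hFu s hs.le x
    have h2 : (fun y => F (t, y)) = u t := funext fun y => hFu t ht.le y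
    rw [← hu.equation t ht x, ← h1.deriv.deriv_eq, ← h1.deriv_eq, ← h2, deriv_deriv_left hF2,
      laplacian_right hF2, (hasDerivAt_left (hF2.differentiable two_ne_zero) t x).deriv]
    rfl
  · rw [← hu.initial_deriv x, ← derivWithin_congr (s := Ici 0) (fun s hs => hFu s hs x) (hFu 0 le_rfl x),
      (hasDerivAt_left (hF2.differentiable two_ne_zero) 0 x).hasDerivWithinAt.derivWithin
      (uniqueDiffOn_Ici 0 0 self_mem_Ici)]
    rfl

end Dictionary

/-! ### Uniqueness by the energy method -/

section Uniqueness

lemma integral_dd_eq_zero {E : Type*} [NormedAddCommGroup E] [NormedSpace ℝ E]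
    [FiniteDimensional ℝ E] [MeasurableSpace E] [BorelSpace E] {μ : Measure E}
    [μ.IsAddHaarMeasure] {g : E → ℝ} (hg : ContDiff ℝ 1 g) (hs : HasCompactSupport g) (v : E) :
    ∫ x, dd v g x ∂μ = 0 := by
  have hs' : HasCompactSupport (dd v g) :=
    (hs.fderiv ℝ).comp_left (g := fun A : E →L[ℝ] ℝ => A v) (by simp)
  have h := integral_mul_fderiv_eq_neg_fderiv_mul_of_integrable (μ := μ) (f := fun _ : E => (1 : ℝ))
    (g := g) (v := v) (by simp)
    (by simp only [one_mul]; exact (continuous_dd hg).integrable_of_hasCompactSupport hs')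
    (by simpa using hg.continuous.integrable_of_hasCompactSupport hs)
    (fun _ _ => differentiableAt_const _) (fun x _ => hg.differentiable one_ne_zero x)
  simpa [dd] using h

variable {n : ℕ}

/-- A smooth weight, positive exactly on the region `t + √(1 + |x|²) < R`. The level sets are
spacelike, so that the weighted energy loses nothing to the flux. -/
def coneWeight (R : ℝ) (p : ℝ × Space n) : ℝ :=
  Real.smoothTransition (R - p.1 - √(1 + ‖p.2‖ ^ 2))

lemma contDiff_coneWeight (R : ℝ) : ContDiff ℝ 2 (coneWeight (n := n) R) := by
  have h1 : ContDiff ℝ 2 fun p : ℝ × Space n => √(1 + ‖p.2‖ ^ 2) :=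
    ContDiff.sqrt (contDiff_const.add (contDiff_snd.norm_sq ℝ)) fun p => by positivity
  exact (Real.smoothTransition.contDiff (n := 2)).comp
    ((contDiff_const.sub contDiff_fst).sub h1)

lemma exists_dd_coneWeight (R : ℝ) (p : ℝ × Space n) :
    ∃ c : ℝ, 0 ≤ c ∧ dd (eT n) (coneWeight R) p = -c ∧ ∃ ψ : Fin n → ℝ,
      (∀ i, dd (eX i) (coneWeight R) p = -(c * ψ i)) ∧ ∑ i, ψ i ^ 2 ≤ 1 := by
  set r : ℝ := √(1 + ‖p.2‖ ^ 2) with hr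
  have hr0 : 0 < r := Real.sqrt_pos.2 (by positivity)
  have h1 : HasFDerivAt (fun q : ℝ × Space n => ‖q.2‖ ^ 2)
      ((2 • (innerSL ℝ) p.2).comp (ContinuousLinearMap.snd ℝ ℝ (Space n))) p :=
    (hasStrictFDerivAt_norm_sq p.2).hasFDerivAt.comp p hasFDerivAt_snd
  have h2 := ((h1.const_add 1).sqrt (by positivity))
  have h3 := (((hasFDerivAt_const R p).sub hasFDerivAt_fst).sub h2)
  have h4 := ((Real.smoothTransition.contDiff (n := 1)).differentiable
    one_ne_zero (R - p.1 - r)).hasDerivAt.comp_hasFDerivAt p h3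
  refine ⟨_, Real.smoothTransition.monotone.deriv_nonneg (x := R - p.1 - r), ?_,
    fun i => p.2 i / r, fun i => ?_, ?_⟩
  · refine (dd_eq_of_hasFDerivAt h4).trans ?_
    simp [eT]
  · refine (dd_eq_of_hasFDerivAt h4).trans ?_
    simp [eX, EuclideanSpace.inner_single_right, ← hr]
    field_simp
    simp
  · simp only [div_pow]
    rw [← Finset.sum_div, div_le_one (by positivity), hr, Real.sq_sqrt (by positivity),
      EuclideanSpace.norm_sq_eq]
    simp

/-- The energy density. -/
def energyDensity (F : ℝ × Space n → ℝ) (p : ℝ × Space n) : ℝ :=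
  1 / 2 * (dd (eT n) F p ^ 2 + ∑ i, dd (eX i) F p ^ 2 + F p ^ 2)

lemma contDiff_energyDensity {F : ℝ × Space n → ℝ} (hF : ContDiff ℝ 2 F) :
    ContDiff ℝ 1 (energyDensity F) := by
  have h1 : ∀ v, ContDiff ℝ 1 (dd v F) := fun v => contDiff_dd_one hF
  have h2 : ContDiff ℝ 1 F := hF.of_le (by norm_num)
  exact contDiff_const.mul (((h1 _).pow 2).add (ContDiff.sum fun i _ => (h1 _).pow 2) |>.add
    (h2.pow 2))

lemma dd_energyDensity {F : ℝ × Space n → ℝ} (hF : ContDiff ℝ 2 F) (p : ℝ × Space n) :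
    dd (eT n) (energyDensity F) p = dd (eT n) F p * dd (eT n) (dd (eT n) F) p
      + ∑ i, dd (eX i) F p * dd (eX i) (dd (eT n) F) p + F p * dd (eT n) F p := by
  have h1 : ∀ v, HasFDerivAt (dd v F) (fderiv ℝ (dd v F) p) p := fun v =>
    ((contDiff_dd_one hF).differentiable one_ne_zero p).hasFDerivAt
  have h2 := (hF.differentiable two_ne_zero p).hasFDerivAt
  have h3 := ((((h1 (eT n)).pow 2).add (HasFDerivAt.fun_sum (u := Finset.univ)
    fun i _ => (h1 (eX i)).pow 2)).add (h2.pow 2)).const_mul (1 / 2)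
  refine (dd_eq_of_hasFDerivAt h3).trans ?_
  have h4 : ∀ i, fderiv ℝ (dd (eX i) F) p (eT n) = dd (eX i) (dd (eT n) F) p := fun i =>
    congrFun (dd_comm (v := eT n) (w := eX i) hF) p
  simp [h4, Finset.mul_sum]
  simp only [dd]
  ring_nf

/-- The pointwise energy inequality: up to a divergence, the weighted energy density grows at most
exponentially in time. -/
lemma dd_coneWeight_mul_energyDensity_le {μ ν R : ℝ} (hμ : 0 ≤ μ) {F : ℝ × Space n → ℝ}
    (hF : ContDiff ℝ 2 F) {t : ℝ} (ht : 0 < t) (x : Space n)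
    (heq : dd (eT n) (dd (eT n) F) (t, x) - lapAlong eX F (t, x)
      + μ / (1 + t) * dd (eT n) F (t, x) + ν ^ 2 / (1 + t) ^ 2 * F (t, x) = 0) :
    dd (eT n) (fun p => coneWeight R p * energyDensity F p) (t, x) ≤
      ∑ i, dd (eX i) (fun p => coneWeight R p * (dd (eT n) F p * dd (eX i) F p)) (t, x)
        + (1 + ν ^ 2) * (coneWeight R (t, x) * energyDensity F (t, x)) := by
  have hz := (contDiff_coneWeight (n := n) R).differentiable two_ne_zero
  have h1 : ∀ v, Differentiable ℝ (dd v F) := fun v => (contDiff_dd_one hF).differentiable one_ne_zero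
  have he := (contDiff_energyDensity hF).differentiable one_ne_zero
  rw [dd_mul hz he]
  simp only [dd_energyDensity hF]
  obtain ⟨c, hc, hct, ψ, hψ, hψ1⟩ := exists_dd_coneWeight R (t, x)
  have hz0 : 0 ≤ coneWeight R (t, x) := Real.smoothTransition.nonneg _
  have hdiv : ∀ i, dd (eX i) (fun p => coneWeight R p * (dd (eT n) F p * dd (eX i) F p)) (t, x)
      = -(c * ψ i) * (dd (eT n) F (t, x) * dd (eX i) F (t, x))
        + coneWeight R (t, x) * (dd (eX i) (dd (eT n) F) (t, x) * dd (eX i) F (t, x)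
          + dd (eT n) F (t, x) * dd (eX i) (dd (eX i) F) (t, x)) := fun i => by
    rw [dd_mul hz (h := fun p => dd (eT n) F p * dd (eX i) F p) ((h1 (eT n)).mul (h1 (eX i))),
      dd_mul (h1 (eT n)) (h1 (eX i)), ← hψ i]
  simp only [hct, hdiv]
  set z := coneWeight R (t, x)
  set a := dd (eT n) F (t, x) with ha
  set w := F (t, x)
  have hlap : dd (eT n) (dd (eT n) F) (t, x) = ∑ i, dd (eX i) (dd (eX i) F) (t, x)
      - μ / (1 + t) * a - ν ^ 2 / (1 + t) ^ 2 * w := by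
    have : lapAlong eX F (t, x) = ∑ i, dd (eX i) (dd (eX i) F) (t, x) := rfl
    linarith
  rw [hlap]
  simp only [Finset.sum_add_distrib, mul_add, energyDensity, ← Finset.mul_sum]
  set S := ∑ i, dd (eX i) (dd (eX i) F) (t, x)
  have hcomm : ∑ i, dd (eX i) F (t, x) * dd (eX i) (dd (eT n) F) (t, x)
      = ∑ i, dd (eX i) (dd (eT n) F) (t, x) * dd (eX i) F (t, x) :=
    Finset.sum_congr rfl fun i _ => mul_comm _ _
  rw [hcomm]
  set D := ∑ i, dd (eX i) (dd (eT n) F) (t, x) * dd (eX i) F (t, x)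
  set G := ∑ i, dd (eX i) F (t, x) ^ 2
  have hG : 0 ≤ G := Finset.sum_nonneg fun i _ => sq_nonneg _
  -- Since `|ψ| ≤ 1`, the flux through the level sets is dominated by the decay of the weight in time.
  have hflux : ∑ i, -(c * ψ i) * (a * dd (eX i) F (t, x)) ≥ -(c * (1 / 2 * (a ^ 2 + G))) := by
    have h2 : ∑ i, -(c * ψ i) * (a * dd (eX i) F (t, x))
        = -(c * ∑ i, (ψ i * a) * dd (eX i) F (t, x)) := by
      rw [Finset.mul_sum, ← Finset.sum_neg_distrib]
      exact Finset.sum_congr rfl fun i _ => by ring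
    have h3 : ∑ i, (ψ i * a) * dd (eX i) F (t, x) ≤ 1 / 2 * (a ^ 2 + G) := by
      calc ∑ i, (ψ i * a) * dd (eX i) F (t, x)
          ≤ ∑ i, (1 / 2 * a ^ 2 * ψ i ^ 2 + 1 / 2 * dd (eX i) F (t, x) ^ 2) :=
            Finset.sum_le_sum fun i _ => by nlinarith [sq_nonneg (ψ i * a - dd (eX i) F (t, x))]
        _ = 1 / 2 * a ^ 2 * ∑ i, ψ i ^ 2 + 1 / 2 * G := by
            rw [Finset.sum_add_distrib, ← Finset.mul_sum, ← Finset.mul_sum]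
        _ ≤ 1 / 2 * (a ^ 2 + G) := by nlinarith [sq_nonneg a]
    rw [h2]
    exact neg_le_neg (mul_le_mul_of_nonneg_left h3 hc)
  have hm : 0 ≤ μ / (1 + t) := by positivity
  have hk0 : 0 ≤ ν ^ 2 / (1 + t) ^ 2 := by positivity
  have hk1 : ν ^ 2 / (1 + t) ^ 2 ≤ ν ^ 2 :=
    div_le_self (sq_nonneg ν) (one_le_pow₀ (by linarith))
  set m := μ / (1 + t)
  set k := ν ^ 2 / (1 + t) ^ 2
  -- the lower-order terms are absorbed by the energy
  have hlow : z * (w * a - m * a ^ 2 - k * (w * a))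
      ≤ (1 + ν ^ 2) * (z * (1 / 2 * (a ^ 2 + G + w ^ 2))) := by
    have h5 : |(1 - k) * (w * a)| ≤ (1 + ν ^ 2) * (1 / 2 * (a ^ 2 + w ^ 2)) := by
      rw [abs_mul]
      refine mul_le_mul (abs_le.2 ⟨by nlinarith [sq_nonneg ν], by nlinarith [sq_nonneg ν]⟩)
        (abs_le.2 ⟨by nlinarith [sq_nonneg (w + a)], by nlinarith [sq_nonneg (w - a)]⟩)
        (abs_nonneg _) (by positivity)
    have h6 : w * a - m * a ^ 2 - k * (w * a) ≤ (1 + ν ^ 2) * (1 / 2 * (a ^ 2 + G + w ^ 2)) := by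
      have := (abs_le.1 h5).2
      nlinarith [mul_nonneg hm (sq_nonneg a), mul_nonneg (sq_nonneg ν) hG]
    calc _ ≤ z * ((1 + ν ^ 2) * (1 / 2 * (a ^ 2 + G + w ^ 2))) := mul_le_mul_of_nonneg_left h6 hz0
      _ = _ := by ring
  have hcw : 0 ≤ c * (1 / 2 * w ^ 2) := by positivity
  nlinarith

/-- A `C²` solution of the homogeneous equation with vanishing initial data vanishes. -/
theorem eq_zero_of_homogeneous {μ ν : ℝ} (hμ : 0 ≤ μ) {F : ℝ × Space n → ℝ}
    (hF : ContDiff ℝ 2 F)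
    (heq : ∀ t, 0 < t → ∀ x, dd (eT n) (dd (eT n) F) (t, x) - lapAlong eX F (t, x)
      + μ / (1 + t) * dd (eT n) F (t, x) + ν ^ 2 / (1 + t) ^ 2 * F (t, x) = 0)
    (h0 : ∀ x, F (0, x) = 0) (h1 : ∀ x, dd (eT n) F (0, x) = 0) {t₀ : ℝ} (ht₀ : 0 ≤ t₀)
    (x₀ : Space n) : F (t₀, x₀) = 0 := by
  set R : ℝ := t₀ + √(1 + ‖x₀‖ ^ 2) + 1 with hR
  set K := Metric.closedBall (0 : Space n) R with hK
  have hKc : IsCompact K := isCompact_closedBall 0 R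
  have hzc := (contDiff_coneWeight (n := n) R).of_le (m := 1) (by norm_num)
  have hΦ : ContDiff ℝ 1 fun p => coneWeight R p * energyDensity F p :=
    hzc.mul (contDiff_energyDensity hF)
  have hsupp : ∀ t, 0 ≤ t → ∀ x ∉ K, coneWeight R (t, x) = 0 := by
    intro t ht x hx
    have hx' : R < ‖x‖ := by simpa [hK] using hx
    have : ‖x‖ ≤ √(1 + ‖x‖ ^ 2) := Real.le_sqrt_of_sq_le (by linarith)
    exact Real.smoothTransition.zero_of_nonpos (by simp only; linarith)
  have hnn : ∀ p, 0 ≤ coneWeight R p * energyDensity F p := fun p =>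
    mul_nonneg (Real.smoothTransition.nonneg _) (mul_nonneg (by norm_num)
      (add_nonneg (add_nonneg (sq_nonneg _) (Finset.sum_nonneg fun i _ => sq_nonneg _))
        (sq_nonneg _)))
  set En : ℝ → ℝ := fun t => ∫ x in K, coneWeight R (t, x) * energyDensity F (t, x) with hEn
  have hder : ∀ t, HasDerivAt En
      (∫ x in K, dd (eT n) (fun p => coneWeight R p * energyDensity F p) (t, x)) t := by
    intro t
    have h2 := dd_setIntegral (μ := volume) (ι := id) hΦ hKc continuous_id (1 : ℝ)
    have h3 : ContDiff ℝ 1 En := by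
      exact_mod_cast contDiff_setIntegral (μ := volume) (k := 1) (ι := id)
        (Φ := fun p : ℝ × Space n => coneWeight R p * energyDensity F p)
        (by exact_mod_cast hΦ) hKc continuous_id
    have h4 := (h3.differentiable one_ne_zero t).hasDerivAt
    have h5 : deriv En t = dd 1 En t := by simp [dd]
    rw [h5, hEn] at h4
    simp only [id] at h2
    rw [h2] at h4
    exact h4
  have hle : ∀ t, 0 < t → deriv En t ≤ (1 + ν ^ 2) * En t := by
    intro t ht
    rw [(hder t).deriv]
    have hj : ∀ i, ContDiff ℝ 1
        (fun p => coneWeight R p * (dd (eT n) F p * dd (eX i) F p)) := fun i =>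
      hzc.mul ((contDiff_dd_one hF).mul (contDiff_dd_one hF))
    have hflux : ∀ i, ∫ x in K,
        dd (eX i) (fun p => coneWeight R p * (dd (eT n) F p * dd (eX i) F p)) (t, x) = 0 := by
      intro i
      set g : Space n → ℝ := fun x => coneWeight R (t, x) * (dd (eT n) F (t, x) * dd (eX i) F (t, x))
      have hg : ContDiff ℝ 1 g := (hj i).comp (by fun_prop : ContDiff ℝ 1 fun x : Space n => (t, x))
      have hgs : HasCompactSupport g := HasCompactSupport.intro hKc fun x hx => by
        simp [g, hsupp t ht.le x hx]
      have h2 := integral_dd_eq_zero (μ := volume) hg hgs (EuclideanSpace.single i 1)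
      have h3 : dd (EuclideanSpace.single i 1) g = fun x =>
          dd (eX i) (fun p => coneWeight R p * (dd (eT n) F p * dd (eX i) F p)) (t, x) :=
        funext fun x => fderiv_right ((hj i).differentiable one_ne_zero) t x _
      rw [h3] at h2
      rw [← h2]
      refine setIntegral_eq_integral_of_forall_compl_eq_zero fun x hx => ?_
      rw [← congrFun h3 x]
      have : g =ᶠ[𝓝 x] fun _ => 0 := by
        filter_upwards [(Metric.isClosed_closedBall).isOpen_compl.mem_nhds hx] with y hy
        simp [g, hsupp t ht.le y hy]
      simp [dd, this.fderiv_eq]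
    have hint : ∀ {h : ℝ × Space n → ℝ}, Continuous h →
        IntegrableOn (fun x => h (t, x)) K := fun hh =>
      (hh.comp (by fun_prop : Continuous fun x : Space n => (t, x))).continuousOn.integrableOn_compact
        hKc
    calc _ ≤ ∫ x in K, (∑ i, dd (eX i)
            (fun p => coneWeight R p * (dd (eT n) F p * dd (eX i) F p)) (t, x)
            + (1 + ν ^ 2) * (coneWeight R (t, x) * energyDensity F (t, x))) := by
          refine setIntegral_mono (hint (continuous_dd hΦ)) ?_ fun x =>
            dd_coneWeight_mul_energyDensity_le hμ hF ht x (heq t ht x)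
          exact hint (h := fun p => ∑ i, dd (eX i)
            (fun p => coneWeight R p * (dd (eT n) F p * dd (eX i) F p)) p
            + (1 + ν ^ 2) * (coneWeight R p * energyDensity F p))
            ((continuous_finsetSum _ fun i _ => continuous_dd (hj i)).add
              (continuous_const.mul hΦ.continuous))
      _ = _ := by
          rw [integral_add (integrable_finsetSum _ fun i _ => hint (continuous_dd (hj i)))
            ((hint hΦ.continuous).const_mul _),
            integral_finsetSum _ fun i _ => hint (continuous_dd (hj i)), integral_const_mul]
          simp [hflux, hEn]
  have hE0 : En 0 = 0 := by
    have : ∀ x, energyDensity F (0, x) = 0 := by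
      intro x
      have h2 : ∀ i, dd (eX i) F (0, x) = 0 := fun i => by
        rw [eX, ← fderiv_right (hF.differentiable two_ne_zero)]
        simp [h0]
      simp [energyDensity, h0, h1, h2]
    simp [hEn, this]
  -- Gronwall: the exponentially weighted energy is nonincreasing
  have hanti : AntitoneOn (fun t => Real.exp (-(1 + ν ^ 2) * t) * En t) (Ici 0) := by
    have hd : ∀ t, HasDerivAt (fun t => Real.exp (-(1 + ν ^ 2) * t) * En t)
        (Real.exp (-(1 + ν ^ 2) * t) * (deriv En t - (1 + ν ^ 2) * En t)) t := by
      intro t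
      have h2 : HasDerivAt (fun t => -(1 + ν ^ 2) * t) (-(1 + ν ^ 2)) t := by
        simpa only [mul_one] using (hasDerivAt_id' t).const_mul (-(1 + ν ^ 2))
      convert! h2.exp.mul (hder t) using 1
      rw [(hder t).deriv]; ring
    refine antitoneOn_of_deriv_nonpos (convex_Ici 0)
      (fun t _ => (hd t).continuousAt.continuousWithinAt)
      (fun t _ => (hd t).differentiableAt.differentiableWithinAt) fun t ht => ?_
    rw [interior_Ici] at ht
    rw [(hd t).deriv]
    exact mul_nonpos_of_nonneg_of_nonpos (Real.exp_pos _).le (by linarith [hle t ht])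
  have hEt : En t₀ ≤ 0 := by
    have := hanti self_mem_Ici ht₀ ht₀
    simp only [hE0, mul_zero] at this
    exact nonpos_of_mul_nonpos_right this (Real.exp_pos _)
  by_contra hne
  have hpos : 0 < ∫ x, coneWeight R (t₀, x) * energyDensity F (t₀, x) := by
    refine Continuous.integral_pos_of_hasCompactSupport_nonneg_nonzero (x := x₀)
      (hΦ.continuous.comp (by fun_prop : Continuous fun x : Space n => (t₀, x)))
      (HasCompactSupport.intro hKc fun x hx => by simp [hsupp t₀ ht₀ x hx]) (fun x => hnn _) ?_
    refine mul_ne_zero (Real.smoothTransition.pos_of_pos (by simp only [hR]; linarith)).ne' ?_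
    have h2 : 0 < F (t₀, x₀) ^ 2 := by positivity
    have h3 : 0 ≤ ∑ i, dd (eX i) F (t₀, x₀) ^ 2 := Finset.sum_nonneg fun i _ => sq_nonneg _
    have h4 : 0 < energyDensity F (t₀, x₀) := by
      unfold energyDensity
      have := sq_nonneg (dd (eT n) F (t₀, x₀))
      linarith
    exact h4.ne'
  rw [← setIntegral_eq_integral_of_forall_compl_eq_zero (s := K)
    fun x hx => by simp [hsupp t₀ ht₀ x hx]] at hpos
  exact absurd hEt (not_le.2 hpos)

/-- Classical solutions of the Cauchy problem are unique. -/
theorem IsClassicalSolution.unique {μ ν : ℝ} (hμ : 0 ≤ μ) {f : ℝ → Space n → ℝ}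
    {u₀ u₁ : Space n → ℝ} {u v : ℝ → Space n → ℝ} (hu : IsClassicalSolution μ ν f u₀ u₁ u)
    (hv : IsClassicalSolution μ ν f u₀ u₁ v) {t : ℝ} (ht : 0 ≤ t) (x : Space n) :
    v t x = u t x := by
  obtain ⟨U, hU, hUu, hUe, hU0, hU1⟩ := hu.exists_contDiff
  obtain ⟨V, hV, hVv, hVe, hV0, hV1⟩ := hv.exists_contDiff
  have hUd := hU.differentiable two_ne_zero
  have hVd := hV.differentiable two_ne_zero
  have h1 : ∀ v w : ℝ × Space n, dd w (fun p => dd v V p - dd v U p)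
      = fun p => dd w (dd v V) p - dd w (dd v U) p := fun v w =>
    dd_sub ((contDiff_dd_one hV).differentiable one_ne_zero)
      ((contDiff_dd_one hU).differentiable one_ne_zero)
  have key := eq_zero_of_homogeneous (ν := ν) hμ (hV.sub hU) (fun s hs y => by
      have e1 := hUe s hs y
      have e2 := hVe s hs y
      simp only [lapAlong] at e1 e2 ⊢
      simp only [dd_sub hVd hUd, h1, Finset.sum_sub_distrib]
      linear_combination e2 - e1)
    (fun y => by rw [hU0, hV0, sub_self]) (fun y => by
      rw [dd_sub hVd hUd]; simp only; rw [hU1, hV1, sub_self]) ht x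
  rw [← hVv t ht, ← hUu t ht]
  exact sub_eq_zero.1 key

end Uniqueness

/-! ### Spherical means and Darboux's equation -/

section SphericalMeans

variable {n : ℕ}

/-- The surface measure of the unit sphere. -/
abbrev sphereMeasure (n : ℕ) : Measure (Metric.sphere (0 : Space n) 1) :=
  (volume : Measure (Space n)).toSphere

/-- The spherical mean of `F(b, ·)` over the sphere of radius `r` about `x`, as a function of
`(r, b, x)`. -/
def sphMean (F : ℝ × Space n → ℝ) (p : ℝ × ℝ × Space n) : ℝ :=
  sphericalMean (fun y => F (p.2.1, y)) p.2.2 p.1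

/-- The radial unit vector in the space of triples `(r, b, x)`. -/
def eR (n : ℕ) : ℝ × ℝ × Space n := (1, 0, 0)

/-- The `i`-th spatial unit vector in the space of triples `(r, b, x)`. -/
def eY (i : Fin n) : ℝ × ℝ × Space n := (0, 0, EuclideanSpace.single i 1)

lemma sphMean_eq_setIntegral (F : ℝ × Space n → ℝ) :
    sphMean F = fun p => ((sphereMeasure n).real univ)⁻¹ *
      ∫ σ in univ, (fun q : (ℝ × ℝ × Space n) × Space n =>
        F (q.1.2.1, q.1.2.2 + q.1.1 • q.2)) (p, ((↑) : Metric.sphere (0 : Space n) 1 → Space n) σ)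
        ∂(sphereMeasure n) := by
  ext p
  simp [sphMean, sphericalMean, average_eq]

lemma contDiff_sphMean_integrand {k : ℕ∞ω} {F : ℝ × Space n → ℝ} (hF : ContDiff ℝ k F) :
    ContDiff ℝ k fun q : (ℝ × ℝ × Space n) × Space n => F (q.1.2.1, q.1.2.2 + q.1.1 • q.2) :=
  hF.comp (by fun_prop)

lemma contDiff_sphMean {k : ℕ} {F : ℝ × Space n → ℝ} (hF : ContDiff ℝ k F) :
    ContDiff ℝ k (sphMean F) := by
  rw [sphMean_eq_setIntegral]
  exact contDiff_const.mul (contDiff_setIntegral (contDiff_sphMean_integrand hF) isCompact_univ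
    continuous_subtype_val)

lemma dd_sphMean {F : ℝ × Space n → ℝ} (hF : ContDiff ℝ 1 F) (v : ℝ × ℝ × Space n) :
    dd v (sphMean F) = fun p => ⨍ σ : Metric.sphere (0 : Space n) 1,
      dd (v.2.1, v.2.2 + v.1 • (σ : Space n)) F (p.2.1, p.2.2 + p.1 • (σ : Space n))
        ∂(sphereMeasure n) := by
  have hΦ := contDiff_sphMean_integrand hF
  have hI : Differentiable ℝ fun p : ℝ × ℝ × Space n => ∫ σ in univ,
      (fun q : (ℝ × ℝ × Space n) × Space n => F (q.1.2.1, q.1.2.2 + q.1.1 • q.2))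
        (p, ((↑) : Metric.sphere (0 : Space n) 1 → Space n) σ) ∂(sphereMeasure n) := fun p =>
    (hasFDerivAt_setIntegral hΦ isCompact_univ continuous_subtype_val p).differentiableAt
  rw [sphMean_eq_setIntegral, dd_const_mul _ hI,
    dd_setIntegral hΦ isCompact_univ continuous_subtype_val]
  ext p
  rw [average_eq, smul_eq_mul, Measure.restrict_univ]
  congr 1
  refine integral_congr_ae (Filter.Eventually.of_forall fun σ => ?_)
  refine dd_eq_of_hasDerivAt (γ := fun s => (p + s • v, (σ : Space n))) (t := 0)
    (hΦ.differentiable one_ne_zero _) (by simp) ?_ ?_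
  · have h1 : HasDerivAt (fun s : ℝ => p + s • v) v 0 := by
      simpa using ((hasDerivAt_id (0 : ℝ)).smul_const v).const_add p
    exact h1.prodMk (hasDerivAt_const _ _)
  · refine hasDerivAt_comp_dd (γ := fun s : ℝ => ((p + s • v).2.1,
      (p + s • v).2.2 + (p + s • v).1 • (σ : Space n))) (hF.differentiable one_ne_zero _)
      (by simp) ?_
    have h1 : HasDerivAt (fun s : ℝ => s) 1 0 := hasDerivAt_id 0
    have h2 := (h1.smul_const v.2.1).const_add p.2.1
    have h3 := ((h1.smul_const v.2.2).const_add p.2.2).add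
      (((h1.smul_const v.1).const_add p.1).smul_const (σ : Space n))
    have h4 := h2.prodMk h3
    simp only [one_smul] at h4
    exact h4

lemma dd_eY_sphMean {F : ℝ × Space n → ℝ} (hF : ContDiff ℝ 1 F) (i : Fin n) :
    dd (eY i) (sphMean F) = sphMean (dd (eX i) F) := by
  rw [dd_sphMean hF]
  ext p
  simp [eY, eX, sphMean, sphericalMean]

lemma dd_eR_sphMean {F : ℝ × Space n → ℝ} (hF : ContDiff ℝ 1 F) :
    dd (eR n) (sphMean F) = fun p => ⨍ σ : Metric.sphere (0 : Space n) 1,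
      dd (0, (σ : Space n)) F (p.2.1, p.2.2 + p.1 • (σ : Space n)) ∂(sphereMeasure n) := by
  rw [dd_sphMean hF]
  ext p
  simp [eR]

/-- Integration in polar coordinates. -/
lemma integral_eq_integral_sphere {n : ℕ} [NeZero n] {g : Space n → ℝ} (hg : Integrable g) :
    ∫ y, g y = ∫ r in Ioi (0 : ℝ), r ^ (n - 1) *
      ∫ σ : Metric.sphere (0 : Space n) 1, g (r • (σ : Space n)) ∂(sphereMeasure n) := by
  have hd : Module.finrank ℝ (Space n) = n := by simp
  set G : Metric.sphere (0 : Space n) 1 × Ioi (0 : ℝ) → ℝ := fun q => g ((q.2 : ℝ) • (q.1 : Space n))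
  have hG : ∀ y : ({0}ᶜ : Set (Space n)), G (homeomorphUnitSphereProd (Space n) y) = g y := by
    intro y
    have : (y : Space n) ≠ 0 := y.2
    simp [G, smul_smul, this]
  have hmp := (volume : Measure (Space n)).measurePreserving_homeomorphUnitSphereProd
  have hemb := (homeomorphUnitSphereProd (Space n)).measurableEmbedding
  have h1 : ∫ y, g y = ∫ q, G q ∂(sphereMeasure n).prod (.volumeIoiPow (n - 1)) := by
    have h2 := hmp.integral_comp hemb G
    simp only [hG, hd] at h2
    rw [← h2, integral_subtype_comap (measurableSet_singleton _).compl g, restrict_compl_singleton]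
  have h3 : Integrable G ((sphereMeasure n).prod (.volumeIoiPow (n - 1))) := by
    have h2 := hmp.integrable_comp_emb hemb (g := G)
    rw [hd] at h2
    rw [← h2]
    have : (G ∘ homeomorphUnitSphereProd (Space n)) = g ∘ Subtype.val := funext hG
    rw [this, ← integrableOn_iff_comap_subtypeVal (measurableSet_singleton _).compl]
    exact hg.integrableOn
  rw [h1, integral_prod_symm G h3]
  simp only [Measure.volumeIoiPow, ENNReal.ofReal]
  rw [integral_withDensity_eq_integral_smul
    ((measurable_subtype_coe.pow_const _).real_toNNReal),
    integral_subtype_comap measurableSet_Ioi fun a : ℝ => Real.toNNReal (a ^ (n - 1)) •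
      ∫ σ : Metric.sphere (0 : Space n) 1, g (a • (σ : Space n)) ∂(sphereMeasure n)]
  refine setIntegral_congr_fun measurableSet_Ioi fun r hr => ?_
  rw [NNReal.smul_def, Real.coe_toNNReal _ (pow_nonneg (le_of_lt hr) _), smul_eq_mul]

end SphericalMeans

section Darboux

variable {n : ℕ}

lemma continuous_sphMean {F : ℝ × Space n → ℝ} (hF : Continuous F) : Continuous (sphMean F) :=
  (contDiff_sphMean (k := 0) (by exact_mod_cast contDiff_zero.2 hF)).continuous

lemma contDiff_lapAlong {E : Type*} [NormedAddCommGroup E] [NormedSpace ℝ E] {k : ℕ∞ω}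
    {e : Fin n → E} {h : E → ℝ} (hh : ContDiff ℝ (k + 2) h) : ContDiff ℝ k (lapAlong e h) :=
  ContDiff.sum fun _ _ => contDiff_dd (contDiff_dd (by rwa [add_assoc, one_add_one_eq_two]))

/-- The radial cut-off `η(|y|)` is smooth if `η` is supported in `(0, ∞)`. -/
lemma contDiff_comp_norm {η : ℝ → ℝ} (hη : ContDiff ℝ ∞ η) (hs : tsupport η ⊆ Ioi 0) :
    ContDiff ℝ 1 fun y : Space n => η ‖y‖ := by
  refine contDiff_iff_contDiffAt.2 fun y => ?_
  by_cases hy : y = 0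
  · have h0 : (0 : ℝ) ∉ tsupport η := fun h => lt_irrefl (0 : ℝ) (hs h)
    have h1 : η =ᶠ[𝓝 0] 0 := notMem_tsupport_iff_eventuallyEq.1 h0
    have h2 : (fun y : Space n => η ‖y‖) =ᶠ[𝓝 y] fun _ => 0 := by
      have : Filter.Tendsto (fun y : Space n => ‖y‖) (𝓝 y) (𝓝 0) := by
        rw [hy]; simpa using (continuous_norm (E := Space n)).tendsto 0
      exact this.eventually h1
    exact contDiffAt_const.congr_of_eventuallyEq h2
  · exact ((hη.of_le (by simp)).contDiffAt).comp y (contDiffAt_norm ℝ hy)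

lemma dd_comp_norm {η : ℝ → ℝ} (hη : ContDiff ℝ ∞ η) {r : ℝ} (hr : 0 < r)
    (σ : Metric.sphere (0 : Space n) 1) (i : Fin n) :
    dd (EuclideanSpace.single i 1) (fun y : Space n => η ‖y‖) (r • (σ : Space n))
      = deriv η r * (σ : Space n) i := by
  have hσ : ‖(σ : Space n)‖ = 1 := norm_eq_of_mem_sphere σ
  have hn : ‖r • (σ : Space n)‖ = r := by rw [norm_smul, hσ, mul_one, Real.norm_of_nonneg hr.le]
  have h1 : HasFDerivAt (fun y : Space n => ‖y‖ ^ 2)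
      (2 • (innerSL ℝ) (r • (σ : Space n))) (r • (σ : Space n)) :=
    (hasStrictFDerivAt_norm_sq _).hasFDerivAt
  have h2 := h1.sqrt (by rw [hn]; positivity)
  simp only [Real.sqrt_sq (norm_nonneg _)] at h2
  have h3 := (hη.differentiable (by simp) ‖r • (σ : Space n)‖).hasDerivAt.comp_hasFDerivAt _ h2
  refine (dd_eq_of_hasFDerivAt h3).trans ?_
  rw [hn]
  simp [EuclideanSpace.inner_single_right]
  field_simp
  simp

lemma sum_apply_mul_dd {F : ℝ × Space n → ℝ} (p : ℝ × Space n) (v : Space n) :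
    ∑ i, v i * dd (eX i) F p = dd (0, v) F p := by
  have h1 : ((0 : ℝ), v) = ∑ i, v i • eX i := by
    ext j
    · simp [eX, Prod.fst_sum]
    · simp [eX, Prod.snd_sum, Pi.single_apply]
  simp only [dd]
  rw [h1, map_sum]
  simp

/-- Darboux's equation tested against a radial function: the divergence theorem on all of `ℝⁿ`,
written in polar coordinates. -/
lemma integral_test_darboux [NeZero n] {F : ℝ × Space n → ℝ} (hF : ContDiff ℝ 2 F) {η : ℝ → ℝ}
    (hη : ContDiff ℝ ∞ η) (hc : HasCompactSupport η) (hs : tsupport η ⊆ Ioi 0) (b : ℝ)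
    (x : Space n) :
    ∫ r in Ioi (0 : ℝ), r ^ (n - 1) * (deriv η r * dd (eR n) (sphMean F) (r, b, x)
      + η r * sphMean (lapAlong eX F) (r, b, x)) = 0 := by
  have hF1 : ContDiff ℝ 1 F := hF.of_le (by norm_num)
  set φ : Fin n → Space n → ℝ := fun i y => dd (eX i) F (b, x + y) with hφ
  have hφc : ∀ i, ContDiff ℝ 1 (φ i) := fun i => (contDiff_dd_one hF).comp (by fun_prop)
  have hχ := contDiff_comp_norm (n := n) hη hs
  set g : Fin n → Space n → ℝ := fun i y => η ‖y‖ * φ i y with hg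
  have hgc : ∀ i, ContDiff ℝ 1 (g i) := fun i => hχ.mul (hφc i)
  obtain ⟨R, hR⟩ := hc.isBounded.subset_closedBall 0
  have hgs : ∀ i, HasCompactSupport (g i) := fun i =>
    HasCompactSupport.intro (isCompact_closedBall (0 : Space n) R) fun y hy => by
      have : η ‖y‖ = 0 := by
        refine image_eq_zero_of_notMem_tsupport fun h => hy ?_
        simpa using hR h
      simp [hg, this]
  have hint : ∀ i, Integrable (dd (EuclideanSpace.single i 1) (g i)) := fun i =>
    (continuous_dd (hgc i)).integrable_of_hasCompactSupport
      (((hgs i).fderiv ℝ).comp_left (g := fun A : Space n →L[ℝ] ℝ => A _) (by simp))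
  have h0 : ∫ y, ∑ i, dd (EuclideanSpace.single i 1) (g i) y = 0 := by
    rw [integral_finsetSum _ fun i _ => hint i]
    exact Finset.sum_eq_zero fun i _ => integral_dd_eq_zero (hgc i) (hgs i) _
  rw [integral_eq_integral_sphere (integrable_finsetSum _ fun i _ => hint i)] at h0
  have hσ0 : (sphereMeasure n).real univ ≠ 0 := by
    rw [measureReal_def]
    refine ENNReal.toReal_ne_zero.2 ⟨?_, measure_ne_top _ _⟩
    have : 0 < (volume : Measure (Space n)) (Metric.ball 0 1) :=
      Metric.measure_ball_pos _ _ one_pos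
    simp [NeZero.ne n, this.ne']
  have key : ∀ r ∈ Ioi (0 : ℝ), r ^ (n - 1) * ∫ σ : Metric.sphere (0 : Space n) 1,
      ∑ i, dd (EuclideanSpace.single i 1) (g i) (r • (σ : Space n)) ∂(sphereMeasure n)
      = (sphereMeasure n).real univ * (r ^ (n - 1) * (deriv η r * dd (eR n) (sphMean F) (r, b, x)
        + η r * sphMean (lapAlong eX F) (r, b, x))) := by
    intro r hr
    have h1 : ∀ σ : Metric.sphere (0 : Space n) 1,
        ∑ i, dd (EuclideanSpace.single i 1) (g i) (r • (σ : Space n))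
        = deriv η r * dd (0, (σ : Space n)) F (b, x + r • (σ : Space n))
          + η r * lapAlong eX F (b, x + r • (σ : Space n)) := by
      intro σ
      have hn : ‖r • (σ : Space n)‖ = r := by
        have hσ : ‖(σ : Space n)‖ = 1 := norm_eq_of_mem_sphere σ
        rw [norm_smul, hσ, mul_one, Real.norm_of_nonneg (le_of_lt hr)]
      rw [← sum_apply_mul_dd, lapAlong, Finset.mul_sum, Finset.mul_sum, ← Finset.sum_add_distrib]
      refine Finset.sum_congr rfl fun i _ => ?_
      rw [hg]
      simp only
      rw [dd_mul (hχ.differentiable one_ne_zero) ((hφc i).differentiable one_ne_zero)]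
      simp only [dd_comp_norm hη hr σ i, hn]
      have h2 : dd (EuclideanSpace.single i 1) (φ i) (r • (σ : Space n))
          = dd (eX i) (dd (eX i) F) (b, x + r • (σ : Space n)) := by
        refine dd_eq_of_hasDerivAt (γ := fun s => r • (σ : Space n) + s • EuclideanSpace.single i 1)
          (t := 0) ((hφc i).differentiable one_ne_zero _) (by simp) ?_ ?_
        · simpa using ((hasDerivAt_id (0 : ℝ)).smul_const
            (EuclideanSpace.single i (1 : ℝ))).const_add (r • (σ : Space n))
        · refine hasDerivAt_comp_dd (γ := fun s : ℝ => (b, x + (r • (σ : Space n)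
            + s • EuclideanSpace.single i 1)))
            ((contDiff_dd_one hF).differentiable one_ne_zero _) (by simp) ?_
          refine (hasDerivAt_const _ _).prodMk ?_
          simpa using (((hasDerivAt_id (0 : ℝ)).smul_const
            (EuclideanSpace.single i (1 : ℝ))).const_add (r • (σ : Space n))).const_add x
      rw [h2]
      simp only [hφ]
      ring
    have hcd : Continuous fun σ : Metric.sphere (0 : Space n) 1 =>
        dd (0, (σ : Space n)) F (b, x + r • (σ : Space n)) := by
      have := hF1.continuous_fderiv one_ne_zero
      unfold dd; fun_prop
    have hcl : Continuous fun σ : Metric.sphere (0 : Space n) 1 =>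
        lapAlong eX F (b, x + r • (σ : Space n)) :=
      (contDiff_lapAlong (k := 0) (by simpa using hF)).continuous.comp (by fun_prop)
    have hi : ∀ {h : Metric.sphere (0 : Space n) 1 → ℝ}, Continuous h →
        Integrable h (sphereMeasure n) := fun hh =>
      hh.integrable_of_hasCompactSupport (HasCompactSupport.of_compactSpace _)
    simp only [h1]
    rw [integral_add ((hi hcd).const_mul _) ((hi hcl).const_mul _), integral_const_mul,
      integral_const_mul, dd_eR_sphMean hF1]
    simp only [sphMean, sphericalMean, average_eq, smul_eq_mul]
    field_simp
  rw [setIntegral_congr_fun measurableSet_Ioi key, integral_const_mul] at h0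
  exact (mul_eq_zero.1 h0).resolve_left hσ0

/-- **Darboux's equation** `M_rr + (n - 1)/r M_r = M[ΔF]`, multiplied by `r²`. -/
theorem darboux [NeZero n] {F : ℝ × Space n → ℝ} (hF : ContDiff ℝ 2 F) {r : ℝ} (hr : 0 ≤ r)
    (b : ℝ) (x : Space n) :
    r ^ 2 * dd (eR n) (dd (eR n) (sphMean F)) (r, b, x)
      + (n - 1) * r * dd (eR n) (sphMean F) (r, b, x)
      = r ^ 2 * sphMean (lapAlong eX F) (r, b, x) := by
  have hM : ContDiff ℝ 2 (sphMean F) := by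
    exact_mod_cast contDiff_sphMean (k := 2) (by exact_mod_cast hF)
  have hn : 1 ≤ n := NeZero.one_le
  rcases hr.eq_or_lt with rfl | hr
  · simp
  set A : ℝ → ℝ := fun r => dd (eR n) (sphMean F) (r, b, x) with hA
  set G : ℝ → ℝ := fun r => r ^ (n - 1) * A r with hG
  have hAc : ContDiff ℝ 1 A := (contDiff_dd_one hM).comp (by fun_prop)
  have hGc : ContDiff ℝ 1 G := by fun_prop
  have hA' : ∀ r, HasDerivAt A (dd (eR n) (dd (eR n) (sphMean F)) (r, b, x)) r := fun r =>
    hasDerivAt_comp_dd ((contDiff_dd_one hM).differentiable one_ne_zero _) rfl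
      ((hasDerivAt_id r).prodMk (hasDerivAt_const r (b, x)))
  have hG' : ∀ r, HasDerivAt G (((n - 1 : ℕ) : ℝ) * r ^ (n - 1 - 1) * A r
      + r ^ (n - 1) * dd (eR n) (dd (eR n) (sphMean F)) (r, b, x)) r := fun r =>
    (hasDerivAt_pow (n - 1) r).mul (hA' r)
  set H : ℝ → ℝ := fun r => r ^ (n - 1) * sphMean (lapAlong eX F) (r, b, x) with hH
  have hHc : Continuous H := by
    have := continuous_sphMean (contDiff_lapAlong (e := eX) (k := 0) (h := F)
      (by simpa using hF)).continuous
    simp only [hH]; fun_prop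
  have hdc : Continuous (deriv G) := hGc.continuous_deriv le_rfl
  -- The tested identity says `(r^(n-1) M_r)' = r^(n-1) M[ΔF]` in the sense of distributions on `r > 0`,
  -- hence pointwise by continuity.
  have hae : ∀ᵐ r ∂(volume : Measure ℝ), r ∈ Ioi (0 : ℝ) → (H r - deriv G r) = 0 := by
    refine isOpen_Ioi.ae_eq_zero_of_integral_contDiff_smul_eq_zero
      ((hHc.sub hdc).locallyIntegrable.locallyIntegrableOn _) fun η hη hc hs => ?_
    have h1 := integral_test_darboux hF hη hc hs b x
    have hz : ∀ r ∉ Ioi (0 : ℝ), η r = 0 ∧ deriv η r = 0 := fun r hr =>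
      ⟨image_eq_zero_of_notMem_tsupport fun h => hr (hs h),
        image_eq_zero_of_notMem_tsupport fun h => hr (hs (tsupport_deriv_subset h))⟩
    rw [setIntegral_eq_integral_of_forall_compl_eq_zero fun r hr => by simp [hz r hr]] at h1
    have hη1 : ContDiff ℝ 1 η := hη.of_le (by simp)
    have h2 := integral_dd_eq_zero (μ := volume) (hη1.mul hGc) (hc.mul_right (f' := G)) (1 : ℝ)
    have hηd := hη1.differentiable one_ne_zero
    have h3 : ∀ r, dd (1 : ℝ) (fun r => η r * G r) r = deriv η r * G r + η r * deriv G r :=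
      fun r => by
        rw [dd, fderiv_apply_one_eq_deriv]
        exact ((hηd r).hasDerivAt.mul (hGc.differentiable one_ne_zero r).hasDerivAt).deriv
    have hcη : Continuous (deriv η) := hη1.continuous_deriv le_rfl
    have i1 : Integrable fun r => r ^ (n - 1) * (deriv η r * A r
        + η r * sphMean (lapAlong eX F) (r, b, x)) := by
      have : (fun r => r ^ (n - 1) * (deriv η r * A r
        + η r * sphMean (lapAlong eX F) (r, b, x))) = fun r => deriv η r * G r + η r * H r := by
        ext r; simp only [hG, hH]; ring
      rw [this]
      exact ((hcη.mul hGc.continuous).integrable_of_hasCompactSupport hc.deriv.mul_right).add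
        ((hη1.continuous.mul hHc).integrable_of_hasCompactSupport hc.mul_right)
    have i2 : Integrable fun r => dd (1 : ℝ) (fun r => η r * G r) r := by
      simp only [h3]
      exact ((hcη.mul hGc.continuous).integrable_of_hasCompactSupport hc.deriv.mul_right).add
        ((hη1.continuous.mul hdc).integrable_of_hasCompactSupport hc.mul_right)
    have h4 := integral_sub i1 i2
    rw [h2] at h4
    rw [show (∫ r, r ^ (n - 1) * (deriv η r * A r
        + η r * sphMean (lapAlong eX F) (r, b, x))) = 0 from h1, sub_zero] at h4
    rw [← h4]
    congr 1
    ext r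
    rw [h3]
    simp only [hG, hH, smul_eq_mul]
    ring
  have hall : EqOn (fun r => H r - deriv G r) 0 (Ioi 0) :=
    Measure.eqOn_open_of_ae_eq ((ae_restrict_iff' measurableSet_Ioi).2 hae) isOpen_Ioi
      (hHc.sub hdc).continuousOn continuousOn_const
  have h5 := hall hr
  simp only [Pi.zero_apply, (hG' r).deriv, hH, hA] at h5
  have h6 : r ^ (n - 1) ≠ 0 := by positivity
  have h7 : ((n - 1 : ℕ) : ℝ) = n - 1 := by push_cast [hn]; ring
  rw [h7] at h5
  rcases Nat.lt_or_ge 1 n with h8 | h8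
  · have h9 : r ^ (n - 1) = r * r ^ (n - 1 - 1) := by
      rw [← pow_succ']; congr 1; omega
    rw [h9] at h5 h6
    have : r ^ (n - 1 - 1) ≠ 0 := (mul_ne_zero_iff.1 h6).2
    have h10 : r ^ (n - 1 - 1) * (r * sphMean (lapAlong eX F) (r, b, x)
      - ((n - 1) * dd (eR n) (sphMean F) (r, b, x)
        + r * dd (eR n) (dd (eR n) (sphMean F)) (r, b, x))) = 0 := by linear_combination h5
    have h11 := (mul_eq_zero.1 h10).resolve_left this
    linear_combination -r * h11
  · obtain rfl : n = 1 := by omega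
    simp only [Nat.sub_self, pow_zero, one_mul, Nat.cast_one, sub_self, zero_mul, zero_add] at h5
    simp only [Nat.cast_one, sub_self, zero_mul]
    linear_combination -r ^ 2 * h5

end Darboux

/-! ### The free wave equation in odd dimensions -/

section FreeWave

variable {n : ℕ}

/-- The iterated Euler operator `∏ (r ∂_r + n - 2 - 2i)`, `i < j`, applied to the spherical mean.
Up to a power of `r`, it is `(r⁻¹ ∂_r)^j` applied to `r^(n-2) M`, but it is regular at `r = 0`. -/
def radialIter (F : ℝ × Space n → ℝ) : ℕ → ℝ × ℝ × Space n → ℝ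
  | 0 => sphMean F
  | j + 1 => fun p => ((n : ℝ) - 2 - 2 * j) * radialIter F j p + p.1 * dd (eR n) (radialIter F j) p

lemma contDiff_radialIter {F : ℝ × Space n → ℝ} {i j : ℕ} (hF : ContDiff ℝ (i + j : ℕ) F) :
    ContDiff ℝ i (radialIter F j) := by
  induction j generalizing i with
  | zero => exact contDiff_sphMean hF
  | succ j ih =>
    have h1 : ContDiff ℝ ((i + 1 : ℕ)) (radialIter F j) := ih (by convert hF using 2; ring)
    have h2 : ContDiff ℝ i (dd (eR n) (radialIter F j)) := contDiff_dd (by exact_mod_cast h1)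
    have h3 : ContDiff ℝ i (radialIter F j) := h1.of_le (by exact_mod_cast Nat.le_succ i)
    simp only [radialIter]
    fun_prop

lemma contDiff_one_radialIter {F : ℝ × Space n → ℝ} {j : ℕ} (hF : ContDiff ℝ (j + 1 : ℕ) F) :
    ContDiff ℝ 1 (radialIter F j) := by
  exact_mod_cast contDiff_radialIter (i := 1) (by rwa [add_comm])

lemma contDiff_two_radialIter {F : ℝ × Space n → ℝ} {j : ℕ} (hF : ContDiff ℝ (j + 2 : ℕ) F) :
    ContDiff ℝ 2 (radialIter F j) := by
  exact_mod_cast contDiff_radialIter (i := 2) (by rwa [add_comm])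

lemma contDiff_dd_succ {E : Type*} [NormedAddCommGroup E] [NormedSpace ℝ E] {h : E → ℝ} {k : ℕ}
    (hh : ContDiff ℝ (k + 1 : ℕ) h) (v : E) : ContDiff ℝ k (dd v h) :=
  contDiff_dd (by exact_mod_cast hh)

lemma contDiff_lapAlong_add_two {E : Type*} [NormedAddCommGroup E] [NormedSpace ℝ E] {h : E → ℝ}
    {k : ℕ} (hh : ContDiff ℝ (k + 2 : ℕ) h) (e : Fin n → E) : ContDiff ℝ k (lapAlong e h) :=
  contDiff_lapAlong (by exact_mod_cast hh)

lemma dd_fst_mul {h : ℝ × ℝ × Space n → ℝ} (hh : Differentiable ℝ h) (v : ℝ × ℝ × Space n) :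
    dd v (fun p => p.1 * h p) = fun p => v.1 * h p + p.1 * dd v h p := by
  rw [dd_mul differentiable_fst hh]
  ext p
  have : dd v (fun p : ℝ × ℝ × Space n => p.1) p = v.1 :=
    dd_eq_of_hasFDerivAt (hasFDerivAt_fst (𝕜 := ℝ) (p := p))
  rw [this]

lemma dd_radialIter_succ {F : ℝ × Space n → ℝ} {j : ℕ} (hF : ContDiff ℝ (j + 2 : ℕ) F)
    (v : ℝ × ℝ × Space n) : dd v (radialIter F (j + 1)) = fun p =>
      ((n : ℝ) - 2 - 2 * j) * dd v (radialIter F j) p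
        + (v.1 * dd (eR n) (radialIter F j) p + p.1 * dd v (dd (eR n) (radialIter F j)) p) := by
  have h1 := contDiff_two_radialIter hF
  have h2 := h1.differentiable two_ne_zero
  have h3 := (contDiff_dd_one (v := eR n) h1).differentiable one_ne_zero
  simp only [radialIter]
  rw [dd_add (h2.const_mul _) (differentiable_fst.fun_mul h3), dd_const_mul _ h2, dd_fst_mul h3]

lemma dd_eY_radialIter {F : ℝ × Space n → ℝ} {j : ℕ} (hF : ContDiff ℝ (j + 1 : ℕ) F) (i : Fin n) :
    dd (eY i) (radialIter F j) = radialIter (dd (eX i) F) j := by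
  induction j with
  | zero => exact dd_eY_sphMean (by exact_mod_cast hF) i
  | succ j ih =>
    have h1 := contDiff_two_radialIter hF
    rw [dd_radialIter_succ hF, dd_comm h1, ih (hF.of_le (by exact_mod_cast Nat.le_succ _))]
    ext p
    simp [radialIter, eY]

lemma radialIter_sum {ι : Type*} [Fintype ι] {G : ι → ℝ × Space n → ℝ} {j : ℕ}
    (hG : ∀ i, ContDiff ℝ j (G i)) :
    radialIter (fun p => ∑ i, G i p) j = fun p => ∑ i, radialIter (G i) j p := by
  induction j with
  | zero =>
    ext p
    simp only [radialIter, sphMean, sphericalMean, average_eq, smul_eq_mul]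
    rw [integral_finsetSum _ fun i _ => ?_, Finset.mul_sum]
    refine Continuous.integrable_of_hasCompactSupport ?_ (HasCompactSupport.of_compactSpace _)
    have := (hG i).continuous
    fun_prop
  | succ j ih =>
    have h1 : ∀ i, ContDiff ℝ 1 (radialIter (G i) j) := fun i => contDiff_one_radialIter (hG i)
    simp only [radialIter]
    rw [ih fun i => (hG i).of_le (by exact_mod_cast Nat.le_succ _),
      dd_sum fun i _ => (h1 i).differentiable one_ne_zero]
    ext p
    simp [Finset.mul_sum, Finset.sum_add_distrib]

lemma radialIter_add {F G : ℝ × Space n → ℝ} {j : ℕ} (hF : ContDiff ℝ j F) (hG : ContDiff ℝ j G) :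
    radialIter (fun p => F p + G p) j = fun p => radialIter F j p + radialIter G j p := by
  simpa [Fin.sum_univ_two] using radialIter_sum (G := ![F, G]) (j := j) (by
    intro i; fin_cases i <;> assumption)

/-- Iterated form of Darboux's equation, `r ∂_r H_{j+1}[F] = r² H_j[ΔF]`, which follows from the case
`j = 0` by the commutation rule `(r ∂_r + q) r² = r² (r ∂_r + q + 2)`. -/
lemma mul_dd_radialIter_succ [NeZero n] {F : ℝ × Space n → ℝ} {j : ℕ}
    (hF : ContDiff ℝ (j + 2 : ℕ) F) {p : ℝ × ℝ × Space n} (hp : 0 ≤ p.1) :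
    p.1 * dd (eR n) (radialIter F (j + 1)) p = p.1 ^ 2 * radialIter (lapAlong eX F) j p := by
  induction j generalizing p with
  | zero =>
    obtain ⟨r, b, x⟩ := p
    rw [dd_radialIter_succ hF]
    have h1 := darboux (by exact_mod_cast hF) hp b x
    simp only [radialIter, eR] at h1 ⊢
    push_cast
    linear_combination h1
  | succ j ih =>
    rcases hp.eq_or_lt with hp | hp
    · rw [← hp]; ring
    have hF' : ContDiff ℝ (j + 2 : ℕ) F := hF.of_le (by exact_mod_cast Nat.le_succ _)
    have hL := contDiff_one_radialIter (contDiff_lapAlong_add_two (k := j + 1) hF eX)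
    have hLd := hL.differentiable one_ne_zero
    have h1 := (contDiff_two_radialIter (j := j + 1) hF).differentiable two_ne_zero
    have hev : radialIter F (j + 2) =ᶠ[𝓝 p] fun p =>
        ((n : ℝ) - 2 - 2 * (j + 1 : ℕ)) * radialIter F (j + 1) p
          + p.1 * (p.1 * radialIter (lapAlong eX F) j p) := by
      filter_upwards [(continuous_fst.tendsto p).eventually (lt_mem_nhds hp)] with q hq
      rw [radialIter]
      simp only
      have h2 := ih hF' hq.le
      linear_combination h2
    have h3 : dd (eR n) (radialIter F (j + 2)) p = dd (eR n) (fun p =>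
        ((n : ℝ) - 2 - 2 * (j + 1 : ℕ)) * radialIter F (j + 1) p
          + p.1 * (p.1 * radialIter (lapAlong eX F) j p)) p := by
      simp only [dd, hev.fderiv_eq]
    rw [h3, dd_add (h1.const_mul _) (differentiable_fst.fun_mul (differentiable_fst.fun_mul hLd)),
      dd_const_mul _ h1, dd_fst_mul (differentiable_fst.fun_mul hLd), dd_fst_mul hLd]
    simp only [radialIter]
    have h2 := ih hF' hp.le
    simp only [radialIter] at h2
    simp only [eR] at h2 ⊢
    push_cast
    linear_combination ((n : ℝ) - 2 - 2 * (j + 1)) * h2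

/-- The primitive in time of the free wave: the solution of the free wave equation with data
`w(0) = 0`, `w_r(0) = F(b, ·)`, as a function of `(r, b, x)`. -/
def waveV (k : ℕ) (F : ℝ × Space n → ℝ) (p : ℝ × ℝ × Space n) : ℝ :=
  1 / (Nat.doubleFactorial (n - 2) : ℝ) * (p.1 * radialIter F k p)

variable {k : ℕ} {F : ℝ × Space n → ℝ}

lemma contDiff_waveV {i : ℕ} (hF : ContDiff ℝ (i + k : ℕ) F) : ContDiff ℝ i (waveV k F) := by
  have := contDiff_radialIter hF
  unfold waveV
  fun_prop

lemma dd_waveV (hF : ContDiff ℝ (k + 1 : ℕ) F) (v : ℝ × ℝ × Space n) :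
    dd v (waveV k F) = fun p => 1 / (Nat.doubleFactorial (n - 2) : ℝ) *
      (v.1 * radialIter F k p + p.1 * dd v (radialIter F k) p) := by
  have h1 := (contDiff_one_radialIter hF).differentiable one_ne_zero
  unfold waveV
  rw [dd_const_mul _ (differentiable_fst.fun_mul h1), dd_fst_mul h1]

lemma lapAlong_waveV (hF : ContDiff ℝ (k + 2 : ℕ) F) :
    lapAlong eY (waveV k F) = waveV k (lapAlong eX F) := by
  have hF1 : ContDiff ℝ (k + 1 : ℕ) F := hF.of_le (by exact_mod_cast Nat.le_succ _)
  have h1 : ∀ i, dd (eY i) (waveV k F) = waveV k (dd (eX i) F) := fun i => by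
    rw [dd_waveV hF1, dd_eY_radialIter hF1]
    ext p
    simp [waveV, eY]
  have h2 : ∀ i, dd (eY i) (dd (eY i) (waveV k F)) = waveV k (dd (eX i) (dd (eX i) F)) := fun i => by
    have hd := contDiff_dd_succ hF (eX i)
    rw [h1, dd_waveV hd, dd_eY_radialIter hd]
    ext p
    simp [waveV, eY]
  ext p
  unfold lapAlong
  simp only [h2]
  unfold waveV
  rw [radialIter_sum fun i => contDiff_dd_succ (contDiff_dd_succ hF _) _, ← Finset.mul_sum,
    ← Finset.mul_sum]

/-- In dimension `n = 2k + 3`, the time derivative of `waveV` is one more iterate. -/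
lemma dd_eR_waveV (hn : n = 2 * k + 3) (hF : ContDiff ℝ (k + 1 : ℕ) F) :
    dd (eR n) (waveV k F) = fun p =>
      1 / (Nat.doubleFactorial (n - 2) : ℝ) * radialIter F (k + 1) p := by
  rw [dd_waveV hF]
  ext p
  have : (n : ℝ) = 2 * k + 3 := by exact_mod_cast hn
  simp only [radialIter, eR, this]
  ring

/-- `waveV` solves the free wave equation. -/
theorem dd_dd_waveV (hn : n = 2 * k + 3) (hF : ContDiff ℝ (k + 2 : ℕ) F) {p : ℝ × ℝ × Space n}
    (hp : 0 ≤ p.1) :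
    dd (eR n) (dd (eR n) (waveV k F)) p = waveV k (lapAlong eX F) p := by
  have : NeZero n := ⟨by omega⟩
  have hF1 : ContDiff ℝ (k + 1 : ℕ) F := hF.of_le (by exact_mod_cast Nat.le_succ _)
  have h1 : ContDiff ℝ 1 (radialIter F (k + 1)) := contDiff_one_radialIter hF
  have h2 : Continuous (waveV k (lapAlong eX F)) :=
    (contDiff_waveV (i := 0) (by simpa using contDiff_lapAlong_add_two hF eX)).continuous
  rw [dd_eR_waveV hn hF1, dd_const_mul _ (h1.differentiable one_ne_zero)]
  obtain ⟨r, b, x⟩ := p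
  have h3 : EqOn (fun r => 1 / (Nat.doubleFactorial (n - 2) : ℝ) *
      dd (eR n) (radialIter F (k + 1)) (r, b, x)) (fun r => waveV k (lapAlong eX F) (r, b, x))
      (Ioi 0) := by
    intro r hr
    have h4 := mul_dd_radialIter_succ (p := (r, b, x)) hF (le_of_lt hr)
    have hr' : r ≠ 0 := ne_of_gt hr
    have h5 : dd (eR n) (radialIter F (k + 1)) (r, b, x)
        = r * radialIter (lapAlong eX F) k (r, b, x) := by
      apply mul_left_cancel₀ hr'
      simp only at h4
      linear_combination h4
    simp only [waveV, h5]
  -- Division by `r` gives the equation for `r > 0`; it extends to `r = 0` by continuity.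
  have h6 := h3.closure (by have := continuous_dd (v := eR n) h1; fun_prop) (by fun_prop)
  rw [closure_Ioi] at h6
  exact h6 hp

lemma waveV_zero (b : ℝ) (x : Space n) : waveV k F (0, b, x) = 0 := by simp [waveV]

/-- At `r = 0` the Euler operators act by multiplication with `n - 2, n - 4, …`, which produces the
double factorial. -/
lemma radialIter_zero (hn : n = 2 * k + 3) (b : ℝ) (x : Space n) {j : ℕ} (hj : j ≤ k + 1) :
    radialIter F j (0, b, x) * (Nat.doubleFactorial (2 * (k + 1 - j) - 1) : ℝ)
      = (Nat.doubleFactorial (n - 2) : ℝ) * F (b, x) := by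
  induction j with
  | zero =>
    have : n - 2 = 2 * (k + 1 - 0) - 1 := by omega
    have hne : NeZero n := ⟨by omega⟩
    have h0 : (sphereMeasure n).real univ ≠ 0 := by
      refine ENNReal.toReal_ne_zero.2 ⟨?_, measure_ne_top _ _⟩
      have : 0 < (volume : Measure (Space n)) (Metric.ball 0 1) :=
        Metric.measure_ball_pos _ _ one_pos
      simp [this.ne', hne.ne]
    rw [← this]
    simp only [radialIter, sphMean, sphericalMean, average_eq, zero_smul, add_zero,
      integral_const, smul_eq_mul]
    rw [inv_mul_cancel_left₀ h0]
    ring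
  | succ j ih =>
    rw [← ih (by omega)]
    obtain ⟨m, hm⟩ : ∃ m, k + 1 - j = m + 1 := ⟨k - j, by omega⟩
    have h1 : k + 1 - (j + 1) = m := by omega
    rw [h1, hm]
    simp only [radialIter, zero_mul, add_zero]
    have h2 : (n : ℝ) - 2 - 2 * j = 2 * m + 1 := by
      have : n = 2 * (m + j) + 3 := by omega
      rw [this]; push_cast; ring
    rw [h2]
    rcases m with _ | m
    · simp
    · have h3 : 2 * (m + 1 + 1) - 1 = (2 * m + 1) + 2 := by omega
      have h4 : 2 * (m + 1) - 1 = 2 * m + 1 := by omega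
      rw [h3, h4, Nat.doubleFactorial_add_two]
      push_cast
      ring

lemma dd_eR_waveV_zero (hn : n = 2 * k + 3) (hF : ContDiff ℝ (k + 1 : ℕ) F) (b : ℝ) (x : Space n) :
    dd (eR n) (waveV k F) (0, b, x) = F (b, x) := by
  rw [dd_eR_waveV hn hF]
  have h1 := radialIter_zero (F := F) hn b x (le_refl (k + 1))
  have h2 : (Nat.doubleFactorial (n - 2) : ℝ) ≠ 0 := by
    exact_mod_cast (Nat.doubleFactorial_pos _).ne'
  simp only [Nat.sub_self, mul_zero, Nat.zero_sub, Nat.doubleFactorial, Nat.cast_one,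
    mul_one] at h1
  simp only [h1]
  field_simp

lemma radialDeriv_iterate (hn : n = 2 * k + 3) (hF : ContDiff ℝ (k : ℕ) F) (b : ℝ) (x : Space n)
    {j : ℕ} (hj : j ≤ k) {r : ℝ} (hr : r ≠ 0) :
    radialDeriv^[j] (fun r => r ^ (n - 2) * sphericalMean (fun y => F (b, y)) x r) r
      = r ^ (2 * (k - j) + 1) * radialIter F j (r, b, x) := by
  induction j generalizing r with
  | zero =>
    have : n - 2 = 2 * (k - 0) + 1 := by omega
    simp [radialIter, sphMean, this]
  | succ j ih =>
    rw [Function.iterate_succ_apply', radialDeriv]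
    have hev : radialDeriv^[j] (fun r => r ^ (n - 2) * sphericalMean (fun y => F (b, y)) x r)
        =ᶠ[𝓝 r] fun r => r ^ (2 * (k - j) + 1) * radialIter F j (r, b, x) := by
      filter_upwards [isOpen_ne.mem_nhds hr] with s hs using ih (by omega) hs
    rw [hev.deriv_eq]
    have h1 : ContDiff ℝ 1 (radialIter F j) :=
      contDiff_one_radialIter (hF.of_le (by exact_mod_cast hj))
    have h2 : HasDerivAt (fun r => radialIter F j (r, b, x))
        (dd (eR n) (radialIter F j) (r, b, x)) r :=
      hasDerivAt_comp_dd (h1.differentiable one_ne_zero _) rfl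
        ((hasDerivAt_id r).prodMk (hasDerivAt_const r (b, x)))
    rw [((hasDerivAt_pow (2 * (k - j) + 1) r).fun_mul h2).deriv]
    obtain ⟨m, hm⟩ : ∃ m, k - j = m + 1 := ⟨k - j - 1, by omega⟩
    have h3 : k - (j + 1) = m := by omega
    have h4 : (n : ℝ) - 2 - 2 * j = 2 * (m + 1) + 1 := by
      have : n = 2 * (m + 1 + j) + 3 := by omega
      rw [this]; push_cast; ring
    rw [h3, hm]
    simp only [radialIter, h4]
    have h5 : 2 * (m + 1) + 1 - 1 = 2 * m + 2 := by omega
    rw [h5]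
    push_cast
    field_simp
    ring

/-- The classical formula is the time derivative of `waveV`, for all times including zero. -/
theorem freeWave_eq (hn : n = 2 * k + 3) (hF : ContDiff ℝ (k + 1 : ℕ) F) (b t : ℝ) (x : Space n) :
    freeWave (fun y => F (b, y)) t x = dd (eR n) (waveV k F) (t, b, x) := by
  have hF0 : ContDiff ℝ (k : ℕ) F := hF.of_le (by exact_mod_cast Nat.le_succ _)
  have h1 : radialDeriv^[(n - 3) / 2]
      (fun r => r ^ (n - 2) * sphericalMean (fun y => F (b, y)) x r)
      = fun r => r * radialIter F k (r, b, x) := by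
    have hk : (n - 3) / 2 = k := by omega
    rw [hk]
    ext r
    by_cases hr : r = 0
    · subst hr
      rcases k with _ | k
      · have : n - 2 ≠ 0 := by omega
        simp [this]
      · -- at the origin `(1 / t) ∂_t` takes the value zero
        rw [Function.iterate_succ_apply', radialDeriv]
        simp
    · rw [radialDeriv_iterate hn hF0 b x le_rfl hr]
      simp
  have h2 : HasDerivAt (fun r => waveV k F (r, b, x)) (dd (eR n) (waveV k F) (t, b, x)) t :=
    hasDerivAt_comp_dd ((contDiff_waveV (i := 1) (by rwa [add_comm])).differentiable
      (by simp) _) rfl ((hasDerivAt_id t).prodMk (hasDerivAt_const t (b, x)))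
  rw [freeWave, h1, ← h2.deriv]
  simp only [waveV, deriv_const_mul_field]

lemma waveV_add {F G : ℝ × Space n → ℝ} (hF : ContDiff ℝ (k : ℕ) F) (hG : ContDiff ℝ (k : ℕ) G) :
    waveV k (fun p => F p + G p) = fun p => waveV k F p + waveV k G p := by
  ext p
  simp only [waveV, radialIter_add hF hG]
  ring

lemma freeWave_add (hn : n = 2 * k + 3) {φ ψ : Space n → ℝ} (hφ : ContDiff ℝ (k + 1 : ℕ) φ)
    (hψ : ContDiff ℝ (k + 1 : ℕ) ψ) (t : ℝ) (x : Space n) :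
    freeWave (fun y => φ y + ψ y) t x = freeWave φ t x + freeWave ψ t x := by
  have h1 : ContDiff ℝ (k + 1 : ℕ) fun p : ℝ × Space n => φ p.2 := hφ.comp contDiff_snd
  have h2 : ContDiff ℝ (k + 1 : ℕ) fun p : ℝ × Space n => ψ p.2 := hψ.comp contDiff_snd
  have hd : ∀ {F : ℝ × Space n → ℝ}, ContDiff ℝ (k + 1 : ℕ) F → Differentiable ℝ (waveV k F) :=
    fun hF => (contDiff_waveV (i := 1) (by rwa [add_comm])).differentiable (by simp)
  have e1 := freeWave_eq hn h1 0 t x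
  have e2 := freeWave_eq hn h2 0 t x
  have e3 := freeWave_eq hn (h1.add h2) 0 t x
  rw [waveV_add (h1.of_le (by exact_mod_cast Nat.le_succ _))
    (h2.of_le (by exact_mod_cast Nat.le_succ _)), dd_add (hd h1) (hd h2)] at e3
  exact e3.trans (congrArg₂ (· + ·) e1.symm e2.symm)

/-- Homogeneity holds without any regularity, since `deriv` and the mean commute with scalars even
where they take junk values. -/
lemma freeWave_const_mul (c : ℝ) (φ : Space n → ℝ) (t : ℝ) (x : Space n) :
    freeWave (fun y => c * φ y) t x = c * freeWave φ t x := by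
  have h1 : (fun r : ℝ => r ^ (n - 2) * sphericalMean (fun y => c * φ y) x r)
      = fun r => c * (r ^ (n - 2) * sphericalMean φ x r) := by
    ext r
    simp only [sphericalMean, average_eq, smul_eq_mul, integral_const_mul]
    ring
  have h2 : ∀ (j : ℕ) (g : ℝ → ℝ), radialDeriv^[j] (fun r => c * g r)
      = fun r => c * radialDeriv^[j] g r := fun j => by
    induction j with
    | zero => intro g; rfl
    | succ j ih =>
      intro g
      have : radialDeriv (fun r => c * g r) = fun r => c * radialDeriv g r := by
        ext r
        simp only [radialDeriv, deriv_const_mul_field]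
        ring
      rw [Function.iterate_succ_apply, Function.iterate_succ_apply, this, ih]
  rw [freeWave, freeWave, h1, h2, deriv_const_mul_field]
  ring

end FreeWave

/-! ### The hypergeometric profile of the kernel -/

section Hypergeometric

section PowerSeries

variable {c : ℕ → ℂ}

lemma hasSum_mul_deriv_tsum (hc : ∀ ρ : ℝ, 0 ≤ ρ → ρ < 1 → Summable fun i => ‖c i‖ * ρ ^ i) {z : ℂ}
    (hz : ‖z‖ < 1) :
    HasSum (fun i => c i * (i * z ^ (i - 1))) (deriv (fun w => ∑' i, c i * w ^ i) z) := by
  obtain ⟨ρ, hzρ, hρ⟩ := exists_between hz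
  have hρ0 : 0 ≤ ρ := (norm_nonneg z).trans hzρ.le
  have h := Complex.hasSum_deriv_of_summable_norm (F := fun i w => c i * w ^ i)
    (U := Metric.ball (0 : ℂ) ρ) (hc ρ hρ0 hρ)
    (fun i => by fun_prop) Metric.isOpen_ball (fun i w hw => by
      have hw' : ‖w‖ ≤ ρ := by simpa using (Metric.mem_ball.1 hw).le
      rw [norm_mul, norm_pow]
      gcongr) (show z ∈ Metric.ball (0 : ℂ) ρ by simpa using hzρ)
  simpa using h

lemma summable_coeff_mul (hc : ∀ ρ : ℝ, 0 ≤ ρ → ρ < 1 → Summable fun i => ‖c i‖ * ρ ^ i) :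
    ∀ ρ : ℝ, 0 ≤ ρ → ρ < 1 → Summable fun i : ℕ => ‖(i : ℂ) * c i‖ * ρ ^ i := by
  intro ρ hρ0 hρ
  have h := hasSum_mul_deriv_tsum (c := fun i => ((‖c i‖ : ℝ) : ℂ)) (by simpa using hc)
    (z := (ρ : ℂ)) (by simpa [abs_of_nonneg hρ0] using hρ)
  refine ((h.summable.norm).mul_right ρ).congr fun i => ?_
  rcases i with _ | i
  · simp
  · simp [abs_of_nonneg hρ0, pow_succ]
    ring

lemma hasSum_tsum (hc : ∀ ρ : ℝ, 0 ≤ ρ → ρ < 1 → Summable fun i => ‖c i‖ * ρ ^ i) {z : ℂ}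
    (hz : ‖z‖ < 1) : HasSum (fun i => c i * z ^ i) (∑' i, c i * z ^ i) := by
  refine (Summable.of_norm ?_).hasSum
  simpa [norm_mul, norm_pow] using hc ‖z‖ (norm_nonneg z) hz

lemma hasSum_euler (hc : ∀ ρ : ℝ, 0 ≤ ρ → ρ < 1 → Summable fun i => ‖c i‖ * ρ ^ i) {z : ℂ}
    (hz : ‖z‖ < 1) :
    HasSum (fun i : ℕ => (i : ℂ) * c i * z ^ i) (z * deriv (fun w => ∑' i, c i * w ^ i) z) := by
  convert! (hasSum_mul_deriv_tsum hc hz).mul_left z using 1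
  ext i
  rcases i with _ | i
  · simp
  · simp [pow_succ]; ring

lemma hasSum_deriv_shift (hc : ∀ ρ : ℝ, 0 ≤ ρ → ρ < 1 → Summable fun i => ‖c i‖ * ρ ^ i) {z : ℂ}
    (hz : ‖z‖ < 1) :
    HasSum (fun i : ℕ => ((i : ℂ) + 1) * c (i + 1) * z ^ i)
      (deriv (fun w => ∑' i, c i * w ^ i) z) := by
  have h := (hasSum_nat_add_iff' 1).2 (hasSum_mul_deriv_tsum hc hz)
  simp only [Finset.range_one, Finset.sum_singleton, Nat.cast_zero, zero_mul, mul_zero, sub_zero,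
    Nat.add_sub_cancel, Nat.cast_add, Nat.cast_one] at h
  convert! h using 1
  ext i; ring

lemma differentiableAt_tsum (hc : ∀ ρ : ℝ, 0 ≤ ρ → ρ < 1 → Summable fun i => ‖c i‖ * ρ ^ i) {z : ℂ}
    (hz : ‖z‖ < 1) : DifferentiableAt ℂ (fun w => ∑' i, c i * w ^ i) z := by
  obtain ⟨ρ, hzρ, hρ⟩ := exists_between hz
  have hρ0 : 0 ≤ ρ := (norm_nonneg z).trans hzρ.le
  refine (Complex.differentiableOn_tsum_of_summable_norm (F := fun i w => c i * w ^ i)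
    (U := Metric.ball (0 : ℂ) ρ) (hc ρ hρ0 hρ)
    (fun i => by fun_prop) Metric.isOpen_ball fun i w hw => ?_).differentiableAt
    (Metric.isOpen_ball.mem_nhds (show z ∈ Metric.ball (0 : ℂ) ρ by simpa using hzρ))
  have hw' : ‖w‖ ≤ ρ := by simpa using (Metric.mem_ball.1 hw).le
  rw [norm_mul, norm_pow]
  gcongr

end PowerSeries

lemma one_le_radius_hypergeometric (a : ℂ) :
    1 ≤ (ordinaryHypergeometricSeries ℂ a a (1 : ℂ)).radius := by
  by_cases h : ∃ k : ℕ, (k : ℂ) = -a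
  · obtain ⟨k, hk⟩ := h
    obtain rfl : a = -(k : ℂ) := by rw [hk, neg_neg]
    rw [ordinaryHypergeometric_radius_top_of_neg_nat₁]
    exact le_top
  · push Not at h
    refine (ordinaryHypergeometricSeries_radius_eq_one ℂ a a 1 fun k => ⟨h k, h k, fun h1 => ?_⟩).ge
    have := congrArg Complex.re h1
    simp at this
    have h2 : (0 : ℝ) ≤ k := k.cast_nonneg
    linarith

/-- The function `₂F₁(a, a; 1; ·)` and its Euler derivative `g = z F'` satisfy the first-order form
`(1 - z) g' = 2 a g + a² F` of the hypergeometric equation. -/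
lemma exists_hypergeometric_system (a : ℂ) : ∃ g : ℂ → ℂ,
    (∀ z : ℂ, ‖z‖ < 1 → DifferentiableAt ℂ (ordinaryHypergeometric a a (1 : ℂ)) z ∧
      DifferentiableAt ℂ g z ∧ g z = z * deriv (ordinaryHypergeometric a a (1 : ℂ)) z ∧
      (1 - z) * deriv g z = 2 * a * g z + a ^ 2 * ordinaryHypergeometric a a (1 : ℂ) z) := by
  set c : ℕ → ℂ := fun i => ordinaryHypergeometricCoefficient a a (1 : ℂ) i with hcdef
  have hf : ordinaryHypergeometric a a (1 : ℂ) = fun w : ℂ => ∑' i, c i * w ^ i := by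
    rw [ordinaryHypergeometric_eq_tsum]
    rfl
  have hc : ∀ ρ : ℝ, 0 ≤ ρ → ρ < 1 → Summable fun i => ‖c i‖ * ρ ^ i := by
    intro ρ hρ0 hρ
    have h := (ordinaryHypergeometricSeries ℂ a a (1 : ℂ)).summable_norm_mul_pow (r := ⟨ρ, hρ0⟩)
      (lt_of_lt_of_le (ENNReal.coe_lt_one_iff.2 (NNReal.coe_lt_one.1 hρ))
        (one_le_radius_hypergeometric a))
    refine h.congr fun i => ?_
    rw [ordinaryHypergeometricSeries, FormalMultilinearSeries.ofScalars_norm]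
    rfl
  -- the recurrence of the hypergeometric coefficients
  have hrec : ∀ i : ℕ, ((i : ℂ) + 1) * (((i : ℂ) + 1) * c (i + 1)) = (i + a) ^ 2 * c i := by
    intro i
    have h1 : ((i : ℂ) + 1) ≠ 0 := by exact_mod_cast Nat.succ_ne_zero i
    have h2 : (ascPochhammer ℂ i).eval (1 : ℂ) ≠ 0 := by
      rw [ascPochhammer_eval_one]; exact_mod_cast i.factorial_ne_zero
    have h3 : ((i.factorial : ℕ) : ℂ) ≠ 0 := by exact_mod_cast i.factorial_ne_zero
    simp only [hcdef, ordinaryHypergeometricCoefficient, ascPochhammer_succ_eval,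
      Nat.factorial_succ, Nat.cast_mul, Nat.cast_add, Nat.cast_one]
    have h4 : (1 : ℂ) + i ≠ 0 := by rwa [add_comm]
    field_simp
    ring
  have he := summable_coeff_mul hc
  set g : ℂ → ℂ := fun w => ∑' i : ℕ, ((i : ℂ) * c i) * w ^ i with hg
  refine ⟨g, fun z hz => ?_⟩
  have hgz : g z = z * deriv (fun w : ℂ => ∑' i, c i * w ^ i) z := (hasSum_euler hc hz).tsum_eq
  rw [hf]
  refine ⟨differentiableAt_tsum hc hz, differentiableAt_tsum he hz, hgz, ?_⟩
  have s0 := hasSum_tsum hc hz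
  have s1 := hasSum_tsum he hz
  have s2 := hasSum_euler he hz
  have s3 := hasSum_deriv_shift he hz
  have s4 := (s2.add (s1.mul_left (2 * a))).add (s0.mul_left (a ^ 2))
  have h5 : (fun i : ℕ => ((i : ℂ) + 1) * (((i + 1 : ℕ) : ℂ) * c (i + 1)) * z ^ i)
      = fun i : ℕ => (i : ℂ) * (i * c i) * z ^ i + 2 * a * (i * c i * z ^ i)
        + a ^ 2 * (c i * z ^ i) := by
    ext i
    push_cast
    rw [hrec i]; ring
  rw [h5] at s3
  have h6 := s3.unique s4
  change deriv g z = z * deriv g z + 2 * a * g z + a ^ 2 * _ at h6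
  linear_combination h6

/-- The kernel profile as a complex-valued function of `q = z / (1 - z)`. -/
def profileC (a : ℂ) (q : ℝ) : ℂ :=
  ((1 + q : ℝ) : ℂ) ^ (-a) * ordinaryHypergeometric a a (1 : ℂ) ((q / (1 + q) : ℝ) : ℂ)

lemma norm_div_one_add_lt {q : ℝ} (hq : -(1 / 2) < q) : ‖((q / (1 + q) : ℝ) : ℂ)‖ < 1 := by
  rw [Complex.norm_real, Real.norm_eq_abs, abs_div, abs_of_pos (by linarith : 0 < 1 + q),
    div_lt_one (by linarith), abs_lt]
  constructor <;> linarith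

lemma contDiffAt_profileC (a : ℂ) {q : ℝ} (hq : -(1 / 2) < q) :
    ContDiffAt ℝ ∞ (profileC a) q := by
  obtain ⟨g, hg⟩ := exists_hypergeometric_system a
  have h0 : (0 : ℝ) < 1 + q := by linarith
  have h0' : (1 : ℂ) + q ≠ 0 := by exact_mod_cast h0.ne'
  have hF : AnalyticAt ℂ (ordinaryHypergeometric a a (1 : ℂ)) ((q : ℂ) / (1 + q)) := by
    refine DifferentiableOn.analyticAt (s := Metric.ball 0 1)
      (fun z hz => (hg z (by simpa using hz)).1.differentiableWithinAt) ?_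
    refine Metric.isOpen_ball.mem_nhds ?_
    have := norm_div_one_add_lt hq
    push_cast at this
    simpa using this
  have h1 : AnalyticAt ℂ (fun w : ℂ => (1 + w) ^ (-a)
      * ordinaryHypergeometric a a (1 : ℂ) (w / (1 + w))) q := by
    refine AnalyticAt.mul (AnalyticAt.cpow (by fun_prop) (by fun_prop) (Or.inl ?_)) ?_
    · simpa using h0
    · exact AnalyticAt.comp (f := fun w : ℂ => w / (1 + w)) hF
        (AnalyticAt.div (by fun_prop) (by fun_prop) h0')
  have h2 : ContDiffAt ℝ ∞ (fun w : ℂ => (1 + w) ^ (-a)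
      * ordinaryHypergeometric a a (1 : ℂ) (w / (1 + w))) q := h1.contDiffAt.restrict_scalars ℝ
  have h3 := h2.comp q Complex.ofRealCLM.contDiff.contDiffAt
  convert! h3 using 1
  ext s
  simp [profileC]

/-- The equation `(q (1 + q) P')' = -a (1 - a) P` for the profile, in first-order form. -/
lemma exists_profileC_system (a : ℂ) : ∃ Y : ℝ → ℂ, ∀ q : ℝ, -(1 / 2) < q →
    ((q * (1 + q) : ℝ) : ℂ) * deriv (profileC a) q = Y q ∧
      HasDerivAt Y (-(a * (1 - a)) * profileC a q) q := by
  obtain ⟨g, hg⟩ := exists_hypergeometric_system a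
  set F : ℂ → ℂ := ordinaryHypergeometric a a (1 : ℂ) with hF
  refine ⟨fun q => ((1 + q : ℝ) : ℂ) ^ (-a) * (g ((q / (1 + q) : ℝ) : ℂ)
    - a * q * F ((q / (1 + q) : ℝ) : ℂ)), fun q hq => ?_⟩
  have h0 : (0 : ℝ) < 1 + q := by linarith
  have h0' : ((1 + q : ℝ) : ℂ) ≠ 0 := by exact_mod_cast h0.ne'
  obtain ⟨dF, dg, e1, e2⟩ := hg _ (norm_div_one_add_lt hq)
  have hz : HasDerivAt (fun s : ℝ => ((s / (1 + s) : ℝ) : ℂ)) ((1 / (1 + q) ^ 2 : ℝ) : ℂ) q := by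
    have h1 : HasDerivAt (fun s : ℝ => s / (1 + s)) (1 / (1 + q) ^ 2) q := by
      exact ((hasDerivAt_id' q).fun_div ((hasDerivAt_id' q).const_add 1) h0.ne').congr_deriv
        (by ring)
    exact h1.ofReal_comp
  have hp : HasDerivAt (fun s : ℝ => ((1 + s : ℝ) : ℂ) ^ (-a))
      (-a * ((1 + q : ℝ) : ℂ) ^ (-a - 1) * ((1 : ℝ) : ℂ)) q := by
    have h1 : HasDerivAt (fun w : ℂ => (1 + w) ^ (-a)) (-a * (1 + q) ^ (-a - 1) * 1) (q : ℂ) :=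
      ((hasDerivAt_id' (q : ℂ)).const_add 1).cpow_const (Or.inl (by simpa using h0))
    have h2 := h1.comp_ofReal
    simpa using h2
  have hFz := dF.hasDerivAt.comp q hz
  have hgz := dg.hasDerivAt.comp q hz
  have hq' : HasDerivAt (fun s : ℝ => (s : ℂ)) 1 q := by simpa using (hasDerivAt_id' q).ofReal_comp
  rw [Complex.cpow_sub _ _ h0', Complex.cpow_one] at hp
  have hP : HasDerivAt (profileC a) _ q := hp.mul hFz
  have hY := hp.mul (hgz.sub ((hq'.const_mul a).mul hFz))
  set z : ℂ := ((q / (1 + q) : ℝ) : ℂ) with hzdef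
  have hz1 : z * ((1 + q : ℝ) : ℂ) = q := by
    rw [hzdef]; push_cast; push_cast at h0'; field_simp
  have hz2 : (1 - z) * ((1 + q : ℝ) : ℂ) = 1 := by
    rw [sub_mul, hz1]; push_cast; ring
  have e3 : deriv g z = ((1 + q : ℝ) : ℂ) * (2 * a * g z + a ^ 2 * F z) := by
    rw [← e2]; linear_combination -deriv g z * hz2
  have e4 : (q : ℂ) * deriv F z = ((1 + q : ℝ) : ℂ) * g z := by
    rw [e1, ← hz1]; ring
  have h0'' : (1 : ℂ) + q ≠ 0 := by exact_mod_cast h0'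
  constructor
  · rw [hP.deriv]
    simp only [← hzdef]
    set A := ((1 + q : ℝ) : ℂ) ^ (-a)
    push_cast at e4 ⊢
    field_simp
    linear_combination A * e4
  · refine hY.congr_deriv ?_
    simp only [Function.comp, ← hzdef, Pi.mul_apply, Pi.sub_apply, profileC, ← hF]
    set A := ((1 + q : ℝ) : ℂ) ^ (-a)
    rw [e3]
    push_cast at e4 ⊢
    field_simp
    linear_combination (-a) * A * e4

lemma two_le_infty : (2 : ℕ∞ω) ≤ ∞ := WithTop.coe_le_coe.2 le_top

/-- Uniqueness of the regular solution at the singular point `q = 0`, by the energy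
`h² + q (1 + q) h'²`. -/
lemma eq_zero_of_profile_ode {h k : ℝ → ℝ} {l : ℝ}
    (hh : ∀ q, -(1 / 2) < q → ContDiffAt ℝ 2 h q)
    (hk : ∀ q, -(1 / 2) < q → q * (1 + q) * deriv h q = k q ∧ HasDerivAt k (-l * h q) q)
    (h0 : h 0 = 0) {q : ℝ} (hq : 0 ≤ q) : h q = 0 := by
  set C : ℝ := (1 - l) ^ 2
  set Q : ℝ → ℝ := fun q => h q ^ 2 + k q * deriv h q with hQ
  have hd : ∀ s, 0 ≤ s → ∃ h2 : ℝ, HasDerivAt h (deriv h s) s ∧ HasDerivAt (deriv h) h2 s ∧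
      (1 + 2 * s) * deriv h s + s * (1 + s) * h2 = -l * h s := by
    intro s hs
    have hs' : -(1 / 2) < s := by linarith
    have e1 : DifferentiableAt ℝ (deriv h) s :=
      ((hh s hs').derivWithin (m := 1) (by norm_num)).differentiableAt one_ne_zero
    refine ⟨_, ((hh s hs').differentiableAt two_ne_zero).hasDerivAt, e1.hasDerivAt, ?_⟩
    have e2 : HasDerivAt (fun s : ℝ => s * (1 + s) * deriv h s)
        ((1 * (1 + s) + s * 1) * deriv h s + s * (1 + s) * deriv (deriv h) s) s :=
      (((hasDerivAt_id s).mul ((hasDerivAt_id s).const_add 1))).mul e1.hasDerivAt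
    have e3 : (fun s : ℝ => s * (1 + s) * deriv h s) =ᶠ[𝓝 s] k := by
      filter_upwards [lt_mem_nhds hs'] with r hr using (hk r hr).1
    have e4 := (e2.congr_of_eventuallyEq e3.symm).unique (hk s hs').2
    linear_combination e4
  have hQd : ∀ s, 0 ≤ s → ∃ d, HasDerivAt Q d s ∧ d ≤ C * Q s := by
    intro s hs
    have hs' : -(1 / 2) < s := by linarith
    obtain ⟨h2, e1, e2, e3⟩ := hd s hs
    refine ⟨_, (e1.pow 2).add ((hk s hs').2.mul e2), ?_⟩
    simp only [hQ, ← (hk s hs').1, C]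
    have e5 : 0 ≤ s * (1 + s) * deriv h s ^ 2 := by positivity
    have e6 : s * (1 + s) * h2 = -l * h s - (1 + 2 * s) * deriv h s := by linear_combination e3
    have e7 : s * (1 + s) * deriv h s * h2 = (-l * h s - (1 + 2 * s) * deriv h s) * deriv h s := by
      rw [← e6]; ring
    rw [e7]
    push_cast
    -- The energy has derivative `2 (1 - l) h h' - (1 + 2 s) h'² ≤ (1 - l)² h²`.
    nlinarith [sq_nonneg ((1 - l) * h s - deriv h s), mul_nonneg (sq_nonneg (1 - l)) e5,
      mul_nonneg hs (sq_nonneg (deriv h s))]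
  choose! d hd1 hd2 using hQd
  have hanti : AntitoneOn (fun s => Real.exp (-C * s) * Q s) (Ici 0) := by
    have hE : ∀ s, 0 ≤ s → HasDerivAt (fun s => Real.exp (-C * s) * Q s)
        (Real.exp (-C * s) * (d s - C * Q s)) s := by
      intro s hs
      have h2 : HasDerivAt (fun t => -C * t) (-C) s := by
        simpa only [mul_one] using (hasDerivAt_id' s).const_mul (-C)
      convert! h2.exp.mul (hd1 s hs) using 1
      ring
    refine antitoneOn_of_deriv_nonpos (convex_Ici 0)
      (fun s hs => (hE s hs).continuousAt.continuousWithinAt) (fun s hs =>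
        (hE s (interior_subset hs)).differentiableAt.differentiableWithinAt) fun s hs => ?_
    rw [(hE s (interior_subset hs)).deriv]
    exact mul_nonpos_of_nonneg_of_nonpos (Real.exp_pos _).le
      (by linarith [hd2 s (interior_subset hs)])
  have hQ0 : Q 0 = 0 := by
    have : k 0 = 0 := by rw [← (hk 0 (by norm_num)).1]; ring
    simp [hQ, h0, this]
  have h1 := hanti self_mem_Ici hq hq
  simp only [hQ0, mul_zero] at h1
  have h2 : Q q ≤ 0 := nonpos_of_mul_nonpos_right h1 (Real.exp_pos _)
  simp only [hQ, ← (hk q (by linarith)).1] at h2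
  have h3 : 0 ≤ q * (1 + q) * deriv h q * deriv h q := by
    have : q * (1 + q) * deriv h q * deriv h q = q * (1 + q) * deriv h q ^ 2 := by ring
    rw [this]; positivity
  have h4 : h q ^ 2 = 0 := le_antisymm (by linarith) (sq_nonneg _)
  exact pow_eq_zero_iff two_ne_zero |>.1 h4

/-- The real kernel profile: a smooth function on the line that satisfies a Legendre-type equation
near `[0, ∞)` and agrees on `[0, ∞)` with the complex expression
of the kernel. -/
theorem exists_profile {a : ℂ} {l : ℝ} (ha : a * (1 - a) = l) :
    ∃ P : ℝ → ℝ, ContDiff ℝ ∞ P ∧ P 0 = 1 ∧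
      (∀ q, -(1 / 8) < q →
        q * (1 + q) * deriv (deriv P) q + (1 + 2 * q) * deriv P q + l * P q = 0) ∧
      ∀ q, 0 ≤ q → profileC a q = P q := by
  obtain ⟨Y, hY⟩ := exists_profileC_system a
  have hre : ∀ q, -(1 / 2) < q → ContDiffAt ℝ ∞ (fun q => (profileC a q).re) q := fun q hq =>
    Complex.reCLM.contDiff.contDiffAt.comp q (contDiffAt_profileC a hq)
  have him : ∀ q, -(1 / 2) < q → ContDiffAt ℝ ∞ (fun q => (profileC a q).im) q := fun q hq =>
    Complex.imCLM.contDiff.contDiffAt.comp q (contDiffAt_profileC a hq)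
  have hd : ∀ q, -(1 / 2) < q → HasDerivAt (profileC a) (deriv (profileC a) q) q := fun q hq =>
    ((contDiffAt_profileC a hq).differentiableAt (by simp)).hasDerivAt
  have h1 : profileC a 0 = 1 := by
    simp [profileC, ordinaryHypergeometric_zero]
  have him0 : ∀ q, 0 ≤ q → (profileC a q).im = 0 := fun q hq => by
    refine eq_zero_of_profile_ode (h := fun q => (profileC a q).im) (k := fun q => (Y q).im)
      (l := l) (fun s hs => (him s hs).of_le two_le_infty) (fun s hs => ⟨?_, ?_⟩) (by simp [h1]) hq
    · have e1 : HasDerivAt (fun q => (profileC a q).im) (deriv (profileC a) s).im s :=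
        Complex.imCLM.hasFDerivAt.comp_hasDerivAt s (hd s hs)
      rw [e1.deriv, ← (hY s hs).1, Complex.im_ofReal_mul]
    · have e1 := Complex.imCLM.hasFDerivAt.comp_hasDerivAt s (hY s hs).2
      refine e1.congr_deriv ?_
      rw [ha]
      simp
  -- A cut-off at `q < -1/4` makes the real part of the profile smooth on the whole line.
  set χ : ℝ → ℝ := fun q => Real.smoothTransition ((q + 1 / 4) * 8) with hχ
  have hχc : ContDiff ℝ ∞ χ := (Real.smoothTransition.contDiff (n := ⊤)).comp (by fun_prop)
  set P : ℝ → ℝ := fun q => χ q * (profileC a q).re with hP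
  have hPe : ∀ q, -(1 / 8) ≤ q → P q = (profileC a q).re := fun q hq => by
    simp only [hP, hχ]
    rw [Real.smoothTransition.one_of_one_le (by linarith), one_mul]
  refine ⟨P, ?_, by rw [hPe 0 (by norm_num), h1]; simp, fun q hq => ?_, fun q hq => ?_⟩
  · refine contDiff_iff_contDiffAt.2 fun q => ?_
    rcases lt_or_ge (-(1 / 2)) q with hq | hq
    · exact hχc.contDiffAt.mul (hre q hq)
    · refine (contDiffAt_const (c := (0 : ℝ))).congr_of_eventuallyEq ?_
      filter_upwards [gt_mem_nhds (show q < -(1 / 4) by linarith)] with s hs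
      simp only [hP, hχ]
      rw [Real.smoothTransition.zero_of_nonpos (by linarith), zero_mul]
  · have e1 : ∀ s, -(1 / 8) < s → deriv P s = (deriv (profileC a) s).re := fun s hs => by
      have e2 : HasDerivAt (fun q => (profileC a q).re) (deriv (profileC a) s).re s :=
        Complex.reCLM.hasFDerivAt.comp_hasDerivAt s (hd s (by linarith))
      have e3 : P =ᶠ[𝓝 s] fun q => (profileC a q).re := by
        filter_upwards [lt_mem_nhds hs] with r hr using hPe r hr.le
      rw [e3.deriv_eq, e2.deriv]
    have hPc : ContDiffAt ℝ ∞ P q := by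
      refine (hre q (by linarith)).congr_of_eventuallyEq ?_
      filter_upwards [lt_mem_nhds hq] with r hr using hPe r hr.le
    have e4 : DifferentiableAt ℝ (deriv P) q :=
      (hPc.derivWithin (m := 1) two_le_infty).differentiableAt one_ne_zero
    have e5 : HasDerivAt (fun s : ℝ => s * (1 + s) * deriv P s)
        ((1 * (1 + q) + q * 1) * deriv P q + q * (1 + q) * deriv (deriv P) q) q :=
      (((hasDerivAt_id q).mul ((hasDerivAt_id q).const_add 1))).mul e4.hasDerivAt
    have e6 : (fun s : ℝ => s * (1 + s) * deriv P s) =ᶠ[𝓝 q] fun s => (Y s).re := by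
      filter_upwards [lt_mem_nhds hq] with s hs
      rw [e1 s hs, ← (hY s (by linarith)).1, Complex.re_ofReal_mul]
    have e7 : HasDerivAt (fun s => (Y s).re) (-(a * (1 - a)) * profileC a q).re q :=
      Complex.reCLM.hasFDerivAt.comp_hasDerivAt q (hY q (by linarith)).2
    have e8 := (e5.congr_of_eventuallyEq e6.symm).unique e7
    rw [hPe q hq.le]
    rw [ha] at e8
    simp at e8
    linear_combination e8
  · rw [hPe q (by linarith)]
    exact Complex.ext (by simp) (by simp [him0 q hq])

end Hypergeometric

/-! ### Transmutation kernels -/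

section Kernels

/-- A smooth positive function on the line that equals `1 + t` for `t ≥ -1/4`. It replaces the weight
`1 + t` where global smoothness is convenient. -/
def weight (t : ℝ) : ℝ :=
  1 + Real.smoothTransition (4 * (t + 1 / 2)) * t

lemma contDiff_weight : ContDiff ℝ ∞ weight :=
  contDiff_const.add (((Real.smoothTransition.contDiff (n := ⊤)).comp
    (by fun_prop : ContDiff ℝ ∞ fun t : ℝ => 4 * (t + 1 / 2))).mul contDiff_id)

lemma weight_pos (t : ℝ) : 0 < weight t := by
  unfold weight
  rcases le_or_gt t (-(1 / 2)) with h | h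
  · rw [Real.smoothTransition.zero_of_nonpos (by linarith)]; norm_num
  · nlinarith [Real.smoothTransition.nonneg (4 * (t + 1 / 2)),
      Real.smoothTransition.le_one (4 * (t + 1 / 2))]

lemma weight_eq {t : ℝ} (ht : -(1 / 4) ≤ t) : weight t = 1 + t := by
  rw [weight, Real.smoothTransition.one_of_one_le (by linarith), one_mul]

lemma dd_neg {E : Type*} [NormedAddCommGroup E] [NormedSpace ℝ E] {h : E → ℝ} {v : E} :
    dd v (fun p => -h p) = fun p => -dd v h p := by
  ext p; simp [dd, fderiv_fun_neg]

lemma dd_eqOn {E : Type*} [NormedAddCommGroup E] [NormedSpace ℝ E] {g h : E → ℝ} {U : Set E}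
    (hU : IsOpen U) (hgh : EqOn g h U) (v : E) : EqOn (dd v g) (dd v h) U := fun p hp => by
  have : g =ᶠ[𝓝 p] h := hgh.eventuallyEq_of_mem (hU.mem_nhds hp)
  simp only [dd, this.fderiv_eq]

lemma dd_comp_scalar {E : Type*} [NormedAddCommGroup E] [NormedSpace ℝ E] {P : ℝ → ℝ} {q : E → ℝ}
    (hP : Differentiable ℝ P) (hq : Differentiable ℝ q) (v : E) :
    dd v (fun p => P (q p)) = fun p => deriv P (q p) * dd v q p := by
  ext p
  exact (dd_eq_of_hasFDerivAt ((hP (q p)).hasDerivAt.comp_hasFDerivAt p (hq p).hasFDerivAt)).trans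
    (by simp [dd])

/-- The direction of `t` in the variables `(t, b, s)` of a kernel. -/
abbrev kT : ℝ × ℝ × ℝ := (1, 0, 0)

/-- The direction of `b` in the variables `(t, b, s)` of a kernel. -/
abbrev kB : ℝ × ℝ × ℝ := (0, 1, 0)

/-- The direction of `s` in the variables `(t, b, s)` of a kernel. -/
abbrev kS : ℝ × ℝ × ℝ := (0, 0, 1)

lemma hasDerivAt_kT (t b s : ℝ) : HasDerivAt (fun τ : ℝ => (τ, b, s)) kT t :=
  (hasDerivAt_id' t).prodMk (hasDerivAt_const t (b, s))

lemma hasDerivAt_kB (t b s : ℝ) : HasDerivAt (fun β : ℝ => (t, β, s)) kB b :=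
  (hasDerivAt_const b t).prodMk ((hasDerivAt_id' b).prodMk (hasDerivAt_const b s))

lemma hasDerivAt_kS (t b s : ℝ) : HasDerivAt (fun σ : ℝ => (t, b, σ)) kS s :=
  (hasDerivAt_const s t).prodMk ((hasDerivAt_const s b).prodMk (hasDerivAt_id' s))

/-- A kernel `N(t, b, s)` for which `W ↦ W(t - b) + ∫₀^{t-b} W(s) N(t, b, s) ds` turns solutions of
the wave equation `W_ss = ΔW` into solutions of `T_tt - ΔT + l/(1+t)² T = 0`. -/
structure IsTransmutationKernel (l : ℝ) (N : ℝ × ℝ × ℝ → ℝ) : Prop where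
  contDiff : ContDiff ℝ 2 N
  wave : ∀ t b s, 0 ≤ b → 0 ≤ s → s ≤ t - b →
    dd kT (dd kT N) (t, b, s) - dd kS (dd kS N) (t, b, s) + l / (1 + t) ^ 2 * N (t, b, s) = 0
  diag : ∀ t b, 0 ≤ b → b ≤ t →
    2 * (dd kT N (t, b, t - b) + dd kS N (t, b, t - b)) + l / (1 + t) ^ 2 = 0
  diag_self : ∀ b, 0 ≤ b → N (b, b, 0) = 0

/-- The argument `((t - b)² - s²) / (4 (1 + t) (1 + b))` of the kernel profile. -/
def kerQ (p : ℝ × ℝ × ℝ) : ℝ :=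
  ((p.1 - p.2.1) ^ 2 - p.2.2 ^ 2) / (4 * weight p.1 * weight p.2.1)

lemma contDiff_kerQ : ContDiff ℝ ∞ kerQ := by
  have h1 := contDiff_weight
  refine ContDiff.div (by fun_prop) ?_ fun p =>
    (mul_pos (mul_pos (by norm_num) (weight_pos p.1)) (weight_pos p.2.1)).ne'
  exact (contDiff_const.mul (h1.comp contDiff_fst)).mul (h1.comp (by fun_prop))

lemma differentiable_kerQ : Differentiable ℝ kerQ := contDiff_kerQ.differentiable (by simp)

lemma kerQ_diag (t b : ℝ) : kerQ (t, b, t - b) = 0 := by simp [kerQ]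

lemma kerQ_eq {t b : ℝ} (ht : -(1 / 4) < t) (hb : -(1 / 4) < b) (s : ℝ) :
    kerQ (t, b, s) = ((t - b) ^ 2 - s ^ 2) / (4 * (1 + t) * (1 + b)) := by
  simp only [kerQ, weight_eq ht.le, weight_eq hb.le]

lemma kerQ_nonneg {t b s : ℝ} (hs : 0 ≤ s) (hst : s ≤ t - b) : 0 ≤ kerQ (t, b, s) := by
  refine div_nonneg ?_ (mul_pos (mul_pos (by norm_num) (weight_pos t)) (weight_pos b)).le
  nlinarith

/-- The region where `weight` is `1 + t` in the first two variables. -/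
def kerRegion : Set (ℝ × ℝ × ℝ) := {p | -(1 / 4) < p.1 ∧ -(1 / 4) < p.2.1}

lemma isOpen_kerRegion : IsOpen kerRegion :=
  (isOpen_lt continuous_const continuous_fst).inter
    (isOpen_lt continuous_const (continuous_fst.comp continuous_snd))

lemma dd_kS_kerQ (t b s : ℝ) :
    dd kS kerQ (t, b, s) = -(2 * s) / (4 * weight t * weight b) := by
  refine dd_eq_of_hasDerivAt (differentiable_kerQ _) rfl (hasDerivAt_kS t b s) ?_
  simp only [kerQ]
  refine HasDerivAt.div_const ?_ _
  simpa using ((hasDerivAt_id' s).pow 2).const_sub ((t - b) ^ 2)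

lemma dd_kS_dd_kS_kerQ (t b s : ℝ) :
    dd kS (dd kS kerQ) (t, b, s) = -2 / (4 * weight t * weight b) := by
  refine dd_eq_of_hasDerivAt ((contDiff_dd_one
    (contDiff_kerQ.of_le two_le_infty)).differentiable one_ne_zero _) rfl (hasDerivAt_kS t b s) ?_
  simp only [dd_kS_kerQ]
  refine HasDerivAt.div_const ?_ _
  simpa using ((hasDerivAt_id' s).const_mul 2).fun_neg

lemma dd_kT_kerQ {t b : ℝ} (ht : -(1 / 4) < t) (hb : -(1 / 4) < b) (s : ℝ) :
    dd kT kerQ (t, b, s)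
      = ((1 + t) ^ 2 - (1 + b) ^ 2 + s ^ 2) / (4 * (1 + t) ^ 2 * (1 + b)) := by
  have h1 : 1 + t ≠ 0 := by linarith
  have h2 : 1 + b ≠ 0 := by linarith
  refine dd_eq_of_hasDerivAt (differentiable_kerQ _) rfl (hasDerivAt_kT t b s) ?_
  have h3 : HasDerivAt (fun τ => ((τ - b) ^ 2 - s ^ 2) / (4 * (1 + τ) * (1 + b)))
      (((1 + t) ^ 2 - (1 + b) ^ 2 + s ^ 2) / (4 * (1 + t) ^ 2 * (1 + b))) t := by
    refine ((((((hasDerivAt_id' t).sub_const b).fun_pow 2).sub_const (s ^ 2))).fun_div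
      ((((hasDerivAt_id' t).const_add 1).const_mul 4).mul_const (1 + b))
      (by simp [h1, h2])).congr_deriv ?_
    field_simp
    ring
  refine h3.congr_of_eventuallyEq ?_
  filter_upwards [lt_mem_nhds ht] with τ hτ using kerQ_eq hτ hb s

lemma dd_kB_kerQ {t b : ℝ} (ht : -(1 / 4) < t) (hb : -(1 / 4) < b) (s : ℝ) :
    dd kB kerQ (t, b, s)
      = ((1 + b) ^ 2 - (1 + t) ^ 2 + s ^ 2) / (4 * (1 + t) * (1 + b) ^ 2) := by
  have h1 : 1 + t ≠ 0 := by linarith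
  have h2 : 1 + b ≠ 0 := by linarith
  refine dd_eq_of_hasDerivAt (differentiable_kerQ _) rfl (hasDerivAt_kB t b s) ?_
  have h3 : HasDerivAt (fun β => ((t - β) ^ 2 - s ^ 2) / (4 * (1 + t) * (1 + β)))
      (((1 + b) ^ 2 - (1 + t) ^ 2 + s ^ 2) / (4 * (1 + t) * (1 + b) ^ 2)) b := by
    refine ((((((hasDerivAt_id' b).const_sub t).fun_pow 2).sub_const (s ^ 2))).fun_div
      ((((hasDerivAt_id' b).const_add 1).const_mul (4 * (1 + t))))
      (by simp [h1, h2])).congr_deriv ?_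
    field_simp
    ring
  refine h3.congr_of_eventuallyEq ?_
  filter_upwards [lt_mem_nhds hb] with β hβ using kerQ_eq ht hβ s

lemma dd_kT_dd_kT_kerQ {t b : ℝ} (ht : -(1 / 4) < t) (hb : -(1 / 4) < b) (s : ℝ) :
    dd kT (dd kT kerQ) (t, b, s) = ((1 + b) ^ 2 - s ^ 2) / (2 * (1 + t) ^ 3 * (1 + b)) := by
  have h1 : 1 + t ≠ 0 := by linarith
  have h2 : 1 + b ≠ 0 := by linarith
  refine dd_eq_of_hasDerivAt ((contDiff_dd_one
    (contDiff_kerQ.of_le two_le_infty)).differentiable one_ne_zero _) rfl (hasDerivAt_kT t b s) ?_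
  have h3 : HasDerivAt (fun τ => ((1 + τ) ^ 2 - (1 + b) ^ 2 + s ^ 2) / (4 * (1 + τ) ^ 2 * (1 + b)))
      (((1 + b) ^ 2 - s ^ 2) / (2 * (1 + t) ^ 3 * (1 + b))) t := by
    refine (((((((hasDerivAt_id' t).const_add 1).fun_pow 2).sub_const ((1 + b) ^ 2)).add_const
      (s ^ 2))).fun_div (((((hasDerivAt_id' t).const_add 1).fun_pow 2).const_mul 4).mul_const (1 + b))
      (by simp [h1, h2])).congr_deriv ?_
    field_simp
    ring
  refine h3.congr_of_eventuallyEq ?_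
  filter_upwards [lt_mem_nhds ht] with τ hτ using dd_kT_kerQ hτ hb s

variable {P : ℝ → ℝ} {l : ℝ}

/-- The Riemann function `P(q)` as a function of `(t, b, s)`. -/
def kerR (P : ℝ → ℝ) (p : ℝ × ℝ × ℝ) : ℝ := P (kerQ p)

lemma contDiff_kerR (hP : ContDiff ℝ ∞ P) : ContDiff ℝ ∞ (kerR P) := hP.comp contDiff_kerQ

lemma dd_kerR (hP : ContDiff ℝ ∞ P) (v : ℝ × ℝ × ℝ) :
    dd v (kerR P) = fun p => deriv P (kerQ p) * dd v kerQ p :=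
  dd_comp_scalar (hP.differentiable (by simp)) differentiable_kerQ v

lemma dd_dd_kerR (hP : ContDiff ℝ ∞ P) (v : ℝ × ℝ × ℝ) :
    dd v (dd v (kerR P)) = fun p => deriv (deriv P) (kerQ p) * dd v kerQ p ^ 2
      + deriv P (kerQ p) * dd v (dd v kerQ) p := by
  have h1 : ContDiff ℝ 1 (deriv P) :=
    ContDiff.deriv' (by simpa [one_add_one_eq_two] using hP.of_le two_le_infty)
  have h2 := (contDiff_dd_one (v := v) (contDiff_kerQ.of_le two_le_infty)).differentiable one_ne_zero
  have h3 : Differentiable ℝ fun p => deriv P (kerQ p) :=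
    (h1.differentiable one_ne_zero).comp differentiable_kerQ
  rw [dd_kerR hP, dd_mul h3 h2,
    dd_comp_scalar (h1.differentiable one_ne_zero) differentiable_kerQ]
  ext p
  ring

/-- The profile equation makes `P(q)` a solution of the potential equation in `(t, s)`. -/
lemma kerR_wave (hP : ContDiff ℝ ∞ P)
    (hode : ∀ q, -(1 / 8) < q →
      q * (1 + q) * deriv (deriv P) q + (1 + 2 * q) * deriv P q + l * P q = 0)
    {t b s : ℝ} (ht : -(1 / 4) < t) (hb : -(1 / 4) < b) (hq : -(1 / 8) < kerQ (t, b, s)) :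
    dd kT (dd kT (kerR P)) (t, b, s) - dd kS (dd kS (kerR P)) (t, b, s)
      + l / weight t ^ 2 * kerR P (t, b, s) = 0 := by
  have h1 : 1 + t ≠ 0 := by linarith
  have h2 : 1 + b ≠ 0 := by linarith
  have h3 := hode _ hq
  simp only [dd_dd_kerR hP, dd_kT_kerQ ht hb, dd_kT_dd_kT_kerQ ht hb, dd_kS_kerQ, dd_kS_dd_kS_kerQ,
    weight_eq ht.le, weight_eq hb.le, kerR]
  -- The profile equation arises from `q_t² - q_s² = q (1 + q) / (1 + t)²` and
  -- `q_tt - q_ss = (1 + 2 q) / (1 + t)²`.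
  have h4 : (((1 + t) ^ 2 - (1 + b) ^ 2 + s ^ 2) / (4 * (1 + t) ^ 2 * (1 + b))) ^ 2
      - (-(2 * s) / (4 * (1 + t) * (1 + b))) ^ 2
      = kerQ (t, b, s) * (1 + kerQ (t, b, s)) / (1 + t) ^ 2 := by
    rw [kerQ_eq ht hb]; field_simp; ring
  have h5 : ((1 + b) ^ 2 - s ^ 2) / (2 * (1 + t) ^ 3 * (1 + b)) - -2 / (4 * (1 + t) * (1 + b))
      = (1 + 2 * kerQ (t, b, s)) / (1 + t) ^ 2 := by
    rw [kerQ_eq ht hb]; field_simp; ring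
  linear_combination deriv (deriv P) (kerQ (t, b, s)) * h4 + deriv P (kerQ (t, b, s)) * h5
    + 1 / (1 + t) ^ 2 * h3

/-- Derivatives of `P(q)` in the directions `b` and `s` satisfy the same equation, since its
coefficients do not depend on these variables. -/
lemma dd_kerR_wave (hP : ContDiff ℝ ∞ P)
    (hode : ∀ q, -(1 / 8) < q →
      q * (1 + q) * deriv (deriv P) q + (1 + 2 * q) * deriv P q + l * P q = 0)
    {v : ℝ × ℝ × ℝ} (hv : v.1 = 0)
    {t b s : ℝ} (hb : 0 ≤ b) (hs : 0 ≤ s) (hst : s ≤ t - b) :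
    dd kT (dd kT (dd v (kerR P))) (t, b, s) - dd kS (dd kS (dd v (kerR P))) (t, b, s)
      + l / (1 + t) ^ 2 * dd v (kerR P) (t, b, s) = 0 := by
  have hR := contDiff_kerR hP
  have hU : IsOpen (kerRegion ∩ {p | -(1 / 8) < kerQ p}) :=
    isOpen_kerRegion.inter (isOpen_lt continuous_const contDiff_kerQ.continuous)
  have hmem : (t, b, s) ∈ kerRegion ∩ {p | -(1 / 8) < kerQ p} :=
    ⟨⟨by simp only; linarith, by simp only; linarith⟩,
      lt_of_lt_of_le (by norm_num) (kerQ_nonneg hs hst)⟩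
  have hd : ∀ w, ContDiff ℝ ∞ (dd w (kerR P)) := fun w => contDiff_dd (by simpa using hR)
  have hdd : ∀ w w', ContDiff ℝ ∞ (dd w' (dd w (kerR P))) := fun w w' =>
    contDiff_dd (by simpa using hd w)
  have hcomm : ∀ w, dd v (dd w (dd w (kerR P))) = dd w (dd w (dd v (kerR P))) := fun w => by
    rw [dd_comm ((hd w).of_le two_le_infty), dd_comm (hR.of_le two_le_infty)]
  set c : ℝ × ℝ × ℝ → ℝ := fun p => l / weight p.1 ^ 2 with hc
  have hcd : ContDiff ℝ ∞ c := contDiff_const.div ((contDiff_weight.comp contDiff_fst).pow 2)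
    fun p => (pow_pos (weight_pos _) 2).ne'
  have hc0 : ∀ p, dd v c p = 0 := fun p => by
    refine dd_eq_of_hasDerivAt (γ := fun τ => p + τ • v) (t := 0)
      (hcd.differentiable (by simp) p) (by simp) ?_ ?_
    · simpa using ((hasDerivAt_id' (0 : ℝ)).smul_const v).const_add p
    · simpa [hc, hv] using hasDerivAt_const (0 : ℝ) (l / weight p.1 ^ 2)
  have hzero : EqOn (fun p => (dd kT (dd kT (kerR P)) p - dd kS (dd kS (kerR P)) p)
      + c p * kerR P p) (fun _ => 0) (kerRegion ∩ {p | -(1 / 8) < kerQ p}) :=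
    fun p hp => kerR_wave hP hode hp.1.1 hp.1.2 hp.2
  have h1 := dd_eqOn hU hzero v hmem
  have hne : (∞ : ℕ∞ω) ≠ 0 := by simp
  rw [dd_add (((hdd _ _).differentiable hne).fun_sub ((hdd _ _).differentiable hne))
    ((hcd.differentiable hne).fun_mul (hR.differentiable hne)),
    dd_sub ((hdd _ _).differentiable hne) ((hdd _ _).differentiable hne),
    dd_mul (hcd.differentiable hne) (hR.differentiable hne), hcomm, hcomm] at h1
  simp only [hc0, zero_mul, zero_add] at h1
  have h2 : dd v (fun _ : ℝ × ℝ × ℝ => (0 : ℝ)) (t, b, s) = 0 := by simp [dd]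
  rw [h2] at h1
  simpa [hc, weight_eq (show -(1 / 4) ≤ t by linarith)] using h1

/-- A negated derivative of `P(q)` in the direction `b` or `s` is a transmutation kernel as soon as it
has the right value on the diagonal `s = t - b`. -/
lemma isTransmutationKernel_of_diag (hP : ContDiff ℝ ∞ P)
    (hode : ∀ q, -(1 / 8) < q →
      q * (1 + q) * deriv (deriv P) q + (1 + 2 * q) * deriv P q + l * P q = 0)
    {v : ℝ × ℝ × ℝ} (hv : v.1 = 0)
    (hdiag : ∀ t b, -(1 / 4) < t → -(1 / 4) < b →
      dd v (kerR P) (t, b, t - b) = l * (t - b) / (2 * (1 + t) * (1 + b))) :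
    IsTransmutationKernel l (fun p => -dd v (kerR P) p) := by
  have hd : ContDiff ℝ ∞ (dd v (kerR P)) := contDiff_dd (by simpa using contDiff_kerR hP)
  refine ⟨(hd.of_le two_le_infty).neg, fun t b s hb hs hst => ?_, fun t b hb hbt => ?_,
    fun b hb => ?_⟩
  · rw [dd_neg, dd_neg, dd_neg, dd_neg]
    linear_combination -dd_kerR_wave hP hode hv hb hs hst
  -- `∂_t + ∂_s` is the derivative along the diagonal, where the kernel is explicit.
  · have h1 : HasDerivAt (fun τ : ℝ => (τ, b, τ - b)) (kT + kS) t := by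
      have := (hasDerivAt_id' t).prodMk
        ((hasDerivAt_const t b).prodMk ((hasDerivAt_id' t).sub_const b))
      simpa using this
    have h2 := hasDerivAt_comp_dd (hd.differentiable (by simp) (t, b, t - b)) rfl h1
    have h3 : 1 + t ≠ 0 := by linarith
    have h4 : 1 + b ≠ 0 := by linarith
    have h5 : HasDerivAt (fun τ : ℝ => l * (τ - b) / (2 * (1 + τ) * (1 + b)))
        (l / (2 * (1 + t) ^ 2)) t := by
      refine ((((hasDerivAt_id' t).sub_const b).const_mul l).fun_div
        ((((hasDerivAt_id' t).const_add 1).const_mul 2).mul_const (1 + b))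
        (by simp [h3, h4])).congr_deriv ?_
      field_simp
      ring
    have h6 := h2.unique (h5.congr_of_eventuallyEq (by
      filter_upwards [lt_mem_nhds (show -(1 / 4) < t by linarith)] with τ hτ
      exact hdiag τ b hτ (by linarith)))
    have h7 : dd (kT + kS) (dd v (kerR P)) (t, b, t - b)
        = dd kT (dd v (kerR P)) (t, b, t - b) + dd kS (dd v (kerR P)) (t, b, t - b) := by
      simp only [dd, map_add]
    rw [dd_neg, dd_neg]
    rw [h7] at h6
    simp only
    rw [← neg_add, h6]
    field_simp
    ring
  · have := hdiag b b (by linarith) (by linarith)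
    simpa using this

lemma deriv_profile_zero (hP0 : P 0 = 1)
    (hode : ∀ q, -(1 / 8) < q →
      q * (1 + q) * deriv (deriv P) q + (1 + 2 * q) * deriv P q + l * P q = 0) :
    deriv P 0 = -l := by
  have := hode 0 (by norm_num)
  rw [hP0] at this
  linarith

lemma isTransmutationKernel_kS (hP : ContDiff ℝ ∞ P) (hP0 : P 0 = 1)
    (hode : ∀ q, -(1 / 8) < q →
      q * (1 + q) * deriv (deriv P) q + (1 + 2 * q) * deriv P q + l * P q = 0) :
    IsTransmutationKernel l (fun p => -dd kS (kerR P) p) := by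
  refine isTransmutationKernel_of_diag hP hode rfl fun t b ht hb => ?_
  have h3 : 1 + t ≠ 0 := by linarith
  have h4 : 1 + b ≠ 0 := by linarith
  rw [dd_kerR hP]
  simp only
  rw [kerQ_diag, deriv_profile_zero hP0 hode, dd_kS_kerQ, weight_eq ht.le, weight_eq hb.le]
  field_simp
  ring

lemma isTransmutationKernel_kB (hP : ContDiff ℝ ∞ P) (hP0 : P 0 = 1)
    (hode : ∀ q, -(1 / 8) < q →
      q * (1 + q) * deriv (deriv P) q + (1 + 2 * q) * deriv P q + l * P q = 0) :
    IsTransmutationKernel l (fun p => -dd kB (kerR P) p) := by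
  refine isTransmutationKernel_of_diag hP hode rfl fun t b ht hb => ?_
  have h3 : 1 + t ≠ 0 := by linarith
  have h4 : 1 + b ≠ 0 := by linarith
  rw [dd_kerR hP]
  simp only
  rw [kerQ_diag, deriv_profile_zero hP0 hode, dd_kB_kerQ ht hb]
  field_simp
  ring

lemma dd_kS_kerR_zero (hP : ContDiff ℝ ∞ P) (t b : ℝ) : dd kS (kerR P) (t, b, 0) = 0 := by
  simp [dd_kerR hP, dd_kS_kerQ]

/-- `P(q)` is even in `s`, and so is its `b`-derivative. -/
lemma dd_kS_dd_kB_kerR_zero (hP : ContDiff ℝ ∞ P) (t b : ℝ) :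
    dd kS (dd kB (kerR P)) (t, b, 0) = 0 := by
  rw [dd_comm ((contDiff_kerR hP).of_le two_le_infty)]
  refine dd_eq_of_hasDerivAt ((contDiff_dd_one
    ((contDiff_kerR hP).of_le two_le_infty)).differentiable one_ne_zero _) rfl
    (hasDerivAt_kB t b 0) ?_
  simpa only [dd_kS_kerR_zero hP] using hasDerivAt_const b (0 : ℝ)

end Kernels

/-! ### Transmutation of the wave equation and Duhamel's principle -/

section Transmutation

variable {n : ℕ} {W : ℝ × ℝ × Space n → ℝ} {N : ℝ × ℝ × ℝ → ℝ}

lemma hasDerivAt_fst_comp {E F : Type*} [NormedAddCommGroup E] [NormedSpace ℝ E]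
    [NormedAddCommGroup F] [NormedSpace ℝ F] {γ : ℝ → E × F} {v : E × F} {t : ℝ}
    (h : HasDerivAt γ v t) : HasDerivAt (fun τ => (γ τ).1) v.1 t :=
  (ContinuousLinearMap.fst ℝ E F).hasFDerivAt.comp_hasDerivAt t h

lemma hasDerivAt_snd_comp {E F : Type*} [NormedAddCommGroup E] [NormedSpace ℝ E]
    [NormedAddCommGroup F] [NormedSpace ℝ F] {γ : ℝ → E × F} {v : E × F} {t : ℝ}
    (h : HasDerivAt γ v t) : HasDerivAt (fun τ => (γ τ).2) v.2 t :=
  (ContinuousLinearMap.snd ℝ E F).hasFDerivAt.comp_hasDerivAt t h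

/-- The substitution `(t, b, x) ↦ (t - b, b, x)`. -/
def shiftL (n : ℕ) : ℝ × ℝ × Space n →L[ℝ] ℝ × ℝ × Space n :=
  (ContinuousLinearMap.fst ℝ ℝ (ℝ × Space n)
    - (ContinuousLinearMap.fst ℝ ℝ (Space n)).comp (ContinuousLinearMap.snd ℝ ℝ (ℝ × Space n))).prod
    (ContinuousLinearMap.snd ℝ ℝ (ℝ × Space n))

/-- The substitution `(t, b, x) ↦ (t, b, t - b)`. -/
def diagL (n : ℕ) : ℝ × ℝ × Space n →L[ℝ] ℝ × ℝ × ℝ :=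
  (ContinuousLinearMap.fst ℝ ℝ (ℝ × Space n)).prod
    (((ContinuousLinearMap.fst ℝ ℝ (Space n)).comp (ContinuousLinearMap.snd ℝ ℝ (ℝ × Space n))).prod
      (ContinuousLinearMap.fst ℝ ℝ (ℝ × Space n)
        - (ContinuousLinearMap.fst ℝ ℝ (Space n)).comp
          (ContinuousLinearMap.snd ℝ ℝ (ℝ × Space n))))

lemma shiftL_apply (p : ℝ × ℝ × Space n) : shiftL n p = (p.1 - p.2.1, p.2) := rfl

lemma diagL_apply (p : ℝ × ℝ × Space n) : diagL n p = (p.1, p.2.1, p.1 - p.2.1) := rfl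

lemma shiftL_eR : shiftL n (eR n) = eR n := by simp [shiftL_apply, eR]

lemma shiftL_eY (i : Fin n) : shiftL n (eY i) = eY i := by simp [shiftL_apply, eY]

lemma diagL_eR : diagL n (eR n) = kT + kS := by simp [diagL_apply, eR]

/-- The integral `∫₀^{t-b} W(s, b, x) N(t, b, s) ds`. -/
def kerInt (W : ℝ × ℝ × Space n → ℝ) (N : ℝ × ℝ × ℝ → ℝ) (p : ℝ × ℝ × Space n) : ℝ :=
  ∫ s in (0 : ℝ)..(p.1 - p.2.1), W (s, p.2) * N (p.1, p.2.1, s)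

lemma contDiff_kerInt {k : ℕ} (hW : ContDiff ℝ k W) (hN : ContDiff ℝ k N) :
    ContDiff ℝ k (kerInt W N) :=
  contDiff_intervalIntegral
    (Φ := fun p : (ℝ × ℝ × Space n) × ℝ => W (p.2, p.1.2) * N (p.1.1, p.1.2.1, p.2))
    ((hW.comp (by fun_prop)).mul (hN.comp (by fun_prop))) (by fun_prop)

lemma dd_kerInt (hW : ContDiff ℝ 1 W) (hN : ContDiff ℝ 1 N) (v : ℝ × ℝ × Space n) :
    dd v (kerInt W N) = fun p => (v.1 - v.2.1) * (W (shiftL n p) * N (diagL n p))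
      + ∫ s in (0 : ℝ)..(p.1 - p.2.1), (dd (0, v.2) W (s, p.2) * N (p.1, p.2.1, s)
        + W (s, p.2) * dd (v.1, v.2.1, 0) N (p.1, p.2.1, s)) := by
  have h := dd_intervalIntegral
    (Φ := fun p : (ℝ × ℝ × Space n) × ℝ => W (p.2, p.1.2) * N (p.1.1, p.1.2.1, p.2))
    (α := fun p : ℝ × ℝ × Space n => p.1 - p.2.1)
    ((hW.comp (by fun_prop)).mul (hN.comp (by fun_prop))) (by fun_prop) v
  refine h.trans (funext fun p => ?_)
  have h1 : dd v (fun p : ℝ × ℝ × Space n => p.1 - p.2.1) p = v.1 - v.2.1 :=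
    dd_eq_of_hasFDerivAt (hasFDerivAt_fst.sub (hasFDerivAt_fst.comp p hasFDerivAt_snd))
  rw [h1]
  congr 1
  refine intervalIntegral.integral_congr fun s _ => ?_
  have hp : HasDerivAt (fun τ : ℝ => p + τ • v) v 0 := by
    simpa using ((hasDerivAt_id' (0 : ℝ)).smul_const v).const_add p
  have hγ : HasDerivAt (fun τ : ℝ => (p + τ • v, s)) (v, (0 : ℝ)) 0 :=
    hp.prodMk (hasDerivAt_const _ _)
  have h2 : HasDerivAt (fun τ : ℝ => (s, (p + τ • v).2)) (0, v.2) 0 :=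
    (hasDerivAt_const _ _).prodMk (hasDerivAt_snd_comp hp)
  have h3 : HasDerivAt (fun τ : ℝ => ((p + τ • v).1, (p + τ • v).2.1, s)) (v.1, v.2.1, 0) 0 :=
    (hasDerivAt_fst_comp hp).prodMk
      ((hasDerivAt_fst_comp (hasDerivAt_snd_comp hp)).prodMk (hasDerivAt_const _ _))
  refine dd_eq_of_hasDerivAt (γ := fun τ : ℝ => (p + τ • v, s)) (t := 0) ?_ (by simp) hγ ?_
  · exact (((hW.comp (by fun_prop)).mul (hN.comp (by fun_prop)) : ContDiff ℝ 1
      fun p : (ℝ × ℝ × Space n) × ℝ => W (p.2, p.1.2) * N (p.1.1, p.1.2.1, p.2)).differentiable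
        one_ne_zero) _
  · have h4 := hasDerivAt_comp_dd (p := (s, p.2)) (hW.differentiable one_ne_zero _) (by simp) h2
    have h5 := hasDerivAt_comp_dd (p := (p.1, p.2.1, s)) (hN.differentiable one_ne_zero _)
      (by simp) h3
    refine (h4.fun_mul h5).congr_deriv (by simp)

lemma dd_eR_kerInt (hW : ContDiff ℝ 1 W) (hN : ContDiff ℝ 1 N) :
    dd (eR n) (kerInt W N) = fun p => W (shiftL n p) * N (diagL n p) + kerInt W (dd kT N) p := by
  rw [dd_kerInt hW hN]
  ext p
  simp only [eR, sub_zero, one_mul, kerInt, kT]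
  congr 1
  refine intervalIntegral.integral_congr fun s _ => ?_
  have h0 : dd ((0 : ℝ), (0 : ℝ), (0 : Space n)) W = 0 := by
    ext p
    exact (fderiv ℝ W p).map_zero
  simp [h0]

lemma dd_eY_kerInt (hW : ContDiff ℝ 1 W) (hN : ContDiff ℝ 1 N) (i : Fin n) :
    dd (eY i) (kerInt W N) = kerInt (dd (eY i) W) N := by
  rw [dd_kerInt hW hN]
  ext p
  have h0 : dd ((0 : ℝ), (0 : ℝ), (0 : ℝ)) N = 0 := by
    ext p
    exact (fderiv ℝ N p).map_zero
  simp [eY, kerInt, h0]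

/-- The transmutation `T(t, b, x) = W(t - b, b, x) + ∫₀^{t-b} W(s, b, x) N(t, b, s) ds`. -/
def transmute (W : ℝ × ℝ × Space n → ℝ) (N : ℝ × ℝ × ℝ → ℝ) (p : ℝ × ℝ × Space n) : ℝ :=
  W (shiftL n p) + kerInt W N p

lemma contDiff_transmute {k : ℕ} (hW : ContDiff ℝ k W) (hN : ContDiff ℝ k N) :
    ContDiff ℝ k (transmute W N) :=
  (hW.comp (shiftL n).contDiff).add (contDiff_kerInt hW hN)

lemma transmute_self (b : ℝ) (x : Space n) : transmute W N (b, b, x) = W (0, b, x) := by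
  simp [transmute, kerInt, shiftL_apply]

lemma dd_eR_transmute (hW : ContDiff ℝ 1 W) (hN : ContDiff ℝ 1 N) :
    dd (eR n) (transmute W N) = fun p => dd (eR n) W (shiftL n p)
      + (W (shiftL n p) * N (diagL n p) + kerInt W (dd kT N) p) := by
  have h1 : ContDiff ℝ 1 fun p => W (shiftL n p) := hW.comp (shiftL n).contDiff
  have h2 : ContDiff ℝ 1 (kerInt W N) := by
    exact_mod_cast contDiff_kerInt (k := 1) (by exact_mod_cast hW) (by exact_mod_cast hN)
  unfold transmute
  rw [dd_add (h1.differentiable one_ne_zero) (h2.differentiable one_ne_zero), dd_eR_kerInt hW hN,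
    dd_comp_clm _ (hW.differentiable one_ne_zero), shiftL_eR]

lemma dd_eR_transmute_self (hW : ContDiff ℝ 1 W) (hN : ContDiff ℝ 1 N) {b : ℝ} {x : Space n}
    (h0 : N (b, b, 0) = 0) : dd (eR n) (transmute W N) (b, b, x) = dd (eR n) W (0, b, x) := by
  rw [dd_eR_transmute hW hN]
  simp [shiftL_apply, diagL_apply, h0, kerInt]

lemma dd_dd_eR_transmute (hW : ContDiff ℝ 2 W) (hN : ContDiff ℝ 2 N) :
    dd (eR n) (dd (eR n) (transmute W N)) = fun p => dd (eR n) (dd (eR n) W) (shiftL n p)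
      + (dd (eR n) W (shiftL n p) * N (diagL n p)
        + W (shiftL n p) * (2 * dd kT N (diagL n p) + dd kS N (diagL n p))
        + kerInt W (dd kT (dd kT N)) p) := by
  have hW1 : ContDiff ℝ 1 W := hW.of_le (by norm_num)
  have hN1 : ContDiff ℝ 1 N := hN.of_le (by norm_num)
  have hWr : ContDiff ℝ 1 (dd (eR n) W) := contDiff_dd_one hW
  have hNt : ContDiff ℝ 1 (dd kT N) := contDiff_dd_one hN
  have d1 : Differentiable ℝ fun p => dd (eR n) W (shiftL n p) :=
    (hWr.comp (shiftL n).contDiff).differentiable one_ne_zero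
  have d2 : Differentiable ℝ fun p => W (shiftL n p) :=
    (hW1.comp (shiftL n).contDiff).differentiable one_ne_zero
  have d3 : Differentiable ℝ fun p => N (diagL n p) :=
    (hN1.comp (diagL n).contDiff).differentiable one_ne_zero
  have d4 : ContDiff ℝ 1 (kerInt W (dd kT N)) := by
    exact_mod_cast contDiff_kerInt (k := 1) (by exact_mod_cast hW1) (by exact_mod_cast hNt)
  rw [dd_eR_transmute hW1 hN1, dd_add d1 ((d2.fun_mul d3).fun_add (d4.differentiable one_ne_zero)),
    dd_add (d2.fun_mul d3) (d4.differentiable one_ne_zero), dd_mul d2 d3, dd_eR_kerInt hW1 hNt,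
    dd_comp_clm _ (hWr.differentiable one_ne_zero), dd_comp_clm _ (hW1.differentiable one_ne_zero),
    dd_comp_clm _ (hN1.differentiable one_ne_zero), shiftL_eR, diagL_eR]
  ext p
  have : dd (kT + kS) N (diagL n p) = dd kT N (diagL n p) + dd kS N (diagL n p) := by
    simp only [dd, map_add]
  simp only [this]
  ring

lemma continuous_kerInt_integrand (hW : Continuous W) (hN : Continuous N) (t b : ℝ) (x : Space n) :
    Continuous fun s : ℝ => W (s, b, x) * N (t, b, s) :=
  (hW.comp (by fun_prop)).mul (hN.comp (by fun_prop))

lemma lapAlong_transmute (hW : ContDiff ℝ 2 W) (hN : ContDiff ℝ 2 N) :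
    lapAlong eY (transmute W N) = fun p => lapAlong eY W (shiftL n p) + kerInt (lapAlong eY W) N p := by
  have hW1 : ContDiff ℝ 1 W := hW.of_le (by norm_num)
  have hN1 : ContDiff ℝ 1 N := hN.of_le (by norm_num)
  have hk : ∀ {V : ℝ × ℝ × Space n → ℝ}, ContDiff ℝ 1 V → Differentiable ℝ (kerInt V N) := fun hV =>
    (contDiff_kerInt (k := 1) (by exact_mod_cast hV)
      (by exact_mod_cast hN1)).differentiable (by simp)
  have hs : ∀ {V : ℝ × ℝ × Space n → ℝ}, ContDiff ℝ 1 V →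
      Differentiable ℝ fun p => V (shiftL n p) := fun hV =>
    (hV.comp (shiftL n).contDiff).differentiable one_ne_zero
  have h1 : ∀ i, dd (eY i) (dd (eY i) (transmute W N)) = fun p =>
      dd (eY i) (dd (eY i) W) (shiftL n p) + kerInt (dd (eY i) (dd (eY i) W)) N p := fun i => by
    have hWi : ContDiff ℝ 1 (dd (eY i) W) := contDiff_dd_one hW
    unfold transmute
    rw [dd_add (hs hW1) (hk hW1), dd_eY_kerInt hW1 hN1,
      dd_comp_clm _ (hW1.differentiable one_ne_zero), shiftL_eY, dd_add (hs hWi) (hk hWi),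
      dd_eY_kerInt hWi hN1, dd_comp_clm _ (hWi.differentiable one_ne_zero), shiftL_eY]
  ext p
  simp only [lapAlong, h1, Finset.sum_add_distrib, kerInt, Finset.sum_mul]
  rw [intervalIntegral.integral_finsetSum fun i _ =>
    (continuous_kerInt_integrand (continuous_dd_dd hW) hN1.continuous _ _ _).intervalIntegrable _ _]

/-- The transmutation solves the equation with the singular potential: two integrations by parts in
`s` move `∂_s²` from `W` to the kernel. -/
theorem transmute_wave {l : ℝ} (hW : ContDiff ℝ 2 W) (hN : IsTransmutationKernel l N)
    (hwave : ∀ p : ℝ × ℝ × Space n, 0 ≤ p.1 → dd (eR n) (dd (eR n) W) p = lapAlong eY W p)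
    (h0 : ∀ t b x, dd (eR n) W (0, b, x) * N (t, b, 0) = W (0, b, x) * dd kS N (t, b, 0))
    {t b : ℝ} (hb : 0 ≤ b) (hbt : b ≤ t) (x : Space n) :
    dd (eR n) (dd (eR n) (transmute W N)) (t, b, x) - lapAlong eY (transmute W N) (t, b, x)
      + l / (1 + t) ^ 2 * transmute W N (t, b, x) = 0 := by
  have hNc := hN.contDiff
  have hW1 : ContDiff ℝ 1 W := hW.of_le (by norm_num)
  have hN1 : ContDiff ℝ 1 N := hNc.of_le (by norm_num)
  have hWr : ContDiff ℝ 1 (dd (eR n) W) := contDiff_dd_one hW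
  have hNs : ContDiff ℝ 1 (dd kS N) := contDiff_dd_one hNc
  have hci : ∀ {V : ℝ × ℝ × Space n → ℝ} {M : ℝ × ℝ × ℝ → ℝ}, Continuous V → Continuous M →
      IntervalIntegrable (fun s : ℝ => V (s, b, x) * M (t, b, s)) volume 0 (t - b) :=
    fun hV hM => (continuous_kerInt_integrand hV hM t b x).intervalIntegrable _ _
  have cW := hW1.continuous
  have cN := hN1.continuous
  have cWrr : Continuous (dd (eR n) (dd (eR n) W)) := continuous_dd_dd hW
  have cNss : Continuous (dd kS (dd kS N)) := continuous_dd_dd hNc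
  have cNtt : Continuous (dd kT (dd kT N)) := continuous_dd_dd hNc
  -- `W_rr N - W N_ss` is the `s`-derivative of `W_r N - W N_s`.
  have hparts : ∫ s in (0 : ℝ)..(t - b), (dd (eR n) (dd (eR n) W) (s, b, x) * N (t, b, s)
      - W (s, b, x) * dd kS (dd kS N) (t, b, s))
      = (dd (eR n) W (t - b, b, x) * N (t, b, t - b) - W (t - b, b, x) * dd kS N (t, b, t - b))
        - (dd (eR n) W (0, b, x) * N (t, b, 0) - W (0, b, x) * dd kS N (t, b, 0)) := by
    refine intervalIntegral.integral_eq_sub_of_hasDerivAt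
      (f := fun s => dd (eR n) W (s, b, x) * N (t, b, s) - W (s, b, x) * dd kS N (t, b, s))
      (fun s _ => ?_) ((hci cWrr cN).sub (hci cW cNss))
    have e1 := hasDerivAt_left (hW1.differentiable one_ne_zero) s (b, x)
    have e2 := hasDerivAt_left (hWr.differentiable one_ne_zero) s (b, x)
    have e3 := hasDerivAt_comp_dd (hN1.differentiable one_ne_zero _) rfl (hasDerivAt_kS t b s)
    have e4 := hasDerivAt_comp_dd (hNs.differentiable one_ne_zero _) rfl (hasDerivAt_kS t b s)
    refine ((e2.fun_mul e3).fun_sub (e1.fun_mul e4)).congr_deriv ?_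
    change (dd (eR n) (dd (eR n) W) (s, b, x) * _ + dd (eR n) W (s, b, x) * _)
      - (dd (eR n) W (s, b, x) * _ + _) = _
    ring
  have hlap : kerInt (lapAlong eY W) N (t, b, x)
      = kerInt (dd (eR n) (dd (eR n) W)) N (t, b, x) := by
    refine intervalIntegral.integral_congr fun s hs => ?_
    rw [uIcc_of_le (by simpa using hbt)] at hs
    simp only [hwave (s, b, x) hs.1]
  have hker : kerInt W (dd kT (dd kT N)) (t, b, x)
      + l / (1 + t) ^ 2 * kerInt W N (t, b, x)
      = ∫ s in (0 : ℝ)..(t - b), W (s, b, x) * dd kS (dd kS N) (t, b, s) := by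
    simp only [kerInt]
    rw [← intervalIntegral.integral_const_mul, ← intervalIntegral.integral_add (hci cW cNtt)
      ((hci cW cN).const_mul _)]
    refine intervalIntegral.integral_congr fun s hs => ?_
    rw [uIcc_of_le (by simpa using hbt)] at hs
    linear_combination W (s, b, x) * hN.wave t b s hb hs.1 hs.2
  rw [intervalIntegral.integral_sub (hci cWrr cN) (hci cW cNss)] at hparts
  rw [dd_dd_eR_transmute hW hNc, lapAlong_transmute hW hNc]
  simp only [transmute, hlap, shiftL_apply, diagL_apply, ← hwave (t - b, b, x) (by simpa using hbt)]
  have hk : kerInt (dd (eR n) (dd (eR n) W)) N (t, b, x)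
      = ∫ s in (0 : ℝ)..(t - b), dd (eR n) (dd (eR n) W) (s, b, x) * N (t, b, s) := rfl
  rw [hk]
  linear_combination hker - hparts + h0 t b x + W (t - b, b, x) * hN.diag t b hb hbt

end Transmutation

section Duhamel

variable {n : ℕ} {H : ℝ × ℝ × Space n → ℝ}

/-- The superposition `∫₀ᵗ H(t, b, x) db`. -/
def superpose (H : ℝ × ℝ × Space n → ℝ) (q : ℝ × Space n) : ℝ :=
  ∫ b in (0 : ℝ)..q.1, H (q.1, b, q.2)

lemma contDiff_superpose {k : ℕ} (hH : ContDiff ℝ k H) : ContDiff ℝ k (superpose H) :=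
  contDiff_intervalIntegral (Φ := fun p : (ℝ × Space n) × ℝ => H (p.1.1, p.2, p.1.2))
    (hH.comp (by fun_prop)) contDiff_fst

lemma dd_superpose (hH : ContDiff ℝ 1 H) (v : ℝ × Space n) :
    dd v (superpose H) = fun q => v.1 * H (q.1, q.1, q.2)
      + superpose (dd (v.1, 0, v.2) H) q := by
  have h := dd_intervalIntegral (Φ := fun p : (ℝ × Space n) × ℝ => H (p.1.1, p.2, p.1.2))
    (α := fun q : ℝ × Space n => q.1) (hH.comp (by fun_prop)) contDiff_fst v
  refine h.trans (funext fun q => ?_)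
  have h1 : dd v (fun q : ℝ × Space n => q.1) q = v.1 := dd_eq_of_hasFDerivAt (hasFDerivAt_fst (p := q))
  rw [h1]
  congr 1
  refine intervalIntegral.integral_congr fun b _ => ?_
  have hq : HasDerivAt (fun τ : ℝ => q + τ • v) v 0 := by
    simpa using ((hasDerivAt_id' (0 : ℝ)).smul_const v).const_add q
  refine dd_eq_of_hasDerivAt (γ := fun τ : ℝ => (q + τ • v, b)) (t := 0)
    (((hH.comp (by fun_prop : ContDiff ℝ 1 fun p : (ℝ × Space n) × ℝ =>
      (p.1.1, p.2, p.1.2))).differentiable one_ne_zero) _) (by simp)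
    (hq.prodMk (hasDerivAt_const _ _)) ?_
  exact hasDerivAt_comp_dd (p := (q.1, b, q.2)) (hH.differentiable one_ne_zero _) (by simp)
    ((hasDerivAt_fst_comp hq).prodMk ((hasDerivAt_const _ _).prodMk (hasDerivAt_snd_comp hq)))

lemma dd_eT_superpose (hH : ContDiff ℝ 1 H) :
    dd (eT n) (superpose H) = fun q => H (q.1, q.1, q.2) + superpose (dd (eR n) H) q := by
  rw [dd_superpose hH]
  ext q
  simp only [eT, one_mul, eR]

lemma dd_eX_superpose (hH : ContDiff ℝ 1 H) (i : Fin n) :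
    dd (eX i) (superpose H) = superpose (dd (eY i) H) := by
  rw [dd_superpose hH]
  ext q
  simp [eX, eY]

/-- Duhamel's principle. -/
theorem superpose_wave {l : ℝ} (hH : ContDiff ℝ 2 H) (hH0 : ∀ t x, H (t, t, x) = 0)
    (hwave : ∀ t b x, 0 ≤ b → b ≤ t → dd (eR n) (dd (eR n) H) (t, b, x) - lapAlong eY H (t, b, x)
      + l / (1 + t) ^ 2 * H (t, b, x) = 0) {t : ℝ} (ht : 0 ≤ t) (x : Space n) :
    dd (eT n) (dd (eT n) (superpose H)) (t, x) - lapAlong eX (superpose H) (t, x)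
      + l / (1 + t) ^ 2 * superpose H (t, x) = dd (eR n) H (t, t, x) := by
  have hH1 : ContDiff ℝ 1 H := hH.of_le (by norm_num)
  have h1 : dd (eT n) (superpose H) = superpose (dd (eR n) H) := by
    rw [dd_eT_superpose hH1]
    ext q
    rw [hH0, zero_add]
  have h2 : ∀ i, dd (eX i) (dd (eX i) (superpose H)) = superpose (dd (eY i) (dd (eY i) H)) :=
    fun i => by rw [dd_eX_superpose hH1, dd_eX_superpose (contDiff_dd_one hH)]
  have hc : ∀ {G : ℝ × ℝ × Space n → ℝ}, Continuous G →
      IntervalIntegrable (fun b : ℝ => G (t, b, x)) volume 0 t := fun hG =>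
    (hG.comp (by fun_prop : Continuous fun b : ℝ => (t, b, x))).intervalIntegrable _ _
  have cl : Continuous (lapAlong eY H) :=
    continuous_finsetSum _ fun i _ => continuous_dd_dd hH
  have h3 : lapAlong eX (superpose H) (t, x) = superpose (lapAlong eY H) (t, x) := by
    simp only [lapAlong, h2, superpose]
    rw [intervalIntegral.integral_finsetSum fun i _ => hc (continuous_dd_dd hH)]
  have h4 : superpose (dd (eR n) (dd (eR n) H)) (t, x) - superpose (lapAlong eY H) (t, x)
      + l / (1 + t) ^ 2 * superpose H (t, x) = 0 := by
    simp only [superpose]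
    rw [← intervalIntegral.integral_const_mul, ← intervalIntegral.integral_sub
      (hc (continuous_dd_dd hH)) (hc cl), ← intervalIntegral.integral_add
      ((hc (continuous_dd_dd hH)).sub (hc cl)) ((hc hH1.continuous).const_mul _)]
    refine (intervalIntegral.integral_congr fun b hb => ?_).trans
      (intervalIntegral.integral_zero (a := 0) (b := t) (μ := volume))
    rw [uIcc_of_le ht] at hb
    exact hwave t b x hb.1 hb.2
  rw [h1, dd_eT_superpose (contDiff_dd_one hH), h3]
  linear_combination h4

end Duhamel

/-! ### The solution -/

section Liouville

variable {n : ℕ}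

/-- Restriction of a function of `(t, b, x)` to `b = 0`. -/
def slice (H : ℝ × ℝ × Space n → ℝ) (q : ℝ × Space n) : ℝ := H (q.1, 0, q.2)

variable {H : ℝ × ℝ × Space n → ℝ}

lemma contDiff_slice {k : ℕ∞ω} (hH : ContDiff ℝ k H) : ContDiff ℝ k (slice H) :=
  hH.comp (by fun_prop)

lemma dd_slice (hH : Differentiable ℝ H) (v : ℝ × Space n) :
    dd v (slice H) = slice (dd (v.1, 0, v.2) H) :=
  dd_comp_clm ((ContinuousLinearMap.fst ℝ ℝ (Space n)).prod
    ((0 : ℝ × Space n →L[ℝ] ℝ).prod (ContinuousLinearMap.snd ℝ ℝ (Space n)))) hH v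

lemma dd_eT_slice (hH : Differentiable ℝ H) : dd (eT n) (slice H) = slice (dd (eR n) H) :=
  dd_slice hH _

lemma slice_wave {l : ℝ} (hH : ContDiff ℝ 2 H)
    (hwave : ∀ t b x, 0 ≤ b → b ≤ t → dd (eR n) (dd (eR n) H) (t, b, x) - lapAlong eY H (t, b, x)
      + l / (1 + t) ^ 2 * H (t, b, x) = 0) {t : ℝ} (ht : 0 ≤ t) (x : Space n) :
    dd (eT n) (dd (eT n) (slice H)) (t, x) - lapAlong eX (slice H) (t, x)
      + l / (1 + t) ^ 2 * slice H (t, x) = 0 := by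
  have h0 : ∀ v, dd v (slice H) = slice (dd (v.1, 0, v.2) H) :=
    dd_slice (hH.differentiable two_ne_zero)
  have h1 : ∀ v, dd v (dd v (slice H)) = slice (dd (v.1, 0, v.2) (dd (v.1, 0, v.2) H)) := fun v => by
    rw [h0, dd_slice ((contDiff_dd_one hH).differentiable one_ne_zero)]
  have h2 := hwave t 0 x le_rfl ht
  simp only [lapAlong, h1] at h2 ⊢
  exact h2

lemma lapAlong_add {E : Type*} [NormedAddCommGroup E] [NormedSpace ℝ E] {e : Fin n → E}
    {g h : E → ℝ} (hg : ContDiff ℝ 2 g) (hh : ContDiff ℝ 2 h) :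
    lapAlong e (fun p => g p + h p) = fun p => lapAlong e g p + lapAlong e h p := by
  ext p
  simp only [lapAlong, ← Finset.sum_add_distrib]
  refine Finset.sum_congr rfl fun i _ => ?_
  rw [dd_add (hg.differentiable two_ne_zero) (hh.differentiable two_ne_zero),
    dd_add ((contDiff_dd_one hg).differentiable one_ne_zero)
      ((contDiff_dd_one hh).differentiable one_ne_zero)]

lemma dd_dd_add {E : Type*} [NormedAddCommGroup E] [NormedSpace ℝ E] {e : E}
    {g h : E → ℝ} (hg : ContDiff ℝ 2 g) (hh : ContDiff ℝ 2 h) :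
    dd e (dd e (fun p => g p + h p)) = fun p => dd e (dd e g) p + dd e (dd e h) p := by
  rw [dd_add (hg.differentiable two_ne_zero) (hh.differentiable two_ne_zero),
    dd_add ((contDiff_dd_one hg).differentiable one_ne_zero)
      ((contDiff_dd_one hh).differentiable one_ne_zero)]

lemma hasDerivAt_weight_rpow {t : ℝ} (ht : -(1 / 4) < t) (κ : ℝ) :
    HasDerivAt (fun s => weight s ^ κ) (κ / (1 + t) * weight t ^ κ) t := by
  have h1 : 0 < 1 + t := by linarith
  have h2 : HasDerivAt (fun s : ℝ => (1 + s) ^ κ) (1 * κ * (1 + t) ^ (κ - 1)) t :=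
    ((hasDerivAt_id' t).const_add 1).rpow_const (Or.inl h1.ne')
  have h3 : (fun s => weight s ^ κ) =ᶠ[𝓝 t] fun s => (1 + s) ^ κ := by
    filter_upwards [lt_mem_nhds ht] with s hs
    rw [weight_eq hs.le]
  refine (h2.congr_of_eventuallyEq h3).congr_deriv ?_
  rw [weight_eq ht.le, Real.rpow_sub_one h1.ne']
  ring

lemma contDiff_weight_rpow (κ : ℝ) : ContDiff ℝ ∞ fun s => weight s ^ κ :=
  contDiff_weight.rpow_const_of_ne fun s => (weight_pos s).ne'

/-- The Liouville substitution `u = (1 + t)^{-μ/2} v` removes the damping term. -/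
theorem liouville_wave {μ ν : ℝ} {v : ℝ × Space n → ℝ} (hv : ContDiff ℝ 2 v) {g : ℝ}
    {t : ℝ} (ht : 0 ≤ t) (x : Space n)
    (hwave : dd (eT n) (dd (eT n) v) (t, x) - lapAlong eX v (t, x)
      + (ν ^ 2 - μ ^ 2 / 4 + μ / 2) / (1 + t) ^ 2 * v (t, x) = (1 + t) ^ (μ / 2) * g) :
    dd (eT n) (dd (eT n) fun q => weight q.1 ^ (-μ / 2) * v q) (t, x)
      - lapAlong eX (fun q => weight q.1 ^ (-μ / 2) * v q) (t, x)
      + μ / (1 + t) * dd (eT n) (fun q => weight q.1 ^ (-μ / 2) * v q) (t, x)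
      + ν ^ 2 / (1 + t) ^ 2 * (weight t ^ (-μ / 2) * v (t, x)) = g := by
  set ρ : ℝ → ℝ := fun s => weight s ^ (-μ / 2) with hρ
  have hρc : ContDiff ℝ ∞ ρ := contDiff_weight_rpow _
  have ht' : -(1 / 4) < t := by linarith
  have h1 : 0 < 1 + t := by linarith
  have hvd : Differentiable ℝ v := hv.differentiable two_ne_zero
  have hd : ∀ w, Differentiable ℝ (dd w v) := fun w =>
    (contDiff_dd_one hv).differentiable one_ne_zero
  have hρ1 : ContDiff ℝ 1 (deriv ρ) :=
    ContDiff.deriv' (by simpa [one_add_one_eq_two] using hρc.of_le two_le_infty)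
  have hfst : ∀ w : ℝ × Space n, dd w (fun q : ℝ × Space n => q.1) = fun _ => w.1 := fun w =>
    funext fun q => dd_eq_of_hasFDerivAt (hasFDerivAt_fst (p := q))
  have dρ : Differentiable ℝ fun q : ℝ × Space n => ρ q.1 :=
    (hρc.differentiable (by simp)).comp differentiable_fst
  have dρ1 : Differentiable ℝ fun q : ℝ × Space n => deriv ρ q.1 :=
    (hρ1.differentiable one_ne_zero).comp differentiable_fst
  have e1 : ∀ w, dd w (fun q => ρ q.1 * v q)
      = fun q => deriv ρ q.1 * w.1 * v q + ρ q.1 * dd w v q := fun w => by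
    rw [dd_mul dρ hvd, dd_comp_scalar (hρc.differentiable (by simp)) differentiable_fst, hfst]
  have eX' : ∀ i, dd (eX i) (dd (eX i) fun q => ρ q.1 * v q)
      = fun q => ρ q.1 * dd (eX i) (dd (eX i) v) q := fun i => by
    have : dd (eX i) (fun q => ρ q.1 * v q) = fun q => ρ q.1 * dd (eX i) v q := by
      rw [e1]; ext q; simp [eX]
    rw [this, dd_mul dρ (hd _), dd_comp_scalar (hρc.differentiable (by simp)) differentiable_fst,
      hfst]
    ext q; simp [eX]
  have eT1 : dd (eT n) (fun q => ρ q.1 * v q)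
      = fun q => deriv ρ q.1 * v q + ρ q.1 * dd (eT n) v q := by
    rw [e1]; ext q; simp [eT]
  have eT2 : dd (eT n) (dd (eT n) fun q => ρ q.1 * v q)
      = fun q => deriv (deriv ρ) q.1 * v q + 2 * (deriv ρ q.1 * dd (eT n) v q)
        + ρ q.1 * dd (eT n) (dd (eT n) v) q := by
    rw [eT1, dd_add (dρ1.fun_mul hvd) (dρ.fun_mul (hd _)), dd_mul dρ1 hvd, dd_mul dρ (hd _),
      dd_comp_scalar (hρc.differentiable (by simp)) differentiable_fst,
      dd_comp_scalar (hρ1.differentiable one_ne_zero) differentiable_fst, hfst]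
    ext q
    simp only [eT]
    ring
  have hlap : lapAlong eX (fun q => ρ q.1 * v q) (t, x) = ρ t * lapAlong eX v (t, x) := by
    simp only [lapAlong, eX', Finset.mul_sum]
  have r1 : ∀ s, -(1 / 4) < s → deriv ρ s = -μ / 2 / (1 + s) * ρ s := fun s hs =>
    (hasDerivAt_weight_rpow hs _).deriv
  have r2 : deriv (deriv ρ) t = μ / 2 * (μ / 2 + 1) / (1 + t) ^ 2 * ρ t := by
    have h2 : HasDerivAt (fun s => -μ / 2 / (1 + s) * ρ s)
        (μ / 2 * (μ / 2 + 1) / (1 + t) ^ 2 * ρ t) t := by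
      refine ((((hasDerivAt_id' t).const_add 1).inv h1.ne').const_mul (-μ / 2) |>.fun_mul
        (hasDerivAt_weight_rpow ht' (-μ / 2))).congr_deriv ?_
      simp only [Pi.inv_apply, hρ]
      field_simp
      ring
    refine (h2.congr_of_eventuallyEq ?_).deriv
    filter_upwards [lt_mem_nhds ht'] with s hs using r1 s hs
  have r3 : ρ t * (1 + t) ^ (μ / 2) = 1 := by
    simp only [hρ]
    rw [weight_eq ht'.le, ← Real.rpow_add h1]
    simp [neg_div]
  rw [eT2, hlap, eT1]
  simp only [r1 t ht', r2]
  change _ + ν ^ 2 / (1 + t) ^ 2 * (ρ t * v (t, x)) = g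
  -- `μ/2 (μ/2 + 1) - μ²/2 + ν² = ν² - μ²/4 + μ/2`, and the terms in `v_t` cancel.
  have h3 : g = ρ t * (dd (eT n) (dd (eT n) v) (t, x) - lapAlong eX v (t, x)
      + (ν ^ 2 - μ ^ 2 / 4 + μ / 2) / (1 + t) ^ 2 * v (t, x)) := by
    rw [hwave, ← mul_assoc, r3, one_mul]
  rw [h3]
  field_simp
  ring

end Liouville

section FreeWaves

variable {n k : ℕ} {F : ℝ × Space n → ℝ}

lemma waveV_wave (hn : n = 2 * k + 3) (hF : ContDiff ℝ (k + 2 : ℕ) F) {p : ℝ × ℝ × Space n}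
    (hp : 0 ≤ p.1) : dd (eR n) (dd (eR n) (waveV k F)) p = lapAlong eY (waveV k F) p := by
  rw [dd_dd_waveV hn hF hp, lapAlong_waveV hF]

lemma contDiff_two_waveV (hF : ContDiff ℝ (k + 2 : ℕ) F) : ContDiff ℝ 2 (waveV k F) := by
  exact_mod_cast contDiff_waveV (i := 2) (by rwa [add_comm])

lemma contDiff_three_waveV (hF : ContDiff ℝ (k + 3 : ℕ) F) : ContDiff ℝ (2 + 1) (waveV k F) := by
  exact_mod_cast contDiff_waveV (i := 3) (by rwa [add_comm])

/-- Functions that agree for `r ≥ 0` have the same `r`-derivative for `r ≥ 0`. -/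
lemma dd_eR_congr {g h : ℝ × ℝ × Space n → ℝ} (hg : Differentiable ℝ g) (hh : Differentiable ℝ h)
    (hgh : ∀ p : ℝ × ℝ × Space n, 0 ≤ p.1 → g p = h p) {p : ℝ × ℝ × Space n} (hp : 0 ≤ p.1) :
    dd (eR n) g p = dd (eR n) h p := by
  obtain ⟨r, y⟩ := p
  have h1 := (hasDerivAt_left hg r y).hasDerivWithinAt (s := Ici 0)
  have h2 := (hasDerivAt_left hh r y).hasDerivWithinAt (s := Ici 0)
  have h3 := h2.congr (fun s hs => hgh (s, y) hs) (hgh (r, y) hp)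
  exact (uniqueDiffOn_Ici (0 : ℝ) r hp).eq_deriv _ h1 h3

lemma dd_eR_waveV_wave (hn : n = 2 * k + 3) (hF : ContDiff ℝ (k + 3 : ℕ) F)
    {p : ℝ × ℝ × Space n} (hp : 0 ≤ p.1) :
    dd (eR n) (dd (eR n) (dd (eR n) (waveV k F))) p = lapAlong eY (dd (eR n) (waveV k F)) p := by
  have hF2 : ContDiff ℝ (k + 2 : ℕ) F := hF.of_le (by exact_mod_cast Nat.le_succ _)
  have hV3 := contDiff_three_waveV hF
  have hV2 : ContDiff ℝ 2 (waveV k F) := contDiff_two_waveV hF2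
  have hd2 : ∀ v, ContDiff ℝ 2 (dd v (waveV k F)) := fun v => contDiff_dd hV3
  have hd1 : ∀ v w, Differentiable ℝ (dd w (dd v (waveV k F))) := fun v w =>
    (contDiff_dd_one (hd2 v)).differentiable one_ne_zero
  have hl : Differentiable ℝ (lapAlong eY (waveV k F)) := by
    unfold lapAlong
    exact Differentiable.fun_sum fun i _ => hd1 _ _
  rw [dd_eR_congr (hd1 _ _) hl (fun p hp => waveV_wave hn hF2 hp) hp]
  unfold lapAlong
  rw [dd_sum fun i _ => hd1 _ _]
  refine Finset.sum_congr rfl fun i _ => ?_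
  rw [dd_comm (hd2 _), dd_comm hV2]

end FreeWaves

section Solution

variable {n k : ℕ} {μ ν : ℝ} {P : ℝ → ℝ} {F : ℝ × Space n → ℝ} {u₀ u₁ : Space n → ℝ}

/-- The solution of `v_tt - Δv + l/(1+t)² v = (1+t)^{μ/2} F`, `v(0) = u₀`, `v_t(0) = u₁ + μ/2 u₀`,
with `l = ν² - μ²/4 + μ/2`, assembled from transmuted free waves. -/
def liouvilleSolution (k : ℕ) (μ : ℝ) (P : ℝ → ℝ) (F : ℝ × Space n → ℝ) (u₀ u₁ : Space n → ℝ)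
    (q : ℝ × Space n) : ℝ :=
  slice (transmute (dd (eR n) (waveV k fun p => u₀ p.2)) fun p => -dd kB (kerR P) p) q
    + slice (transmute (waveV k fun p => u₁ p.2 + μ / 2 * u₀ p.2) fun p => -dd kS (kerR P) p) q
    + superpose (transmute (waveV k fun p => weight p.1 ^ (μ / 2) * F p)
      fun p => -dd kS (kerR P) p) q

/-- The solution of the Cauchy problem. -/
def solution (k : ℕ) (μ : ℝ) (P : ℝ → ℝ) (F : ℝ × Space n → ℝ) (u₀ u₁ : Space n → ℝ)
    (q : ℝ × Space n) : ℝ :=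
  weight q.1 ^ (-μ / 2) * liouvilleSolution k μ P F u₀ u₁ q

theorem isClassicalSolution_solution (hn : n = 2 * k + 3) {f : ℝ → Space n → ℝ}
    (hF : ContDiff ℝ (k + 2 : ℕ) F) (hFf : ∀ t, 0 ≤ t → ∀ x, F (t, x) = f t x)
    (hu₀ : ContDiff ℝ (k + 3 : ℕ) u₀) (hu₁ : ContDiff ℝ (k + 2 : ℕ) u₁)
    (hP : ContDiff ℝ ∞ P) (hP0 : P 0 = 1)
    (hode : ∀ q, -(1 / 8) < q → q * (1 + q) * deriv (deriv P) q + (1 + 2 * q) * deriv P q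
      + (ν ^ 2 - μ ^ 2 / 4 + μ / 2) * P q = 0) :
    IsClassicalSolution μ ν f u₀ u₁ fun t x => solution k μ P F u₀ u₁ (t, x) := by
  have hKS := isTransmutationKernel_kS hP hP0 hode
  have hKB := isTransmutationKernel_kB hP hP0 hode
  have hKS0 : ∀ t b, -dd kS (kerR P) (t, b, 0) = 0 := fun t b => by
    rw [dd_kS_kerR_zero hP, neg_zero]
  have hKB0 : ∀ t b, dd kS (fun p => -dd kB (kerR P) p) (t, b, 0) = 0 := fun t b => by
    rw [dd_neg]
    simp only [dd_kS_dd_kB_kerR_zero hP, neg_zero]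
  have hg0 : ContDiff ℝ (k + 3 : ℕ) fun p : ℝ × Space n => u₀ p.2 := hu₀.comp contDiff_snd
  have hg0' : ContDiff ℝ (k + 2 : ℕ) fun p : ℝ × Space n => u₀ p.2 :=
    hg0.of_le (by exact_mod_cast Nat.le_succ _)
  have hg1 : ContDiff ℝ (k + 2 : ℕ) fun p : ℝ × Space n => u₁ p.2 + μ / 2 * u₀ p.2 :=
    (hu₁.comp contDiff_snd).add (contDiff_const.mul hg0')
  have hg2 : ContDiff ℝ (k + 2 : ℕ) fun p : ℝ × Space n => weight p.1 ^ (μ / 2) * F p :=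
    (((contDiff_weight_rpow (μ / 2)).comp contDiff_fst).of_le
      (WithTop.coe_le_coe.2 le_top)).mul hF
  have hg0'' : ContDiff ℝ (k + 1 : ℕ) fun p : ℝ × Space n => u₀ p.2 :=
    hg0'.of_le (by exact_mod_cast Nat.le_succ _)
  have hg1' := hg1.of_le (m := (k + 1 : ℕ)) (by exact_mod_cast Nat.le_succ _)
  have hg2' := hg2.of_le (m := (k + 1 : ℕ)) (by exact_mod_cast Nat.le_succ _)
  set W0 := dd (eR n) (waveV k fun p : ℝ × Space n => u₀ p.2) with hW0
  set W1 := waveV k fun p : ℝ × Space n => u₁ p.2 + μ / 2 * u₀ p.2 with hW1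
  set W2 := waveV k fun p : ℝ × Space n => weight p.1 ^ (μ / 2) * F p with hW2
  set KB : ℝ × ℝ × ℝ → ℝ := fun p => -dd kB (kerR P) p with hKBdef
  set KS : ℝ × ℝ × ℝ → ℝ := fun p => -dd kS (kerR P) p with hKSdef
  have c0 : ContDiff ℝ 2 W0 := contDiff_dd (contDiff_three_waveV hg0)
  have c1 : ContDiff ℝ 2 W1 := contDiff_two_waveV hg1
  have c2 : ContDiff ℝ 2 W2 := contDiff_two_waveV hg2
  have t0 : ContDiff ℝ 2 (transmute W0 KB) := by
    exact_mod_cast contDiff_transmute (k := 2) (by exact_mod_cast c0) (by exact_mod_cast hKB.contDiff)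
  have t1 : ContDiff ℝ 2 (transmute W1 KS) := by
    exact_mod_cast contDiff_transmute (k := 2) (by exact_mod_cast c1) (by exact_mod_cast hKS.contDiff)
  have t2 : ContDiff ℝ 2 (transmute W2 KS) := by
    exact_mod_cast contDiff_transmute (k := 2) (by exact_mod_cast c2) (by exact_mod_cast hKS.contDiff)
  have s2 : ContDiff ℝ 2 (superpose (transmute W2 KS)) := by
    exact_mod_cast contDiff_superpose (k := 2) (by exact_mod_cast t2)
  have s0 := contDiff_slice t0
  have s1 := contDiff_slice t1
  have z1 : ∀ b x, W1 (0, b, x) = 0 := fun b x => waveV_zero b x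
  have z2 : ∀ b x, W2 (0, b, x) = 0 := fun b x => waveV_zero b x
  have z0 : ∀ b x, dd (eR n) W0 (0, b, x) = 0 := fun b x => by
    rw [hW0, dd_dd_waveV hn hg0' le_rfl, waveV_zero]
  -- The boundary term at `s = 0` vanishes because `∂_r W0 = 0` and `∂_s ∂_b R = 0` there, respectively
  -- because `W1 = W2 = 0` and `∂_s R = 0`.
  have w0 := fun (t b : ℝ) (x : Space n) (hb : 0 ≤ b) (hbt : b ≤ t) =>
    transmute_wave c0 hKB (fun p hp => dd_eR_waveV_wave hn hg0 hp)
      (fun t b x => by rw [z0, hKB0]; ring) hb hbt x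
  have w1 := fun (t b : ℝ) (x : Space n) (hb : 0 ≤ b) (hbt : b ≤ t) =>
    transmute_wave c1 hKS (fun p hp => waveV_wave hn hg1 hp)
      (fun t b x => by rw [z1, hKSdef]; simp only [hKS0]; ring) hb hbt x
  have w2 := fun (t b : ℝ) (x : Space n) (hb : 0 ≤ b) (hbt : b ≤ t) =>
    transmute_wave c2 hKS (fun p hp => waveV_wave hn hg2 hp)
      (fun t b x => by rw [z2, hKSdef]; simp only [hKS0]; ring) hb hbt x
  have hT20 : ∀ t x, transmute W2 KS (t, t, x) = 0 := fun t x => by rw [transmute_self, z2]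
  set v : ℝ × Space n → ℝ := liouvilleSolution k μ P F u₀ u₁ with hv
  have hv' : v = fun q => (slice (transmute W0 KB) q + slice (transmute W1 KS) q)
      + superpose (transmute W2 KS) q := rfl
  have hvc : ContDiff ℝ 2 v := (s0.add s1).add s2
  have hvT : dd (eT n) v = fun q => (slice (dd (eR n) (transmute W0 KB)) q
      + slice (dd (eR n) (transmute W1 KS)) q)
      + (transmute W2 KS (q.1, q.1, q.2) + superpose (dd (eR n) (transmute W2 KS)) q) := by
    rw [hv', dd_add ((s0.add s1).differentiable two_ne_zero) (s2.differentiable two_ne_zero),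
      dd_add (s0.differentiable two_ne_zero) (s1.differentiable two_ne_zero),
      dd_eT_slice (t0.differentiable two_ne_zero), dd_eT_slice (t1.differentiable two_ne_zero),
      dd_eT_superpose (t2.of_le (by norm_num))]
  have v0 : ∀ x, v (0, x) = u₀ x := fun x => by
    simp only [hv', slice, transmute_self, z1, superpose, intervalIntegral.integral_same, add_zero]
    exact dd_eR_waveV_zero hn hg0'' 0 x
  have v1 : ∀ x, dd (eT n) v (0, x) = u₁ x + μ / 2 * u₀ x := fun x => by
    simp only [hvT, slice, superpose, intervalIntegral.integral_same, add_zero, hT20]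
    rw [dd_eR_transmute_self (c0.of_le (by norm_num)) (hKB.contDiff.of_le (by norm_num))
      (hKB.diag_self 0 le_rfl), z0, zero_add,
      dd_eR_transmute_self (c1.of_le (by norm_num)) (hKS.contDiff.of_le (by norm_num))
      (hKS.diag_self 0 le_rfl)]
    exact dd_eR_waveV_zero hn hg1' 0 x
  have hρ0 : weight 0 ^ (-μ / 2) = 1 := by
    rw [weight_eq (by norm_num), add_zero, Real.one_rpow]
  refine isClassicalSolution_of_contDiff (F := solution k μ P F u₀ u₁) ?_ (fun t ht x => ?_)
    (fun x => ?_) fun x => ?_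
  · exact (((contDiff_weight_rpow (-μ / 2)).comp contDiff_fst).of_le two_le_infty).mul hvc
  · have h1 : 0 < 1 + t := by linarith
    refine liouville_wave hvc ht.le x ?_
    have e0 := slice_wave t0 w0 ht.le x
    have e1 := slice_wave t1 w1 ht.le x
    have e2 := superpose_wave t2 hT20 w2 ht.le x
    rw [dd_eR_transmute_self (c2.of_le (by norm_num)) (hKS.contDiff.of_le (by norm_num))
      (hKS.diag_self t ht.le), hW2, dd_eR_waveV_zero hn hg2', hFf t ht.le,
      weight_eq (by linarith)] at e2
    rw [hv', dd_dd_add (s0.add s1) s2, dd_dd_add s0 s1, lapAlong_add (s0.add s1) s2,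
      lapAlong_add s0 s1, ← e2]
    linear_combination e0 + e1
  · change weight 0 ^ (-μ / 2) * v (0, x) = _
    rw [hρ0, one_mul, v0]
  · have e1 := (hasDerivAt_weight_rpow (show -(1 / 4) < (0 : ℝ) by norm_num) (-μ / 2)).fun_mul
      (hasDerivAt_left (hvc.differentiable two_ne_zero) 0 x)
    have e2 : HasDerivAt (fun s => solution k μ P F u₀ u₁ (s, x)) _ 0 := e1
    have e3 := hasDerivAt_left (h := solution k μ P F u₀ u₁)
      (((((contDiff_weight_rpow (-μ / 2)).comp contDiff_fst).of_le
        two_le_infty).mul hvc).differentiable two_ne_zero) 0 x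
    have e4 := v1 x
    change dd (1, 0) (solution k μ P F u₀ u₁) (0, x) = _
    change dd (1, 0) v (0, x) = _ at e4
    rw [e3.unique e2, hρ0, v0, e4]
    ring

end Solution

/-! ### The representation formula -/

section Kernel

variable {μ ν : ℝ} {P : ℝ → ℝ}

lemma sqrtDelta_sq (μ ν : ℝ) : sqrtDelta μ ν ^ 2 = (((μ - 1) ^ 2 - 4 * ν ^ 2 : ℝ) : ℂ) := by
  rw [sqrtDelta, one_div]
  exact Complex.cpow_nat_inv_pow _ two_ne_zero

/-- The parameter `a = (1 - √δ)/2` of the hypergeometric function. -/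
def hyperParam (μ ν : ℝ) : ℂ := (1 - sqrtDelta μ ν) / 2

lemma hyperParam_mul (μ ν : ℝ) :
    hyperParam μ ν * (1 - hyperParam μ ν) = ((ν ^ 2 - μ ^ 2 / 4 + μ / 2 : ℝ) : ℂ) := by
  have h := sqrtDelta_sq μ ν
  push_cast at h ⊢
  rw [hyperParam]
  linear_combination (-1 / 4) * h

/-- The kernel `E` in terms of the real profile: with `D = (t + b + 2)² - s²` one has
`D = 4 (1 + t) (1 + b) (1 + q)`, and the argument of the hypergeometric function is `q / (1 + q)`. -/
lemma kernelE_eq (hP : ∀ q, 0 ≤ q → profileC (hyperParam μ ν) q = P q) {t b s : ℝ}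
    (ht : -(1 / 4) < t) (hb : -(1 / 4) < b) (hq : 0 ≤ kerQ (t, b, s)) :
    kernelE μ ν t 0 b s = 2 ^ (sqrtDelta μ ν - 1)
      * ((weight t ^ (-μ / 2) * (weight b ^ (μ / 2) * kerR P (t, b, s)) : ℝ) : ℂ) := by
  have hT : 0 < 1 + t := by linarith
  have hB : 0 < 1 + b := by linarith
  have hTc : ((1 + t : ℝ) : ℂ) ≠ 0 := by exact_mod_cast hT.ne'
  have hBc : ((1 + b : ℝ) : ℂ) ≠ 0 := by exact_mod_cast hB.ne'
  set q := kerQ (t, b, s) with hqdef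
  have hqe : q = ((t - b) ^ 2 - s ^ 2) / (4 * (1 + t) * (1 + b)) := kerQ_eq ht hb s
  have hQ : 0 < 1 + q := by linarith
  have hD : (t + b + 2) ^ 2 - (s - 0) ^ 2 = (2 * 2) * (1 + t) * (1 + b) * (1 + q) := by
    rw [hqe]; field_simp; ring
  have hz : ((t - b) ^ 2 - (s - 0) ^ 2) / ((t + b + 2) ^ 2 - (s - 0) ^ 2) = q / (1 + q) := by
    have h1 : (t - b) ^ 2 - (s - 0) ^ 2 = (2 * 2) * (1 + t) * (1 + b) * q := by
      rw [hqe]; field_simp; ring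
    rw [hD, h1, mul_div_mul_left _ _ (by positivity)]
  have ha : (sqrtDelta μ ν - 1) / 2 = -hyperParam μ ν := by rw [hyperParam]; ring
  have hR : ((kerR P (t, b, s) : ℝ) : ℂ) = ((1 + q : ℝ) : ℂ) ^ (-hyperParam μ ν)
      * ordinaryHypergeometric (hyperParam μ ν) (hyperParam μ ν) (1 : ℂ)
        ((q / (1 + q) : ℝ) : ℂ) := by
    rw [kerR, ← hqdef, ← hP q hq, profileC]
  have h2 : (2 : ℂ) ^ (sqrtDelta μ ν - 1)
      = ((2 : ℝ) : ℂ) ^ (-hyperParam μ ν) * ((2 : ℝ) : ℂ) ^ (-hyperParam μ ν) := by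
    rw [← Complex.cpow_add _ _ (by norm_num), ← ha, add_halves]
    norm_num
  have hpow : ((1 + t : ℝ) : ℂ) ^ hyperParam μ ν * ((1 + t : ℝ) : ℂ) ^ (-hyperParam μ ν) = 1 := by
    rw [← Complex.cpow_add _ _ hTc, add_neg_cancel, Complex.cpow_zero]
  have hpow' : ((1 + b : ℝ) : ℂ) ^ hyperParam μ ν * ((1 + b : ℝ) : ℂ) ^ (-hyperParam μ ν) = 1 := by
    rw [← Complex.cpow_add _ _ hBc, add_neg_cancel, Complex.cpow_zero]
  rw [kernelE, hz, hD, ha, Complex.ofReal_mul (2 * 2 * (1 + t) * (1 + b)),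
    Complex.mul_cpow_ofReal_nonneg (by positivity) hQ.le,
    Complex.ofReal_mul (2 * 2 * (1 + t)), Complex.mul_cpow_ofReal_nonneg (by positivity) hB.le,
    Complex.ofReal_mul (2 * 2), Complex.mul_cpow_ofReal_nonneg (by positivity) hT.le,
    Complex.ofReal_mul, Complex.mul_cpow_ofReal_nonneg (by positivity) (by positivity),
    h2, Complex.ofReal_mul, Complex.ofReal_mul, hR, weight_eq ht.le, weight_eq hb.le,
    Complex.ofReal_cpow hT.le, Complex.ofReal_cpow hB.le]
  change _ ^ (-(μ : ℂ) / 2 + hyperParam μ ν) * _ ^ ((μ : ℂ) / 2 + hyperParam μ ν) * _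
    * ordinaryHypergeometric (hyperParam μ ν) (hyperParam μ ν) (1 : ℂ) _ = _
  rw [Complex.cpow_add _ _ hTc, Complex.cpow_add _ _ hBc]
  push_cast at hpow hpow' ⊢
  set A := ((2 : ℂ) ^ (-hyperParam μ ν))
  set Y := ordinaryHypergeometric (hyperParam μ ν) (hyperParam μ ν) (1 : ℂ) ((q : ℂ) / (1 + q))
  set X := (1 + (q : ℂ)) ^ (-hyperParam μ ν)
  set T1 := (1 + (t : ℂ)) ^ (-(μ : ℂ) / 2)
  set B1 := (1 + (b : ℂ)) ^ ((μ : ℂ) / 2)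
  set T2 := (1 + (t : ℂ)) ^ hyperParam μ ν
  set B2 := (1 + (b : ℂ)) ^ hyperParam μ ν
  set B3 := (1 + (b : ℂ)) ^ (-hyperParam μ ν)
  linear_combination A * A * T1 * B1 * X * Y * (B2 * B3) * hpow + A * A * T1 * B1 * X * Y * hpow'

lemma kernelK0_eq (hPc : ContDiff ℝ ∞ P)
    (hP : ∀ q, 0 ≤ q → profileC (hyperParam μ ν) q = P q) {t s : ℝ} (hs : 0 ≤ s) (hst : s < t) :
    kernelK0 μ ν t 0 s = 2 ^ (sqrtDelta μ ν - 1)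
      * ((weight t ^ (-μ / 2) * (-(μ / 2) * kerR P (t, 0, s) - dd kB (kerR P) (t, 0, s)) : ℝ) : ℂ) := by
  have hcont : Continuous fun b => kerQ (t, b, s) := contDiff_kerQ.continuous.comp (by fun_prop)
  have h0 : 0 < kerQ (t, 0, s) := by
    rw [kerQ_eq (by linarith) (by norm_num)]
    have : 0 < (t - 0) ^ 2 - s ^ 2 := by nlinarith
    have h2 : 0 < 1 + t := by linarith
    positivity
  -- For `s < t` one has `q > 0` at `b = 0`, hence for all `b` near `0` of either sign. At `s = t` this
  -- fails, which is irrelevant for the integral.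
  have h1 : (fun b : ℝ => kernelE μ ν t 0 b s) =ᶠ[𝓝 0] fun b => 2 ^ (sqrtDelta μ ν - 1)
      * ((weight t ^ (-μ / 2) * (weight b ^ (μ / 2) * kerR P (t, b, s)) : ℝ) : ℂ) := by
    filter_upwards [hcont.continuousAt.eventually (lt_mem_nhds h0),
      lt_mem_nhds (show -(1 / 4) < (0 : ℝ) by norm_num)] with b hb hb'
    exact kernelE_eq hP (by linarith) hb' hb.le
  have h2 := hasDerivAt_comp_dd ((contDiff_kerR hPc).differentiable (by simp) (t, 0, s)) rfl
    (hasDerivAt_kB t 0 s)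
  have h3 := (((hasDerivAt_weight_rpow (show -(1 / 4) < (0 : ℝ) by norm_num) (μ / 2)).fun_mul
    h2).const_mul (weight t ^ (-μ / 2))).ofReal_comp.const_mul ((2 : ℂ) ^ (sqrtDelta μ ν - 1))
  rw [kernelK0, h1.deriv_eq, h3.deriv, weight_eq (show -(1 / 4) ≤ (0 : ℝ) by norm_num)]
  simp only [add_zero, Real.one_rpow]
  push_cast
  ring

end Kernel

section Formula

variable {n k : ℕ} {μ ν : ℝ} {P : ℝ → ℝ} {F : ℝ × Space n → ℝ} {u₀ u₁ : Space n → ℝ}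

/-- Integration by parts: the kernel `P(q)` acting on `∂_r V` is the transmutation of `V` with the
kernel `-∂_s P(q)`, since `q = 0` on the diagonal and `P(0) = 1`. -/
lemma integral_dd_eR_mul_kerR (hPc : ContDiff ℝ ∞ P) (hP0 : P 0 = 1) {V : ℝ × ℝ × Space n → ℝ}
    (hV : ContDiff ℝ 1 V) (t b : ℝ) (x : Space n) (hV0 : V (0, b, x) = 0) :
    ∫ s in (0 : ℝ)..(t - b), dd (eR n) V (s, b, x) * kerR P (t, b, s)
      = transmute V (fun p => -dd kS (kerR P) p) (t, b, x) := by
  have hR : ContDiff ℝ 1 (kerR P) := (contDiff_kerR hPc).of_le (by simp)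
  have cV : Continuous fun s : ℝ => dd (eR n) V (s, b, x) :=
    (continuous_dd hV).comp (by fun_prop)
  have cR : Continuous fun s : ℝ => dd kS (kerR P) (t, b, s) :=
    (continuous_dd hR).comp (by fun_prop)
  have h := intervalIntegral.integral_mul_deriv_eq_deriv_mul (a := 0) (b := t - b)
    (u := fun s => kerR P (t, b, s)) (v := fun s => V (s, b, x))
    (fun s _ => hasDerivAt_comp_dd (hR.differentiable one_ne_zero _) rfl (hasDerivAt_kS t b s))
    (fun s _ => hasDerivAt_left (hV.differentiable one_ne_zero) s (b, x))
    (cR.intervalIntegrable _ _) (cV.intervalIntegrable _ _)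
  have h1 : kerR P (t, b, t - b) = 1 := by rw [kerR, kerQ_diag, hP0]
  rw [h1, hV0, mul_zero, sub_zero, one_mul] at h
  rw [transmute, kerInt, shiftL_apply]
  calc ∫ s in (0 : ℝ)..(t - b), dd (eR n) V (s, b, x) * kerR P (t, b, s)
      = ∫ s in (0 : ℝ)..(t - b), kerR P (t, b, s) * dd (1, 0) V (s, b, x) :=
        intervalIntegral.integral_congr fun s _ => mul_comm _ _
    _ = _ := by
      rw [h, sub_eq_add_neg, ← intervalIntegral.integral_neg]
      congr 1
      exact intervalIntegral.integral_congr fun s _ => by simp only; ring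

/-- An integrand that on the open interval is a complex multiple of a continuous real function. -/
lemma intervalIntegral_eq_const_mul_ofReal {h : ℝ → ℂ} {g : ℝ → ℝ} {C : ℂ} {a : ℝ} (ha : 0 ≤ a)
    (hg : Continuous g) (hh : ∀ s, 0 < s → s < a → h s = C * (g s : ℂ)) :
    IntervalIntegrable h volume 0 a ∧
      ∫ s in (0 : ℝ)..a, h s = C * ((∫ s in (0 : ℝ)..a, g s : ℝ) : ℂ) := by
  have h1 : EqOn (fun s => C * (g s : ℂ)) h (Ioo 0 a) := fun s hs => (hh s hs.1 hs.2).symm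
  constructor
  · have h2 : Continuous fun s => C * (g s : ℂ) :=
      continuous_const.mul (Complex.continuous_ofReal.comp hg)
    exact (h2.intervalIntegrable 0 a).congr_uIoo (by rwa [uIoo_of_le ha])
  · rw [← intervalIntegral.integral_congr_Ioo_of_le ha h1, intervalIntegral.integral_const_mul,
      intervalIntegral.integral_ofReal]

lemma freeWave_eq_of_data (hn : n = 2 * k + 3) {φ : Space n → ℝ} (hφ : ContDiff ℝ (k + 1 : ℕ) φ)
    (b s : ℝ) (x : Space n) : freeWave φ s x = dd (eR n) (waveV k fun p => φ p.2) (s, b, x) :=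
  freeWave_eq (F := fun p : ℝ × Space n => φ p.2) hn (hφ.comp contDiff_snd) b s x

lemma contDiff_one_waveV (hF : ContDiff ℝ (k + 1 : ℕ) F) : ContDiff ℝ 1 (waveV k F) := by
  exact_mod_cast contDiff_waveV (i := 1) (by rwa [add_comm])

/-- The integral against `K₀`. -/
lemma integral_kernelK0 (hn : n = 2 * k + 3) (hu₀ : ContDiff ℝ (k + 1 : ℕ) u₀)
    (hPc : ContDiff ℝ ∞ P) (hP : ∀ q, 0 ≤ q → profileC (hyperParam μ ν) q = P q) {t : ℝ}
    (ht : 0 ≤ t) (x : Space n) :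
    IntervalIntegrable (fun s => (freeWave u₀ s x : ℂ) * kernelK0 μ ν t 0 s) volume 0 t ∧
      ∫ s in (0 : ℝ)..t, (freeWave u₀ s x : ℂ) * kernelK0 μ ν t 0 s
        = 2 ^ (sqrtDelta μ ν - 1) * ((weight t ^ (-μ / 2)
          * (-(μ / 2) * (∫ s in (0 : ℝ)..t, freeWave u₀ s x * kerR P (t, 0, s))
            + kerInt (dd (eR n) (waveV k fun p => u₀ p.2)) (fun p => -dd kB (kerR P) p)
              (t, 0, x)) : ℝ) : ℂ) := by
  have hV := contDiff_one_waveV (F := fun p : ℝ × Space n => u₀ p.2) (hu₀.comp contDiff_snd)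
  have hR : ContDiff ℝ 1 (kerR P) := (contDiff_kerR hPc).of_le (by simp)
  have c1 : Continuous fun s : ℝ => freeWave u₀ s x * kerR P (t, 0, s) := by
    simp only [freeWave_eq_of_data hn hu₀ 0]
    exact continuous_kerInt_integrand (continuous_dd hV) hR.continuous t 0 x
  have c2 : Continuous fun s : ℝ => dd (eR n) (waveV k fun p => u₀ p.2) (s, 0, x)
      * (fun p => -dd kB (kerR P) p) (t, 0, s) :=
    continuous_kerInt_integrand (continuous_dd hV) (continuous_dd hR).neg t 0 x
  have h := intervalIntegral_eq_const_mul_ofReal (h := fun s =>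
      (freeWave u₀ s x : ℂ) * kernelK0 μ ν t 0 s)
    (g := fun s => weight t ^ (-μ / 2) * (-(μ / 2) * (freeWave u₀ s x * kerR P (t, 0, s))
      + dd (eR n) (waveV k fun p => u₀ p.2) (s, 0, x) * -dd kB (kerR P) (t, 0, s)))
    (C := 2 ^ (sqrtDelta μ ν - 1)) ht (continuous_const.mul ((continuous_const.mul c1).add c2))
    fun s hs hst => by
      rw [kernelK0_eq hPc hP hs.le hst, freeWave_eq_of_data hn hu₀ 0]
      push_cast
      ring
  refine ⟨h.1, h.2.trans ?_⟩
  rw [intervalIntegral.integral_const_mul, intervalIntegral.integral_add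
    ((c1.intervalIntegrable _ _).const_mul _) (c2.intervalIntegrable _ _),
    intervalIntegral.integral_const_mul, kerInt]
  simp only [sub_zero]

/-- The integral against the kernel `E`. -/
lemma integral_kernelE (hn : n = 2 * k + 3) {φ : Space n → ℝ} (hφ : ContDiff ℝ (k + 1 : ℕ) φ)
    (hPc : ContDiff ℝ ∞ P) (hP : ∀ q, 0 ≤ q → profileC (hyperParam μ ν) q = P q) {t b : ℝ}
    (hb : 0 ≤ b) (hbt : b ≤ t) (x : Space n) :
    IntervalIntegrable (fun s => (freeWave φ s x : ℂ) * kernelE μ ν t 0 b s) volume 0 (t - b) ∧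
      ∫ s in (0 : ℝ)..(t - b), (freeWave φ s x : ℂ) * kernelE μ ν t 0 b s
        = 2 ^ (sqrtDelta μ ν - 1) * ((weight t ^ (-μ / 2) * (weight b ^ (μ / 2)
          * ∫ s in (0 : ℝ)..(t - b), freeWave φ s x * kerR P (t, b, s)) : ℝ) : ℂ) := by
  have hV := contDiff_one_waveV (F := fun p : ℝ × Space n => φ p.2) (hφ.comp contDiff_snd)
  have c1 : Continuous fun s : ℝ => freeWave φ s x * kerR P (t, b, s) := by
    simp only [freeWave_eq_of_data hn hφ b]
    exact continuous_kerInt_integrand (continuous_dd hV) (contDiff_kerR hPc).continuous t b x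
  have h := intervalIntegral_eq_const_mul_ofReal (h := fun s =>
      (freeWave φ s x : ℂ) * kernelE μ ν t 0 b s)
    (g := fun s => weight t ^ (-μ / 2) * (weight b ^ (μ / 2) * (freeWave φ s x * kerR P (t, b, s))))
    (C := 2 ^ (sqrtDelta μ ν - 1)) (sub_nonneg.2 hbt)
    (continuous_const.mul (continuous_const.mul c1)) fun s hs hst => by
      rw [kernelE_eq hP (by linarith) (by linarith) (kerQ_nonneg hs.le hst.le)]
      push_cast
      ring
  refine ⟨h.1, h.2.trans ?_⟩
  rw [intervalIntegral.integral_const_mul, intervalIntegral.integral_const_mul]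

/-- The integral of the source term against the kernel `E`, as a transmutation. -/
lemma integral_source (hn : n = 2 * k + 3) (hF : ContDiff ℝ (k + 1 : ℕ) F)
    (hPc : ContDiff ℝ ∞ P) (hP0 : P 0 = 1) (t b : ℝ) (x : Space n) :
    weight b ^ (μ / 2) * ∫ s in (0 : ℝ)..(t - b), freeWave (fun y => F (b, y)) s x * kerR P (t, b, s)
      = transmute (waveV k fun p => weight p.1 ^ (μ / 2) * F p) (fun p => -dd kS (kerR P) p)
        (t, b, x) := by
  have hG : ContDiff ℝ (k + 1 : ℕ) fun p : ℝ × Space n => weight p.1 ^ (μ / 2) * F p :=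
    (((contDiff_weight_rpow (μ / 2)).comp contDiff_fst).of_le
      (WithTop.coe_le_coe.2 le_top)).mul hF
  rw [← integral_dd_eR_mul_kerR hPc hP0 (contDiff_one_waveV hG) t b x (waveV_zero b x),
    ← intervalIntegral.integral_const_mul]
  refine intervalIntegral.integral_congr fun s _ => ?_
  rw [← freeWave_eq hn hG, freeWave_const_mul (weight b ^ (μ / 2)), mul_assoc]

/-- The integral of the second Cauchy datum against `K₁`, as a transmutation: half of the term
`μ u₀` compensates the derivative of the weight in `K₀`. -/
lemma integral_data (hn : n = 2 * k + 3) (hu₀ : ContDiff ℝ (k + 1 : ℕ) u₀)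
    (hu₁ : ContDiff ℝ (k + 1 : ℕ) u₁) (hPc : ContDiff ℝ ∞ P) (hP0 : P 0 = 1) (t : ℝ) (x : Space n) :
    ∫ s in (0 : ℝ)..t, freeWave (fun z => u₁ z + μ * u₀ z) s x * kerR P (t, 0, s)
      = transmute (waveV k fun p => u₁ p.2 + μ / 2 * u₀ p.2) (fun p => -dd kS (kerR P) p) (t, 0, x)
        + μ / 2 * ∫ s in (0 : ℝ)..t, freeWave u₀ s x * kerR P (t, 0, s) := by
  have hg : ContDiff ℝ (k + 1 : ℕ) fun y => u₁ y + μ / 2 * u₀ y :=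
    hu₁.add (contDiff_const.mul hu₀)
  have hG : ContDiff ℝ (k + 1 : ℕ) fun p : ℝ × Space n => u₁ p.2 + μ / 2 * u₀ p.2 :=
    hg.comp contDiff_snd
  have hc : ∀ {φ : Space n → ℝ}, ContDiff ℝ (k + 1 : ℕ) φ →
      Continuous fun s : ℝ => freeWave φ s x * kerR P (t, 0, s) := fun hφ => by
    simp only [freeWave_eq_of_data hn hφ 0]
    exact continuous_kerInt_integrand (continuous_dd (contDiff_one_waveV (hφ.comp contDiff_snd)))
      (contDiff_kerR hPc).continuous t 0 x
  have h1 := integral_dd_eR_mul_kerR hPc hP0 (contDiff_one_waveV hG) t 0 x (waveV_zero 0 x)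
  rw [sub_zero] at h1
  rw [← h1, ← intervalIntegral.integral_const_mul]
  have h2 : ∀ s, dd (eR n) (waveV k fun p : ℝ × Space n => u₁ p.2 + μ / 2 * u₀ p.2) (s, 0, x)
      = freeWave (fun y => u₁ y + μ / 2 * u₀ y) s x := fun s =>
    (freeWave_eq_of_data hn hg 0 s x).symm
  simp only [h2]
  rw [← intervalIntegral.integral_add ((hc hg).intervalIntegrable _ _)
    (((hc hu₀).intervalIntegrable _ _).const_mul _)]
  refine intervalIntegral.integral_congr fun s _ => ?_
  have h3 : (fun z => u₁ z + μ * u₀ z)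
      = fun z => (u₁ z + μ / 2 * u₀ z) + μ / 2 * u₀ z := by ext z; ring
  rw [h3, freeWave_add hn hg (contDiff_const.mul hu₀), freeWave_const_mul]
  ring

end Formula

end ScaleInvariantWave

end

open ScaleInvariantWave in
theorem theorem1p2 (n : ℕ) (hn : 3 ≤ n) (hodd : Odd n) (μ ν : ℝ) (hμ : 0 ≤ μ)
    (f : ℝ → Space n → ℝ) (u₀ u₁ : Space n → ℝ)
    (hf : ContDiffOn ℝ (((n + 1) / 2 : ℕ) : WithTop ℕ∞) (fun p : ℝ × Space n => f p.1 p.2)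
      (Ici 0 ×ˢ univ))
    (hu₀ : ContDiff ℝ (((n + 1) / 2 + 1 : ℕ) : WithTop ℕ∞) u₀)
    (hu₁ : ContDiff ℝ (((n + 1) / 2 : ℕ) : WithTop ℕ∞) u₁) :
    -- all the integrals in the formula converge
    (∀ t : ℝ, 0 ≤ t → ∀ x : Space n,
      IntervalIntegrable (fun s => (freeWave u₀ s x : ℂ) * kernelK0 μ ν t 0 s) volume 0 t ∧
      IntervalIntegrable (fun s => (freeWave (fun z => u₁ z + μ * u₀ z) s x : ℂ)
        * kernelK1 μ ν t 0 s) volume 0 t ∧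
      (∀ b ∈ Icc 0 t, IntervalIntegrable (fun s => (freeWave (f b) s x : ℂ)
        * kernelE μ ν t 0 b s) volume 0 (t - b)) ∧
      IntervalIntegrable (fun b => ∫ s in (0 : ℝ)..(t - b), (freeWave (f b) s x : ℂ)
        * kernelE μ ν t 0 b s) volume 0 t) ∧
    -- the solution exists, is given by the formula, and is unique
    ∃ u : ℝ → Space n → ℝ, IsClassicalSolution μ ν f u₀ u₁ u ∧
      (∀ t : ℝ, 0 ≤ t → ∀ x : Space n,
        (u t x : ℂ) =
          ((1 + t : ℝ) : ℂ) ^ (-(μ : ℂ) / 2) * (freeWave u₀ t x : ℂ)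
          + 1 / (2 : ℂ) ^ (sqrtDelta μ ν - 1)
            * (∫ s in (0 : ℝ)..t, (freeWave u₀ s x : ℂ) * kernelK0 μ ν t 0 s)
          + 1 / (2 : ℂ) ^ (sqrtDelta μ ν - 1)
            * (∫ s in (0 : ℝ)..t, (freeWave (fun z => u₁ z + μ * u₀ z) s x : ℂ)
                * kernelK1 μ ν t 0 s)
          + 1 / (2 : ℂ) ^ (sqrtDelta μ ν - 1)
            * (∫ b in (0 : ℝ)..t, ∫ s in (0 : ℝ)..(t - b), (freeWave (f b) s x : ℂ)
                * kernelE μ ν t 0 b s)) ∧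
      ∀ v : ℝ → Space n → ℝ, IsClassicalSolution μ ν f u₀ u₁ v →
        ∀ t : ℝ, 0 ≤ t → ∀ x : Space n, v t x = u t x := by
  obtain ⟨k, hk⟩ : ∃ k, n = 2 * k + 3 := by
    obtain ⟨m, hm⟩ := hodd
    exact ⟨m - 1, by omega⟩
  have hk1 : (n + 1) / 2 = k + 2 := by omega
  rw [hk1] at hf hu₀ hu₁
  have hu₀' : ContDiff ℝ (k + 1 : ℕ) u₀ := hu₀.of_le (by exact_mod_cast (by omega : k + 1 ≤ k + 3))
  have hu₁' : ContDiff ℝ (k + 1 : ℕ) u₁ := hu₁.of_le (by exact_mod_cast Nat.le_succ _)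
  obtain ⟨F, hF, hFf'⟩ := exists_contDiff_extension hf
  have hFf : ∀ t : ℝ, 0 ≤ t → (fun y => F (t, y)) = f t := fun t ht => funext fun y => hFf' t ht y
  have hF' : ContDiff ℝ (k + 1 : ℕ) F := hF.of_le (by exact_mod_cast Nat.le_succ _)
  have hFb : ∀ b, ContDiff ℝ (k + 1 : ℕ) fun y => F (b, y) := fun b => hF'.comp (by fun_prop)
  obtain ⟨P, hPc, hP0, hode, hP⟩ := exists_profile (hyperParam_mul μ ν)
  have hE0 : ∀ t : ℝ, 0 ≤ t → ∀ x : Space n, _ := fun t ht x =>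
    integral_kernelK0 (μ := μ) (ν := ν) hk hu₀' hPc hP ht x
  have hE1 : ∀ t : ℝ, 0 ≤ t → ∀ x : Space n, _ := fun t ht x =>
    integral_kernelE (μ := μ) (ν := ν) (φ := fun z => u₁ z + μ * u₀ z) hk
      (hu₁'.add (contDiff_const.mul hu₀')) hPc hP
      le_rfl ht x
  have hE2 : ∀ t b : ℝ, 0 ≤ b → b ≤ t → ∀ x : Space n, _ := fun t b hb hbt x =>
    integral_kernelE (μ := μ) (ν := ν) hk (hFb b) hPc hP hb hbt x
  have hT : Continuous (transmute (waveV k fun p : ℝ × Space n => weight p.1 ^ (μ / 2) * F p)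
      fun p => -dd kS (kerR P) p) := by
    have hG : ContDiff ℝ (k + 1 : ℕ) fun p : ℝ × Space n => weight p.1 ^ (μ / 2) * F p :=
      (((contDiff_weight_rpow (μ / 2)).comp contDiff_fst).of_le
        (WithTop.coe_le_coe.2 le_top)).mul hF'
    refine (contDiff_transmute (k := 1) (by exact_mod_cast contDiff_one_waveV hG) ?_).continuous
    exact_mod_cast (isTransmutationKernel_kS hPc hP0 hode).contDiff.of_le
      (by norm_num : (1 : WithTop ℕ∞) ≤ 2)
  have hE3 : ∀ t : ℝ, 0 ≤ t → ∀ x : Space n, _ := fun t ht x =>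
    intervalIntegral_eq_const_mul_ofReal (h := fun b => ∫ s in (0 : ℝ)..(t - b),
        (freeWave (f b) s x : ℂ) * kernelE μ ν t 0 b s)
      (g := fun b => weight t ^ (-μ / 2)
        * transmute (waveV k fun p : ℝ × Space n => weight p.1 ^ (μ / 2) * F p)
          (fun p => -dd kS (kerR P) p) (t, b, x))
      (C := 2 ^ (sqrtDelta μ ν - 1)) ht
      (continuous_const.mul (hT.comp (by fun_prop : Continuous fun b : ℝ => (t, b, x))))
      fun b hb hbt => by
        rw [← hFf b hb.le, (hE2 t b hb.le hbt.le x).2, integral_source hk hF' hPc hP0]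
  have hsol := isClassicalSolution_solution (ν := ν) (μ := μ) hk hF hFf' hu₀ hu₁ hPc hP0 hode
  refine ⟨fun t ht x => ⟨(hE0 t ht x).1, ?_, fun b hb => ?_, (hE3 t ht x).1⟩, _, hsol,
    fun t ht x => ?_, fun v hv t ht x => hsol.unique hμ hv ht x⟩
  · simpa [kernelK1] using (hE1 t ht x).1
  · rw [← hFf b hb.1]
    exact (hE2 t b hb.1 hb.2 x).1
  · have e1 := (hE1 t ht x).2
    simp only [sub_zero, weight_eq (show -(1 / 4) ≤ (0 : ℝ) by norm_num), add_zero,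
      Real.one_rpow, one_mul] at e1
    have h2 : (2 : ℂ) ^ (sqrtDelta μ ν - 1) ≠ 0 := by simp [Complex.cpow_eq_zero_iff]
    have hρ : ((1 + t : ℝ) : ℂ) ^ (-(μ : ℂ) / 2) = ((weight t ^ (-μ / 2) : ℝ) : ℂ) := by
      rw [weight_eq (by linarith), Complex.ofReal_cpow (by linarith)]
      push_cast
      rfl
    have hc : ∀ z : ℂ, 1 / (2 : ℂ) ^ (sqrtDelta μ ν - 1) * (2 ^ (sqrtDelta μ ν - 1) * z) = z :=
      fun z => by field_simp
    simp only [kernelK1]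
    rw [(hE0 t ht x).2, e1, (hE3 t ht x).2, hc, hc, hc, hρ,
      integral_data hk hu₀' hu₁' hPc hP0, intervalIntegral.integral_const_mul]
    rw [← Complex.ofReal_mul, ← Complex.ofReal_add, ← Complex.ofReal_add, ← Complex.ofReal_add,
      Complex.ofReal_inj, freeWave_eq_of_data hk hu₀' 0]
    simp only [solution, liouvilleSolution, slice, superpose, transmute, shiftL_apply, sub_zero]
    ring
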